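/- **Theorem 3.3 (Consistency Formulation).** Let $\gamma>1$, $T>0$, $\Omega=(0,L_1)\times(0,L_2)$, with periodic or no-flux boundary conditions. For a state $\mathbf U=(\rho,\mathbf m,E)\in\mathbb R\times\mathbb R^2\times\mathbb R$ put $\mathbf u=\mathbf m/\rho$, $p=(\gamma-1)\big(E-\tfrac{|\mathbf m|^2}{2\rho}\big)$, $s=\log(p/\rho^\gamma)$, $\eta=-\tfrac{\rho s}{\gamma-1}$, $\mathcal U=(\rho,\mathbf m,\eta)$, and let $\mathbf f_k(\mathbf U)=(\rho u_k,\;u_k\mathbf m+p\,\mathbf e_k,\;u_k(E+p))$, $k=1,2$, be the Euler fluxes. *The scheme.* Let $q\ge1$ be the polynomial degree, let $-1=\xi_0<\dots<\xi_q=1$ and $\omega_0,\dots,\omega_q$ be the Gauss–Lobatto nodes and weights on $[-1,1]$, $L_l$ the Lagrange polynomials of the nodes, $D_{jl}=L_l'(\xi_j)$. Let $\Omega$ be divided into square cells $K$ of side $h$, and let $\mathbf U_{ab}=\mathbf U^K_{ab}(t)$ be the value of $\mathbf U^h(t,\cdot)|_K\in[\mathcal Q^q(K)]^4$ at the image of $(\xi_a,\xi_b)$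 under the affine map $[-1,1]^2\to K$. The function $\mathbf U^h$ is a solution of the DG scheme on $[0,T]$ if, for all $t\in[0,T]$, all cells $K$ and all $0\le a,b\le q$, $$\frac{\mathrm d}{\mathrm dt}\mathbf U_{ab}+\frac2h\cdot2\sum_{l=0}^q\Big(D_{al}\,\mathbf f^{vol}_1(\mathbf U_{ab},\mathbf U_{lb})+D_{bl}\,\mathbf f^{vol}_2(\mathbf U_{ab},\mathbf U_{al})\Big)=\frac2h\sum_{e}\frac1{\omega_e}\Big(\mathbf f(\mathbf U_{ab})\cdot\mathbf n_e-\mathbf f^{num}(\mathbf U_{ab},\mathbf U_{ab}^{+,e},\mathbf n_e)\Big),$$ where $e$ runs through the faces of $K$ that contain the node, $\mathbf n_e$ is the outer normal, $\omega_e=\omega_a$ for the faces with $\mathbf n_e=\pm\mathbf e_1$ and $\omega_e=\omega_b$ for those with $\mathbf n_e=\pm\mathbf e_2$, and $\mathbf U^{+,e}_{ab}$ is the trace from the neighbouring cell (taken periodically for periodic boundary conditions; at a wall, for no-flux conditions, it is the mirror state, obtained from $\mathbf U_{ab}$ by reversing the normal momentum). The surface flux is the local Lax–Friedrichs flux $$\mathbf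 f^{num}(\mathbf U^-,\mathbf U^+,\mathbf n)=\tfrac12\big(\mathbf f(\mathbf U^-)+\mathbf f(\mathbf U^+)\big)\cdot\mathbf n-\tfrac\lambda2(\mathbf U^+-\mathbf U^-),\qquad \lambda\ge\max\Big\{|\mathbf u^-|+\sqrt{\gamma p^- /\rho^-},\;|\mathbf u^+|+\sqrt{\gamma p^+/\rho^+}\Big\},$$ where $\lambda=\lambda(\mathbf U^-,\mathbf U^+)$ is symmetric in its arguments and may depend on $h$ and $t$ also. The volume flux is Ranocha's flux: with $\{\!\{x\}\!\}=\tfrac{x^++x^-}2$, $[\![x]\!]=x^+-x^-$, $\{\!\{x\}\!\}_{\log}=\tfrac{x^+-x^-}{\log x^+-\log x^-}$ (and $=x^+$ if $x^+=x^-$), the components of $\mathbf f^{vol}_k(\mathbf U^-,\mathbf U^+)$ are $$f_\rho=\{\!\{\rho\}\!\}_{\log}\{\!\{u_k\}\!\},\qquad f_{m_i}=\{\!\{u_i\}\!\}f_\rho+\delta_{ik}\{\!\{p\}\!\}\quad(i=1,2),$$ $$f_E=\Big(\{\!\{\rho\}\!\}_{\log}\big(\{\!\{u_1\}\!\}^2+\{\!\{u_2\}\!\}^2-\tfrac12\{\!\{u_1^2+u_2^2\}\!\}\big)+\tfrac1{\gamma-1}\tfrac{\{\!\{\rho\}\!\}_{\log}}{\{\!\{\rho/p\}\!\}_{\log}}+\{\!\{p\}\!\}\Big)\{\!\{u_k\}\!\}-\tfrac14[\![p]\!][\![u_k]\!].$$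 *Assumptions.* Let $(\mathbf U^h)$ be solutions of the scheme on $[0,T]$, with initial data $\mathbf U^h_0$, for a sequence of meshes with $h\to0$. Assume that there are constants $\underline\rho>0$, $\overline E$, $\underline s$, $\overline\lambda$, $c$, independent of $h$, $t$ and $\mathbf x$, such that 1. on $[0,T]\times\Omega$: $\rho^h\ge\underline\rho$, $E^h\le\overline E$, $p^h>0$ and $s^h\ge\underline s$; 2. $\lambda(\mathbf U^-,\mathbf U^+)\le\overline\lambda$ for all states satisfying the bounds in 1; 3. $|\mathcal U^h(t,\mathbf x_j)-\mathcal U^h(t,\mathbf x_l)|\le c\,h$ for all $t\in[0,T]$, all cells $K$ and all nodes $\mathbf x_j,\mathbf x_l\in K$. *Test functions.* $\varphi\in C^{q+1}([0,T]\times\overline\Omega)$, respectively $\boldsymbol\varphi\in C^{q+1}([0,T]\times\overline\Omega;\mathbb R^2)$. For periodic boundary conditions they take equal values at opposite boundary points of the rectangle. For no-flux conditions $\boldsymbol\varphi\cdot\mathbf n=0$ on $\partial\Omega$. *Conclusion.* There are errors $e_{\rho^h}(t,\varphi)$, $e_{\mathbf m^h}(t,\boldsymbol\varphi)$, $e_{\eta^h}(t,\varphi)$,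 integrable in $t\in(0,T)$, such that for every $h$ of the sequence and every $\tau\in(0,T]$: * for all scalar test functions $\varphi$: $$\Big[\int_\Omega\rho^h\varphi\,\mathrm d\mathbf x\Big]_{t=0}^{t=\tau}=\int_0^\tau\!\!\int_\Omega\rho^h\partial_t\varphi+\mathbf m^h\cdot\nabla_{\mathbf x}\varphi\,\mathrm d\mathbf x\,\mathrm dt+\int_0^\tau e_{\rho^h}(t,\varphi)\,\mathrm dt;$$ * for all vector test functions $\boldsymbol\varphi$: $$\Big[\int_\Omega\mathbf m^h\cdot\boldsymbol\varphi\,\mathrm d\mathbf x\Big]_{t=0}^{t=\tau}=\int_0^\tau\!\!\int_\Omega\mathbf m^h\cdot\partial_t\boldsymbol\varphi+\frac{\mathbf m^h\otimes\mathbf m^h}{\rho^h}:\nabla_{\mathbf x}\boldsymbol\varphi+p^h\operatorname{div}_{\mathbf x}\boldsymbol\varphi\,\mathrm d\mathbf x\,\mathrm dt+\int_0^\tau e_{\mathbf m^h}(t,\boldsymbol\varphi)\,\mathrm dt;$$ * for all scalar test functions $\varphi\ge0$: $$\Big[\int_\Omega\eta^h\varphi\,\mathrm d\mathbf x\Big]_{t=0}^{t=\tau}\le\int_0^\tau\!\!\int_\Omega\eta^h\partial_t\varphi+\eta^h\mathbf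 u^h\cdot\nabla_{\mathbf x}\varphi\,\mathrm d\mathbf x\,\mathrm dt+\int_0^\tau e_{\eta^h}(t,\varphi)\,\mathrm dt;$$ * $\displaystyle\int_\Omega E^h(\tau)\,\mathrm d\mathbf x=\int_\Omega E^h_0\,\mathrm d\mathbf x$; * for every fixed admissible test function, $\|e_{\rho^h}(\cdot,\varphi)\|_{L^1(0,T)}\to0$, $\|e_{\mathbf m^h}(\cdot,\boldsymbol\varphi)\|_{L^1(0,T)}\to0$ and $\|e_{\eta^h}(\cdot,\varphi)\|_{L^1(0,T)}\to0$ as $h\to0$. -/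

import Mathlib

open Set Filter Topology MeasureTheory

noncomputable section

namespace EulerDG

/-- The boundary conditions: periodic or no-flux (impermeable walls). -/
inductive BoundaryCondition where
  | periodic
  | noFlux

/-- A vector of conservative variables `(ρ, m₁, m₂, E)`. -/
abbrev State := Fin 4 → ℝ

/-- Density. -/
def dens (U : State) : ℝ := U 0

/-- Momentum component in the direction `a`. -/
def mom (U : State) (a : Fin 2) : ℝ := ![U 1, U 2] a

/-- Total energy. -/
def energy (U : State) : ℝ := U 3

/-- Velocity `u = m / ρ`. -/
def vel (U : State) (a : Fin 2) : ℝ := mom U a / dens U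

/-- Pressure of the ideal gas, `p = (γ - 1) (E - |m|² / (2ρ))`. -/
def pressure (γ : ℝ) (U : State) : ℝ :=
  (γ - 1) * (energy U - (mom U 0 ^ 2 + mom U 1 ^ 2) / (2 * dens U))

/-- Thermodynamic entropy `s = log (p / ρ ^ γ)`. -/
def thermoEntropy (γ : ℝ) (U : State) : ℝ := Real.log (pressure γ U / dens U ^ γ)

/-- Mathematical entropy `η = - ρ s / (γ - 1)`. -/
def mathEntropy (γ : ℝ) (U : State) : ℝ := -(dens U * thermoEntropy γ U) / (γ - 1)

/-- The conservative-entropy variables `(ρ, m₁, m₂, η)`. -/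
def consEntropyVars (γ : ℝ) (U : State) : Fin 4 → ℝ :=
  ![dens U, mom U 0, mom U 1, mathEntropy γ U]

/-- The Euler flux `f_a = (ρ u_a, u_a m + p e_a, u_a (E + p))` in the direction `a`. -/
def eulerFlux (γ : ℝ) (a : Fin 2) (U : State) : State :=
  ![dens U * vel U a,
    vel U a * mom U 0 + (if a = 0 then pressure γ U else 0),
    vel U a * mom U 1 + (if a = 1 then pressure γ U else 0),
    vel U a * (energy U + pressure γ U)]

/-- Modulus of the velocity plus speed of sound, `|u| + √(γ p / ρ)`. -/
def waveSpeed (γ : ℝ) (U : State) : ℝ :=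
  Real.sqrt (vel U 0 ^ 2 + vel U 1 ^ 2) + Real.sqrt (γ * pressure γ U / dens U)

/-- The two-state bound `λ_max = max (|u⁻| + c⁻) (|u⁺| + c⁺)`. -/
def lamMax (γ : ℝ) (Um Up : State) : ℝ := max (waveSpeed γ Um) (waveSpeed γ Up)

/-- The Lax-Friedrichs flux `f^num(U⁻, U⁺, n)` through a face with normal `n = sgn • e_a`,
`sgn = 1` or `sgn = -1`, with the viscosity coefficient `lam`. -/
def laxFriedrichs (γ lam : ℝ) (a : Fin 2) (sgn : ℝ) (Um Up : State) : State :=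
  (sgn / 2) • (eulerFlux γ a Um + eulerFlux γ a Up) - (lam / 2) • (Up - Um)

/-- Arithmetic mean. -/
def amean (x y : ℝ) : ℝ := (x + y) / 2

/-- Logarithmic mean (with its continuous extension to the diagonal). -/
def logMean (x y : ℝ) : ℝ := if x = y then x else (x - y) / (Real.log x - Real.log y)

/-- Ranocha's entropy conservative and kinetic energy preserving two-point flux in the
direction `a`. -/
def volumeFlux (γ : ℝ) (a : Fin 2) (U V : State) : State :=
  let u : Fin 2 → ℝ := fun b => amean (vel U b) (vel V b)
  let r : ℝ := logMean (dens U) (dens V)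
  let pm : ℝ := amean (pressure γ U) (pressure γ V)
  let fρ : ℝ := r * u a
  ![fρ,
    u 0 * fρ + (if a = 0 then pm else 0),
    u 1 * fρ + (if a = 1 then pm else 0),
    (r * (u 0 ^ 2 + u 1 ^ 2
          - amean (vel U 0 ^ 2 + vel U 1 ^ 2) (vel V 0 ^ 2 + vel V 1 ^ 2) / 2)
        + 1 / (γ - 1) * (r / logMean (dens U / pressure γ U) (dens V / pressure γ V))
        + pm) * u a
      - (pressure γ V - pressure γ U) * (vel V a - vel U a) / 4]

/-- `ξ`, `ω` are the nodes and weights of the Gauss-Lobatto rule with `p + 1` points on `[-1,1]`: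
the nodes are increasing, contain both end points, and the rule integrates the polynomials of
degree at most `2 p - 1` exactly. (This determines `ξ` and `ω` uniquely.) -/
structure IsGaussLobatto (p : ℕ) (ξ ω : Fin (p + 1) → ℝ) : Prop where
  strictMono : StrictMono ξ
  first : ξ 0 = -1
  last : ξ (Fin.last p) = 1
  exact : ∀ q : Polynomial ℝ, q.natDegree ≤ 2 * p - 1 →
    ∑ j, ω j * q.eval (ξ j) = ∫ x in (-1 : ℝ)..1, q.eval x

/-- The Lagrange polynomial `L_l` of the nodes `ξ`. -/
def lagrange {p : ℕ} (ξ : Fin (p + 1) → ℝ) (l : Fin (p + 1)) : Polynomial ℝ :=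
  Lagrange.basis Finset.univ ξ l

/-- The differentiation matrix `D_{jl} = L_l'(ξ_j)`. -/
def diffMatrix {p : ℕ} (ξ : Fin (p + 1) → ℝ) (j l : Fin (p + 1)) : ℝ :=
  (lagrange ξ l).derivative.eval (ξ j)

/-- A uniform mesh of squares of side `h` on the rectangle `[0, L₁] × [0, L₂]`. The cell with the
index `(i, j)`, `i < N₁`, `j < N₂`, is `[i h, (i+1) h] × [j h, (j+1) h]`. -/
structure Mesh (L₁ L₂ : ℝ) where
  N₁ : ℕ
  N₂ : ℕ
  h : ℝ
  h_pos : 0 < h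
  length₁ : N₁ * h = L₁
  length₂ : N₂ * h = L₂

/-- The nodal values of a piecewise polynomial vector field, `c i j a b` being the value in the
cell `(i, j)` at the node with reference coordinates `(ξ a, ξ b)`. Only the indices `i < N₁`,
`j < N₂` of the mesh at hand are used. -/
abbrev Coeffs (p : ℕ) := ℕ → ℕ → Fin (p + 1) → Fin (p + 1) → State

/-- The piecewise polynomial function (of degree at most `p` in each variable in each cell) with
the nodal values `c`. -/
def evalDG {L₁ L₂ : ℝ} (M : Mesh L₁ L₂) {p : ℕ} (ξ : Fin (p + 1) → ℝ) (c : Coeffs p)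
    (x : ℝ × ℝ) : State :=
  let i := ⌊x.1 / M.h⌋₊
  let j := ⌊x.2 / M.h⌋₊
  ∑ a, ∑ b, ((lagrange ξ a).eval (2 * (x.1 - i * M.h) / M.h - 1)
    * (lagrange ξ b).eval (2 * (x.2 - j * M.h) / M.h - 1)) • c i j a b

/-- The mirror state at a wall with normal in the direction `a`: the normal momentum is
reversed. -/
def mirror (a : Fin 2) (U : State) : State :=
  if a = 0 then ![U 0, -U 1, U 2, U 3] else ![U 0, U 1, -U 2, U 3]

/-- Exterior trace at the right face of the cell `(i, j)`, at the node with index `b` on it. -/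
def extRight {L₁ L₂ : ℝ} (bc : BoundaryCondition) (M : Mesh L₁ L₂) {p : ℕ} (c : Coeffs p)
    (i j : ℕ) (b : Fin (p + 1)) : State :=
  match bc with
  | .periodic => c ((i + 1) % M.N₁) j 0 b
  | .noFlux => if i + 1 < M.N₁ then c (i + 1) j 0 b else mirror 0 (c i j (Fin.last p) b)

/-- Exterior trace at the left face of the cell `(i, j)`. -/
def extLeft {L₁ L₂ : ℝ} (bc : BoundaryCondition) (M : Mesh L₁ L₂) {p : ℕ} (c : Coeffs p)
    (i j : ℕ) (b : Fin (p + 1)) : State :=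
  match bc with
  | .periodic => c ((i + M.N₁ - 1) % M.N₁) j (Fin.last p) b
  | .noFlux => if 0 < i then c (i - 1) j (Fin.last p) b else mirror 0 (c i j 0 b)

/-- Exterior trace at the top face of the cell `(i, j)`. -/
def extTop {L₁ L₂ : ℝ} (bc : BoundaryCondition) (M : Mesh L₁ L₂) {p : ℕ} (c : Coeffs p)
    (i j : ℕ) (a : Fin (p + 1)) : State :=
  match bc with
  | .periodic => c i ((j + 1) % M.N₂) a 0
  | .noFlux => if j + 1 < M.N₂ then c i (j + 1) a 0 else mirror 1 (c i j a (Fin.last p))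

/-- Exterior trace at the bottom face of the cell `(i, j)`. -/
def extBottom {L₁ L₂ : ℝ} (bc : BoundaryCondition) (M : Mesh L₁ L₂) {p : ℕ} (c : Coeffs p)
    (i j : ℕ) (a : Fin (p + 1)) : State :=
  match bc with
  | .periodic => c i ((j + M.N₂ - 1) % M.N₂) a (Fin.last p)
  | .noFlux => if 0 < j then c i (j - 1) a (Fin.last p) else mirror 1 (c i j a 0)

/-- The penalty `f(U⁻) · n - f^num(U⁻, U⁺, n)` at a point of a face with normal
`n = sgn • e_a`. -/
def facePenalty (γ : ℝ) (lam : State → State → ℝ) (a : Fin 2) (sgn : ℝ) (Um Up : State) : State :=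
  sgn • eulerFlux γ a Um - laxFriedrichs γ (lam Um Up) a sgn Um Up

/-- The time derivative that the entropy stable discontinuous Galerkin spectral element scheme
prescribes at the node `(a, b)` of the cell `(i, j)`: minus the flux differencing volume term, plus
the face terms, which are present only at the nodes on the respective faces. The factor `2 / h`
comes from the map of the reference element `[-1,1]²` onto the cell. -/
def dgRHS {L₁ L₂ : ℝ} (γ : ℝ) (bc : BoundaryCondition) (M : Mesh L₁ L₂) {p : ℕ}
    (ξ ω : Fin (p + 1) → ℝ) (lam : State → State → ℝ) (c : Coeffs p)
    (i j : ℕ) (a b : Fin (p + 1)) : State :=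
  let U := c i j a b
  (2 / M.h) •
    (-((2 : ℝ) • ∑ l, (diffMatrix ξ a l • volumeFlux γ 0 U (c i j l b)
          + diffMatrix ξ b l • volumeFlux γ 1 U (c i j a l)))
      + (if a = Fin.last p then
          (1 / ω a) • facePenalty γ lam 0 1 U (extRight bc M c i j b) else 0)
      + (if a = 0 then
          (1 / ω a) • facePenalty γ lam 0 (-1) U (extLeft bc M c i j b) else 0)
      + (if b = Fin.last p then
          (1 / ω b) • facePenalty γ lam 1 1 U (extTop bc M c i j a) else 0)
      + (if b = 0 then
          (1 / ω b) • facePenalty γ lam 1 (-1) U (extBottom bc M c i j a) else 0))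

/-- `U` (a time dependent family of nodal values) solves the semidiscrete scheme on `[0, T]`, the
Lax-Friedrichs viscosity at the time `t` being `lam t`. -/
def IsDGSolution {L₁ L₂ : ℝ} (γ : ℝ) (bc : BoundaryCondition) (M : Mesh L₁ L₂) {p : ℕ}
    (ξ ω : Fin (p + 1) → ℝ) (lam : ℝ → State → State → ℝ) (T : ℝ) (U : ℝ → Coeffs p) : Prop :=
  ∀ t ∈ Icc 0 T, ∀ i < M.N₁, ∀ j < M.N₂, ∀ a b,
    HasDerivWithinAt (fun s => U s i j a b) (dgRHS γ bc M ξ ω (lam t) (U t) i j a b) (Icc 0 T) t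

/-- Density at least `ρmin`, total energy at most `Emax`, positive pressure, and thermodynamic
entropy at least `smin`. -/
def IsBoundedState (γ ρmin Emax smin : ℝ) (U : State) : Prop :=
  ρmin ≤ dens U ∧ energy U ≤ Emax ∧ 0 < pressure γ U ∧ smin ≤ thermoEntropy γ U

/-- The closed rectangle `[0, L₁] × [0, L₂]`. -/
def rect (L₁ L₂ : ℝ) : Set (ℝ × ℝ) := Icc 0 L₁ ×ˢ Icc 0 L₂

/-- Partial derivative in time. -/
def dt (φ : ℝ → ℝ × ℝ → ℝ) (t : ℝ) (x : ℝ × ℝ) : ℝ := deriv (fun s => φ s x) t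

/-- Partial derivative in the spatial direction `a`. -/
def dx (a : Fin 2) (φ : ℝ → ℝ × ℝ → ℝ) (t : ℝ) (x : ℝ × ℝ) : ℝ :=
  if a = 0 then deriv (fun z => φ t (z, x.2)) x.1 else deriv (fun z => φ t (x.1, z)) x.2

/-- `φ ∈ C^k([0, T] × [0, L₁] × [0, L₂])`. -/
def IsSmoothTest (k : ℕ) (T L₁ L₂ : ℝ) (φ : ℝ → ℝ × ℝ → ℝ) : Prop :=
  ContDiffOn ℝ k (fun z : ℝ × (ℝ × ℝ) => φ z.1 z.2) (Icc 0 T ×ˢ rect L₁ L₂)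

/-- Equal values at opposite points of the boundary of the rectangle. -/
def IsPeriodicTest (T L₁ L₂ : ℝ) (φ : ℝ → ℝ × ℝ → ℝ) : Prop :=
  ∀ t ∈ Icc 0 T,
    (∀ y ∈ Icc 0 L₂, φ t (0, y) = φ t (L₁, y)) ∧ (∀ x ∈ Icc 0 L₁, φ t (x, 0) = φ t (x, L₂))

/-- Scalar test functions: of class `C^k` up to the boundary, and periodic if the boundary
conditions are. -/
def IsScalarTest (bc : BoundaryCondition) (k : ℕ) (T L₁ L₂ : ℝ) (φ : ℝ → ℝ × ℝ → ℝ) : Prop :=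
  IsSmoothTest k T L₁ L₂ φ ∧
    match bc with
    | .periodic => IsPeriodicTest T L₁ L₂ φ
    | .noFlux => True

/-- Vector valued test functions: of class `C^k` up to the boundary, and periodic (for periodic
boundary conditions) or with vanishing normal component at the walls (for no-flux boundary
conditions). -/
def IsVectorTest (bc : BoundaryCondition) (k : ℕ) (T L₁ L₂ : ℝ)
    (φ : Fin 2 → ℝ → ℝ × ℝ → ℝ) : Prop :=
  (∀ a, IsSmoothTest k T L₁ L₂ (φ a)) ∧
    match bc with
    | .periodic => ∀ a, IsPeriodicTest T L₁ L₂ (φ a)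
    | .noFlux => ∀ t ∈ Icc 0 T,
        (∀ y ∈ Icc 0 L₂, φ 0 t (0, y) = 0 ∧ φ 0 t (L₁, y) = 0) ∧
        (∀ x ∈ Icc 0 L₁, φ 1 t (x, 0) = 0 ∧ φ 1 t (x, L₂) = 0)

end EulerDG

end

/-! The density, the two momentum components and the entropy are treated together, as instances of
`IsBalanceLaw`: a density `G`, its gradient `g` and a potential `ψ` such that `(g V - g U) ·
f^vol(U, V) = ψ V - ψ U`. For a conserved variable `g` is constant and `ψ = 0`; for the entropy this
is the property for which Ranocha's flux is designed (`volumeFlux_entropy_conservative`).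

Multiply the scheme by `g` and by the nodal values of `φ`, and sum with the Gauss-Lobatto weights.
Summation by parts and the shuffle condition turn the volume terms into increments of `φ` times a
symmetric two-point flux, and leave one production term per face (`grid_identity`). For a conserved
variable this production vanishes. For the entropy it is at least a multiple of the squared jump
(`exists_le_faceProduction_entropy`): the production is an explicit combination of relative
entropies plus one term without a sign, and a viscosity that dominates `|u| + √(γ p / ρ)` absorbs
that term with the factor `√((γ - 1) / γ) < 1` to spare.

With `φ = 1` the entropy balance bounds the time integral of `h` times the sum of all squared jumps,
uniformly in the mesh (`integral_totalJump_le`). This weak control is indispensable: the hypotheses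
limit the variation inside a cell to `O(h)`, but say nothing about the jumps between cells.

Two consistency errors remain. The volume terms differ from the integral of `F · ∇φ` by `O(h³)` per
cell (`exists_volume_consistency`). The scheme provides a quadrature of `φ g(U) · ∂ₜU` where the
exact integral is wanted; in a cell the two differ by `O(h³ max |∂ₜU|)` (`exists_rate_consistency`),
and the scheme itself gives `|∂ₜU| ≤ C (1 + J / h)`, with `J` the sum of the jumps at the sides of
the cell (`exists_dgRHS_bound`). Hence the total error is `O(h)` plus a multiple of the sum of `h²
J` over the cells. Young's inequality with the parameter `√h` bounds the latter by `√h` times `1`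
plus the quantity controlled above (`exists_residual_bound`), so it tends to zero in `L¹(0, T)`
(`exists_defect_majorant`).

For the conserved variables the defect of the weak form is this small residual. For the entropy it
is the residual minus a nonnegative production, so its positive part is an admissible error. The
energy is tested with `1`: the volume terms vanish, the face terms cancel, and the quadrature of the
polynomial energy is exact. -/

noncomputable section

namespace EulerDG

/-! ### Gauss-Lobatto quadrature and the summation-by-parts property. -/

section Quadrature

variable {p : ℕ} {ξ ω : Fin (p + 1) → ℝ}

lemma eval_lagrange (hξ : StrictMono ξ) (l j : Fin (p + 1)) :
    (lagrange ξ l).eval (ξ j) = if l = j then 1 else 0 := by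
  unfold lagrange
  split_ifs with h
  · subst h
    exact Lagrange.eval_basis_self hξ.injective.injOn (Finset.mem_univ _)
  · exact Lagrange.eval_basis_of_ne h (Finset.mem_univ _)

lemma natDegree_lagrange (hξ : StrictMono ξ) (l : Fin (p + 1)) :
    (lagrange ξ l).natDegree = p := by
  have := Lagrange.degree_basis (s := Finset.univ) hξ.injective.injOn (Finset.mem_univ l)
  exact Polynomial.natDegree_eq_of_degree_eq_some (by simpa [lagrange] using this)

lemma sum_lagrange (hξ : StrictMono ξ) : ∑ l, lagrange ξ l = 1 :=
  Lagrange.sum_basis hξ.injective.injOn Finset.univ_nonempty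

lemma sum_eval_lagrange (hξ : StrictMono ξ) (x : ℝ) : ∑ l, (lagrange ξ l).eval x = 1 := by
  rw [← Polynomial.eval_finsetSum, sum_lagrange hξ, Polynomial.eval_one]

lemma sum_diffMatrix (hξ : StrictMono ξ) (j : Fin (p + 1)) : ∑ l, diffMatrix ξ j l = 0 := by
  unfold diffMatrix
  rw [← Polynomial.eval_finsetSum, ← Polynomial.derivative_sum, sum_lagrange hξ]
  simp

namespace IsGaussLobatto

variable (hGL : IsGaussLobatto p ξ ω)
include hGL

lemma mem_Icc (a : Fin (p + 1)) : ξ a ∈ Icc (-1 : ℝ) 1 := by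
  constructor
  · rw [← hGL.first]; exact hGL.strictMono.monotone (Fin.zero_le _)
  · rw [← hGL.last]; exact hGL.strictMono.monotone (Fin.le_last _)

lemma integral_lagrange (hp : 1 ≤ p) (a : Fin (p + 1)) :
    ∫ x in (-1 : ℝ)..1, (lagrange ξ a).eval x = ω a := by
  rw [← hGL.exact _ (by rw [natDegree_lagrange hGL.strictMono]; omega)]
  simp [eval_lagrange hGL.strictMono]

lemma sum_weights : ∑ a, ω a = 2 := by
  have := hGL.exact 1 (by simp)
  simp at this
  rw [this]; norm_num

/-- Summation by parts. -/
lemma summation_by_parts (a l : Fin (p + 1)) :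
    ω a * diffMatrix ξ a l + ω l * diffMatrix ξ l a =
      (if a = Fin.last p ∧ l = Fin.last p then 1 else 0) - (if a = 0 ∧ l = 0 then 1 else 0) := by
  set q := lagrange ξ a * lagrange ξ l with hq
  -- The derivative of a product of two basis polynomials has degree at most `2 p - 1`, precisely
  -- the degree of exactness, so integration by parts survives discretisation.
  have hdeg : (Polynomial.derivative q).natDegree ≤ 2 * p - 1 := by
    refine (Polynomial.natDegree_derivative_le q).trans ?_
    have := Polynomial.natDegree_mul_le (p := lagrange ξ a) (q := lagrange ξ l)
    rw [natDegree_lagrange hGL.strictMono, natDegree_lagrange hGL.strictMono] at this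
    rw [← hq] at this
    omega
  have h1 := hGL.exact _ hdeg
  have h2 : ∫ x in (-1 : ℝ)..1, (Polynomial.derivative q).eval x = q.eval 1 - q.eval (-1) := by
    apply intervalIntegral.integral_eq_sub_of_hasDerivAt (f := fun x => q.eval x)
    · intro x _; exact q.hasDerivAt x
    · exact (Polynomial.continuous _).intervalIntegrable _ _
  rw [h2, ← hGL.first, ← hGL.last] at h1
  simp only [hq, Polynomial.derivative_mul, Polynomial.eval_add, Polynomial.eval_mul,
    eval_lagrange hGL.strictMono] at h1
  have e1 : ∑ j, ω j * ((Polynomial.derivative (lagrange ξ a)).eval (ξ j) * (if l = j then 1 else 0)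
      + (if a = j then 1 else 0) * (Polynomial.derivative (lagrange ξ l)).eval (ξ j))
      = ω a * diffMatrix ξ a l + ω l * diffMatrix ξ l a := by
    simp only [mul_add, Finset.sum_add_distrib, diffMatrix]
    simp [add_comm]
  rw [e1] at h1
  rw [h1]
  congr 1
  · split_ifs <;> simp_all
  · split_ifs <;> simp_all

lemma weight_eq_integral (Q : Polynomial ℝ) (hQ : Q.natDegree ≤ 2 * p - 1) (a : Fin (p + 1))
    (h0 : ∀ j, j ≠ a → Q.eval (ξ j) = 0) :
    ω a * Q.eval (ξ a) = ∫ x in (-1 : ℝ)..1, Q.eval x := by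
  rw [← hGL.exact Q hQ, Finset.sum_eq_single a]
  · intro j _ hj; rw [h0 j hj, mul_zero]
  · simp

/-- A polynomial that is nonnegative on `[-1, 1]` and vanishes at all other nodes isolates the
weight. The square of a Lagrange polynomial has degree `2 p`, one too many for the rule; squaring
only the factors of the interior nodes and taking the end nodes with simple factors `1 - X`, `1 + X`
keeps the degree admissible and the sign right. -/
lemma weight_pos (hp : 1 ≤ p) (a : Fin (p + 1)) : 0 < ω a := by
  have hinj := hGL.strictMono.injective
  suffices h : ∃ Q : Polynomial ℝ, Q.natDegree ≤ 2 * p - 1 ∧ (∀ j, j ≠ a → Q.eval (ξ j) = 0) ∧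
      (∀ x ∈ Icc (-1 : ℝ) 1, 0 ≤ Q.eval x) ∧ 0 < Q.eval (ξ a) by
    obtain ⟨Q, hd, h0, hnn, hpos⟩ := h
    have h1 := hGL.weight_eq_integral Q hd a h0
    have h2 : 0 < ∫ x in (-1 : ℝ)..1, Q.eval x := by
      apply intervalIntegral.integral_pos (by norm_num) Q.continuous.continuousOn
      · intro x hx; exact hnn x ⟨hx.1.le, hx.2⟩
      · exact ⟨ξ a, hGL.mem_Icc a, hpos⟩
    rw [← h1] at h2
    exact (pos_iff_pos_of_mul_pos h2).2 hpos
  have h0l : (0 : Fin (p + 1)) ≠ Fin.last p := by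
    intro h; have := congrArg Fin.val h; simp at this; omega
  set e0 : Finset (Fin (p + 1)) := {0, Fin.last p}
  -- At an end node the erasure is void and `R` has `p - 1` roots; at an interior node it has `p -
  -- 2`, which leaves room for the quadratic factor `1 - X ^ 2`.
  set I : Finset (Fin (p + 1)) := (Finset.univ \ e0).erase a with hI
  set R : Polynomial ℝ := ∏ j ∈ I, (Polynomial.X - Polynomial.C (ξ j)) with hR
  have hRd : R.natDegree = I.card := by
    rw [hR, Polynomial.natDegree_prod_of_monic _ _ (fun j _ => Polynomial.monic_X_sub_C _)]
    simp
  have hRa : R.eval (ξ a) ≠ 0 := by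
    rw [hR, Polynomial.eval_prod, Finset.prod_ne_zero_iff]
    intro j hj
    simp only [Polynomial.eval_sub, Polynomial.eval_X, Polynomial.eval_C]
    rw [sub_ne_zero]
    exact fun h => (Finset.ne_of_mem_erase hj) (hinj h).symm
  have hRj : ∀ j, j ≠ a → j ≠ 0 → j ≠ Fin.last p → R.eval (ξ j) = 0 := by
    intro j h1 h2 h3
    rw [hR, Polynomial.eval_prod]
    apply Finset.prod_eq_zero (i := j)
    · simp [hI, h1, h2, h3, e0]
    · simp
  have hcard0 : (Finset.univ \ e0).card = p - 1 := by
    rw [Finset.card_sdiff_of_subset (Finset.subset_univ _), Finset.card_pair h0l]; simp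
  have e2 : ∀ x : ℝ, 0 ≤ R.eval x ^ 2 := fun x => sq_nonneg _
  have e2a : 0 < R.eval (ξ a) ^ 2 := by positivity
  have hRR : (R ^ 2).natDegree = 2 * I.card := by
    rw [Polynomial.natDegree_pow, hRd]
  by_cases ha0 : a = 0
  · refine ⟨R ^ 2 * (Polynomial.C 1 - Polynomial.X), ?_, ?_, ?_, ?_⟩
    · refine Polynomial.natDegree_mul_le.trans ?_
      have : (Polynomial.C 1 - Polynomial.X : Polynomial ℝ).natDegree ≤ 1 := by
        compute_degree
      have h3 : I.card ≤ p - 1 := by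
        rw [← hcard0]; exact Finset.card_le_card (Finset.erase_subset _ _)
      rw [hRR]; omega
    · intro j hj
      by_cases hjl : j = Fin.last p
      · subst hjl; simp [hGL.last]
      · have := hRj j hj (ha0 ▸ hj) hjl
        simp [this]
    · intro x hx
      simp only [Polynomial.eval_mul, Polynomial.eval_pow, Polynomial.eval_sub, Polynomial.eval_C,
        Polynomial.eval_X]
      exact mul_nonneg (e2 x) (by linarith [hx.2])
    · simp only [Polynomial.eval_mul, Polynomial.eval_pow, Polynomial.eval_sub, Polynomial.eval_C,
        Polynomial.eval_X]
      apply mul_pos e2a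
      rw [ha0, hGL.first]; norm_num
  by_cases hal : a = Fin.last p
  · refine ⟨R ^ 2 * (Polynomial.X + Polynomial.C 1), ?_, ?_, ?_, ?_⟩
    · refine Polynomial.natDegree_mul_le.trans ?_
      have : (Polynomial.X + Polynomial.C 1 : Polynomial ℝ).natDegree ≤ 1 := by
        compute_degree
      have h3 : I.card ≤ p - 1 := by
        rw [← hcard0]; exact Finset.card_le_card (Finset.erase_subset _ _)
      rw [hRR]; omega
    · intro j hj
      by_cases hjl : j = 0
      · subst hjl; simp [hGL.first]
      · have := hRj j hj hjl (hal ▸ hj)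
        simp [this]
    · intro x hx
      simp only [Polynomial.eval_mul, Polynomial.eval_pow, Polynomial.eval_add, Polynomial.eval_C,
        Polynomial.eval_X]
      exact mul_nonneg (e2 x) (by linarith [hx.1])
    · simp only [Polynomial.eval_mul, Polynomial.eval_pow, Polynomial.eval_add, Polynomial.eval_C,
        Polynomial.eval_X]
      apply mul_pos e2a
      rw [hal, hGL.last]; norm_num
  · refine ⟨R ^ 2 * (Polynomial.C 1 - Polynomial.X ^ 2), ?_, ?_, ?_, ?_⟩
    · refine Polynomial.natDegree_mul_le.trans ?_
      have : (Polynomial.C 1 - Polynomial.X ^ 2 : Polynomial ℝ).natDegree ≤ 2 := by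
        compute_degree
      have hmem : a ∈ Finset.univ \ e0 := by simp [e0, ha0, hal]
      have h3 := Finset.card_erase_add_one hmem
      rw [hcard0, ← hI] at h3
      rw [hRR]; omega
    · intro j hj
      by_cases hjl : j = 0
      · subst hjl; simp [hGL.first]
      by_cases hjl' : j = Fin.last p
      · subst hjl'; simp [hGL.last]
      · simp [hRj j hj hjl hjl']
    · intro x hx
      simp only [Polynomial.eval_mul, Polynomial.eval_pow, Polynomial.eval_sub, Polynomial.eval_C,
        Polynomial.eval_X]
      exact mul_nonneg (e2 x) (by nlinarith [hx.1, hx.2])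
    · simp only [Polynomial.eval_mul, Polynomial.eval_pow, Polynomial.eval_sub, Polynomial.eval_C,
        Polynomial.eval_X]
      apply mul_pos e2a
      have h1 : -1 < ξ a := by
        rw [← hGL.first]; exact hGL.strictMono (Fin.pos_of_ne_zero ha0)
      have h2 : ξ a < 1 := by
        rw [← hGL.last]; exact hGL.strictMono (Fin.lt_last_iff_ne_last.2 hal)
      nlinarith

/-- The summation-by-parts form of the weighted difference operator. -/
lemma sum_weight_diffMatrix (l : Fin (p + 1)) :
    ∑ a, ω a * diffMatrix ξ a l =
      (if l = Fin.last p then 1 else 0) - (if l = 0 then 1 else 0) := by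
  have h1 : ∑ a, (ω a * diffMatrix ξ a l + ω l * diffMatrix ξ l a) =
      (if l = Fin.last p then 1 else 0) - (if l = 0 then 1 else 0) := by
    simp only [hGL.summation_by_parts, Finset.sum_sub_distrib]
    congr 1
    · split_ifs <;> simp_all
    · split_ifs <;> simp_all
  rw [Finset.sum_add_distrib, ← Finset.mul_sum, sum_diffMatrix hGL.strictMono, mul_zero,
    add_zero] at h1
  exact h1

lemma sum_weight_diffMatrix_mul (x : Fin (p + 1) → ℝ) :
    ∑ a, ∑ l, ω a * diffMatrix ξ a l * x l = x (Fin.last p) - x 0 := by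
  rw [Finset.sum_comm]
  simp only [← Finset.sum_mul, hGL.sum_weight_diffMatrix, sub_mul, Finset.sum_sub_distrib]
  simp

/-- The rows of the differentiation matrix sum to zero, so `x a` may be subtracted freely. In this
form of the discrete fundamental theorem only increments of `x` appear, which are small for a smooth
test function. -/
lemma sum_weight_diffMatrix_mul_sub (x : Fin (p + 1) → ℝ) :
    ∑ a, ∑ l, ω a * diffMatrix ξ a l * (x l - x a) = x (Fin.last p) - x 0 := by
  simp only [mul_sub, Finset.sum_sub_distrib]
  rw [hGL.sum_weight_diffMatrix_mul]
  simp only [← Finset.sum_mul, ← Finset.mul_sum, sum_diffMatrix hGL.strictMono]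
  simp

/-- Summation by parts for a flux differencing term with a symmetric two-point flux. -/
lemma sum_flux_differencing (x : Fin (p + 1) → ℝ) (f : Fin (p + 1) → Fin (p + 1) → ℝ)
    (hf : ∀ a l, f a l = f l a) :
    ∑ a, ω a * (x a * (2 * ∑ l, diffMatrix ξ a l * f a l)) =
      x (Fin.last p) * f (Fin.last p) (Fin.last p) - x 0 * f 0 0
        - ∑ a, ∑ l, ω a * diffMatrix ξ a l * ((x l - x a) * f a l) := by
  have h1 : ∑ a, ∑ l, ω a * diffMatrix ξ a l * (x l * f a l) =
      x (Fin.last p) * f (Fin.last p) (Fin.last p) - x 0 * f 0 0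
        - ∑ a, ∑ l, ω a * diffMatrix ξ a l * (x a * f a l) := by
    -- Exchanging the indices in the second sum and using the symmetry of `f`, both sums carry `x l
    -- * f a l`, with coefficients that add up to the left side of `summation_by_parts`.
    rw [eq_sub_iff_add_eq]
    nth_rewrite 2 [Finset.sum_comm]
    rw [← Finset.sum_add_distrib]
    simp only [← Finset.sum_add_distrib]
    have : ∀ a l, ω a * diffMatrix ξ a l * (x l * f a l) + ω l * diffMatrix ξ l a * (x l * f l a)
        = ((if a = Fin.last p ∧ l = Fin.last p then 1 else 0) - (if a = 0 ∧ l = 0 then 1 else 0))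
          * (x l * f a l) := by
      intro a l
      rw [hf l a, ← hGL.summation_by_parts]; ring
    simp only [this, sub_mul, Finset.sum_sub_distrib]
    congr 1
    · rw [Finset.sum_eq_single (Fin.last p)]
      · simp
      · intro b _ hb; simp [hb]
      · simp
    · rw [Finset.sum_eq_single 0]
      · simp
      · intro b _ hb; simp [hb]
      · simp
  have h2 : ∑ a, ω a * (x a * (2 * ∑ l, diffMatrix ξ a l * f a l)) =
      2 * ∑ a, ∑ l, ω a * diffMatrix ξ a l * (x a * f a l) := by
    simp only [Finset.mul_sum]
    exact Finset.sum_congr rfl fun a _ => Finset.sum_congr rfl fun l _ => by ring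
  rw [h2]
  have h3 : ∑ a, ∑ l, ω a * diffMatrix ξ a l * ((x l - x a) * f a l) =
      ∑ a, ∑ l, ω a * diffMatrix ξ a l * (x l * f a l)
        - ∑ a, ∑ l, ω a * diffMatrix ξ a l * (x a * f a l) := by
    simp only [← Finset.sum_sub_distrib]
    exact Finset.sum_congr rfl fun a _ => Finset.sum_congr rfl fun l _ => by ring
  rw [h3, h1]; ring

end IsGaussLobatto

lemma exists_lagrange_bound (ξ : Fin (p + 1) → ℝ) :
    ∃ C : ℝ, 0 ≤ C ∧ ∀ a, ∀ x ∈ Icc (-1 : ℝ) 1, |(lagrange ξ a).eval x| ≤ C := by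
  have h : ∀ a, ∃ C : ℝ, ∀ x ∈ Icc (-1 : ℝ) 1, ‖(lagrange ξ a).eval x‖ ≤ C := fun a =>
    isCompact_Icc.exists_bound_of_continuousOn (lagrange ξ a).continuous.continuousOn
  choose C hC using h
  refine ⟨∑ a, |C a|, Finset.sum_nonneg fun _ _ => abs_nonneg _, fun a x hx => ?_⟩
  exact (hC a x hx).trans ((le_abs_self _).trans
    (Finset.single_le_sum (f := fun a => |C a|) (fun _ _ => abs_nonneg _) (Finset.mem_univ a)))

end Quadrature

/-! ### Entropy variables and entropy conservation of the volume flux. -/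

section EntropyAlgebra

/-- The entropy variables, i.e. the gradient of the mathematical entropy. -/
def entropyVars (γ : ℝ) (U : State) : State :=
  ![(γ - thermoEntropy γ U) / (γ - 1)
      - dens U * (vel U 0 ^ 2 + vel U 1 ^ 2) / (2 * pressure γ U),
    dens U * vel U 0 / pressure γ U, dens U * vel U 1 / pressure γ U,
    -(dens U / pressure γ U)]

/-- The entropy potential of the Euler equations. -/
def entropyPotential (a : Fin 2) (U : State) : ℝ := dens U * vel U a

lemma thermoEntropy_eq {γ : ℝ} {U : State} (hρ : 0 < dens U) (hp : 0 < pressure γ U) :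
    thermoEntropy γ U = Real.log (pressure γ U) - γ * Real.log (dens U) := by
  unfold thermoEntropy
  rw [Real.log_div hp.ne' (Real.rpow_pos_of_pos hρ _).ne', Real.log_rpow hρ]

lemma mom_eq {U : State} (hρ : dens U ≠ 0) (a : Fin 2) : mom U a = dens U * vel U a := by
  unfold vel; field_simp

lemma energy_eq {γ : ℝ} (hγ : 1 < γ) {U : State} (hρ : dens U ≠ 0) :
    energy U = pressure γ U / (γ - 1) + dens U * (vel U 0 ^ 2 + vel U 1 ^ 2) / 2 := by
  have : γ - 1 ≠ 0 := by linarith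
  unfold vel pressure; field_simp; ring

lemma state_eq {γ : ℝ} (hγ : 1 < γ) {U : State} (hρ : dens U ≠ 0) :
    U = ![dens U, dens U * vel U 0, dens U * vel U 1,
      pressure γ U / (γ - 1) + dens U * (vel U 0 ^ 2 + vel U 1 ^ 2) / 2] := by
  rw [← energy_eq hγ hρ, ← mom_eq hρ, ← mom_eq hρ]
  ext k; fin_cases k <;> simp [dens, mom, energy]

lemma logMean_comm (x y : ℝ) : logMean x y = logMean y x := by
  unfold logMean
  by_cases h : x = y
  · subst h; rfl
  · rw [if_neg h, if_neg (Ne.symm h), ← neg_sub y x, ← neg_sub (Real.log y), neg_div_neg_eq]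

lemma logMean_self (x : ℝ) : logMean x x = x := if_pos rfl

/-- The product form covers the diagonal too. Apart from positivity it is all that entropy
conservation needs of the logarithmic mean. -/
lemma logMean_mul_log {x y : ℝ} (hx : 0 < x) (hy : 0 < y) :
    logMean x y * (Real.log y - Real.log x) = y - x := by
  unfold logMean
  split_ifs with h
  · subst h; simp
  · have : Real.log x - Real.log y ≠ 0 := by
      intro h'
      exact h (Real.log_injOn_pos hx hy (sub_eq_zero.1 h'))
    field_simp; ring

/-- Both bounds come from `1 - 1 / z ≤ log z ≤ z - 1` at `z = y / x`. -/
lemma logMean_mem_of_le {x y : ℝ} (hx : 0 < x) (hxy : x ≤ y) :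
    x ≤ logMean x y ∧ logMean x y ≤ y := by
  rcases hxy.eq_or_lt with rfl | hlt
  · simp [logMean_self]
  have hy : 0 < y := hx.trans hlt
  have h := logMean_mul_log hx hy
  have hl : 0 < Real.log y - Real.log x := sub_pos.2 (Real.log_lt_log hx hlt)
  have h1 : Real.log y - Real.log x ≤ (y - x) / x := by
    rw [← Real.log_div hy.ne' hx.ne']
    have := Real.log_le_sub_one_of_pos (div_pos hy hx)
    rw [sub_div, div_self hx.ne']; exact this
  have h2 : (y - x) / y ≤ Real.log y - Real.log x := by
    rw [← Real.log_div hy.ne' hx.ne']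
    have := Real.one_sub_inv_le_log_of_pos (div_pos hy hx)
    rw [sub_div, div_self hy.ne']; simpa using this
  have e1 : logMean x y = (y - x) / (Real.log y - Real.log x) := by
    rw [eq_div_iff hl.ne']; exact h
  rw [e1]
  constructor
  · rw [le_div_iff₀ hl]
    rw [le_div_iff₀ hx] at h1; linarith
  · rw [div_le_iff₀ hl]
    rw [div_le_iff₀ hy] at h2; linarith

lemma logMean_pos {x y : ℝ} (hx : 0 < x) (hy : 0 < y) : 0 < logMean x y := by
  rcases le_total x y with h | h
  · exact hx.trans_le (logMean_mem_of_le hx h).1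
  · rw [logMean_comm]; exact hy.trans_le (logMean_mem_of_le hy h).1

lemma abs_logMean_sub_le {x y : ℝ} (hx : 0 < x) (hy : 0 < y) : |logMean x y - x| ≤ |y - x| := by
  rcases le_total x y with h | h
  · have := logMean_mem_of_le hx h
    rw [abs_of_nonneg (by linarith), abs_of_nonneg (by linarith)]; linarith
  · have := logMean_mem_of_le hy h
    rw [logMean_comm, abs_of_nonpos (by linarith), abs_of_nonpos (by linarith)]; linarith

lemma amean_comm (x y : ℝ) : amean x y = amean y x := by unfold amean; ring

lemma amean_self (x : ℝ) : amean x x = x := by unfold amean; ring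

lemma volumeFlux_comm (γ : ℝ) (a : Fin 2) (U V : State) :
    volumeFlux γ a U V = volumeFlux γ a V U := by
  unfold volumeFlux
  simp only [amean_comm (vel U _), amean_comm (pressure γ U), logMean_comm (dens U),
    logMean_comm (dens U / _), amean_comm (vel U 0 ^ 2 + _)]
  ext k; fin_cases k <;> simp
  ring

lemma volumeFlux_self {γ : ℝ} (hγ : 1 < γ) (a : Fin 2) {U : State} (hρ : 0 < dens U) :
    volumeFlux γ a U U = eulerFlux γ a U := by
  unfold volumeFlux eulerFlux
  simp only [amean_self, logMean_self, mom_eq hρ.ne', energy_eq hγ hρ.ne']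
  have h1 : γ - 1 ≠ 0 := by linarith
  ext k; fin_cases k <;> simp
  · ring
  · ring
  · field_simp; ring

/-- Here `β = ρ / p`, `l = log ρ`, `k = log β`, `u` and `w` are the normal and tangential velocity,
and `r`, `b` the logarithmic means of `ρ` and `β`. The terms with `k` cancel the internal energy
flux and the kinetic terms cancel each other. The correction `- [p] [u] / 4` turns `{p} {u}` into
`(p0 u1 + p1 u0) / 2`, so that the pressure terms leave `{ρ} [u]`; together with `r [l] {u} = [ρ]
{u}` this is the product rule for `[ρ u]`. -/
lemma entropy_conservative_aux {γ b r β0 β1 p0 p1 u0 u1 w0 w1 l0 l1 k0 k1 : ℝ} (hγ : γ - 1 ≠ 0)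
    (hb : b ≠ 0) (hr : r * (l1 - l0) = β1 * p1 - β0 * p0) (hk : b * (k1 - k0) = β1 - β0) :
    ((l1 - l0) + (k1 - k0) / (γ - 1) - (β1 * (u1 ^ 2 + w1 ^ 2) - β0 * (u0 ^ 2 + w0 ^ 2)) / 2)
        * (r * ((u0 + u1) / 2))
      + (β1 * u1 - β0 * u0) * ((u0 + u1) / 2 * (r * ((u0 + u1) / 2)) + (p0 + p1) / 2)
      + (β1 * w1 - β0 * w0) * ((w0 + w1) / 2 * (r * ((u0 + u1) / 2)))
      - (β1 - β0) * ((r * (((u0 + u1) / 2) ^ 2 + ((w0 + w1) / 2) ^ 2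
          - (((u0 ^ 2 + w0 ^ 2) + (u1 ^ 2 + w1 ^ 2)) / 2) / 2) + 1 / (γ - 1) * (r / b)
          + (p0 + p1) / 2) * ((u0 + u1) / 2) - (p1 - p0) * (u1 - u0) / 4)
      = β1 * p1 * u1 - β0 * p0 * u0 := by
  have h2 : k1 - k0 = (β1 - β0) / b := by rw [eq_div_iff hb, mul_comm]; exact hk
  rw [h2]
  have h3 : (β1 - β0) / b / (γ - 1) * (r * ((u0 + u1) / 2)) =
    (β1 - β0) * (1 / (γ - 1) * (r / b)) * ((u0 + u1) / 2) := by field_simp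
  linear_combination (u0 + u1) / 2 * hr + h3

/-- Ranocha's flux is entropy conservative. -/
lemma volumeFlux_entropy_conservative {γ : ℝ} (hγ : 1 < γ) (a : Fin 2) {U V : State}
    (hU : 0 < dens U) (hpU : 0 < pressure γ U) (hV : 0 < dens V) (hpV : 0 < pressure γ V) :
    dotProduct (entropyVars γ V - entropyVars γ U) (volumeFlux γ a U V) =
      entropyPotential a V - entropyPotential a U := by
  have hγ1 : γ - 1 ≠ 0 := by linarith
  have hbU := div_pos hU hpU
  have hbV := div_pos hV hpV
  have hb := logMean_pos hbU hbV
  have hr := logMean_mul_log hU hV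
  have hk := logMean_mul_log hbU hbV
  have e0 : dens U = dens U / pressure γ U * pressure γ U := by field_simp
  have e1 : dens V = dens V / pressure γ V * pressure γ V := by field_simp
  have hs : ∀ W : State, 0 < dens W → 0 < pressure γ W →
      entropyVars γ W 0 = γ / (γ - 1) + Real.log (dens W)
        + Real.log (dens W / pressure γ W) / (γ - 1)
        - dens W / pressure γ W * (vel W 0 ^ 2 + vel W 1 ^ 2) / 2 := by
    intro W h1 h2
    simp only [entropyVars, thermoEntropy_eq h1 h2, Real.log_div h1.ne' h2.ne', Matrix.cons_val_zero]
    field_simp; ring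
  have hm : ∀ W : State, entropyVars γ W 1 = dens W / pressure γ W * vel W 0 := by
    intro W; simp [entropyVars]; ring
  have hm' : ∀ W : State, entropyVars γ W 2 = dens W / pressure γ W * vel W 1 := by
    intro W; simp [entropyVars]; ring
  have hE : ∀ W : State, entropyVars γ W 3 = -(dens W / pressure γ W) := by
    intro W; simp [entropyVars]
  rw [dotProduct, Fin.sum_univ_four]
  simp only [Pi.sub_apply, hs U hU hpU, hs V hV hpV, hm, hm', hE, entropyPotential]
  have hr' : logMean (dens U) (dens V) * (Real.log (dens V) - Real.log (dens U)) =
      dens V / pressure γ V * pressure γ V - dens U / pressure γ U * pressure γ U := by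
    rw [← e0, ← e1]; exact hr
  fin_cases a
  · have := entropy_conservative_aux (u0 := vel U 0) (u1 := vel V 0) (w0 := vel U 1)
      (w1 := vel V 1) hγ1 hb.ne' hr' hk
    rw [← e0, ← e1] at this
    simp only [Fin.zero_eta, Fin.isValue]
    rw [← this]
    simp [volumeFlux, amean]
    ring
  -- In the second direction the two velocity components exchange the roles of normal and tangential
  -- component.
  · have := entropy_conservative_aux (u0 := vel U 1) (u1 := vel V 1) (w0 := vel U 0)
      (w1 := vel V 0) hγ1 hb.ne' hr' hk
    rw [← e0, ← e1] at this
    simp only [Fin.mk_one, Fin.isValue]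
    rw [← this]
    simp [volumeFlux, amean]
    ring

/-- This identifies the abstract flux of the entropy balance law with the entropy flux `η u` of the
weak formulation. -/
lemma entropyVars_dot_eulerFlux {γ : ℝ} (hγ : 1 < γ) (a : Fin 2) {U : State}
    (hρ : 0 < dens U) (hp : 0 < pressure γ U) :
    dotProduct (entropyVars γ U) (eulerFlux γ a U) - entropyPotential a U
      = mathEntropy γ U * vel U a := by
  have hγ1 : γ - 1 ≠ 0 := by linarith
  rw [dotProduct, Fin.sum_univ_four]
  simp only [entropyVars, eulerFlux, entropyPotential, mathEntropy, mom_eq hρ.ne',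
    energy_eq hγ hρ.ne']
  fin_cases a <;> simp <;> field_simp <;> ring

lemma hasDerivWithinAt_log_div_rpow {γ : ℝ} {P ρ : ℝ → ℝ} {P' ρ' : ℝ} {s : Set ℝ} {t : ℝ}
    (hP : HasDerivWithinAt P P' s t) (hρ : HasDerivWithinAt ρ ρ' s t) (hP0 : 0 < P t)
    (hρ0 : 0 < ρ t) :
    HasDerivWithinAt (fun t => Real.log (P t / ρ t ^ γ)) (P' / P t - γ * ρ' / ρ t) s t := by
  have hr := Real.rpow_pos_of_pos hρ0 γ
  have h := (hP.div (hρ.rpow_const (p := γ) (Or.inl hρ0.ne')) hr.ne').log (div_pos hP0 hr).ne'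
  refine HasDerivWithinAt.congr_deriv h ?_
  change _ / (P t / ρ t ^ γ) = _
  rw [Real.rpow_sub_one hρ0.ne']
  field_simp

/-- The chain rule, which justifies regarding `entropyVars` as the gradient of the entropy with
respect to the conservative variables. Once logarithm, pressure, density and momentum are free
symbols, a rational identity is left. -/
lemma hasDerivWithinAt_mathEntropy {γ : ℝ} (hγ : 1 < γ) {c : ℝ → State} {c' : State} {s : Set ℝ}
    {t : ℝ} (hc : HasDerivWithinAt c c' s t) (hρ : 0 < dens (c t)) (hp : 0 < pressure γ (c t)) :
    HasDerivWithinAt (fun t => mathEntropy γ (c t)) (dotProduct (entropyVars γ (c t)) c') s t := by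
  have hγ1 : γ - 1 ≠ 0 := by linarith
  have h := hasDerivWithinAt_pi.1 hc
  have h0 : HasDerivWithinAt (fun t => dens (c t)) (c' 0) s t := h 0
  have h1 : HasDerivWithinAt (fun t => mom (c t) 0) (c' 1) s t := h 1
  have h2 : HasDerivWithinAt (fun t => mom (c t) 1) (c' 2) s t := h 2
  have h3 : HasDerivWithinAt (fun t => energy (c t)) (c' 3) s t := h 3
  have hP : HasDerivWithinAt (fun t => pressure γ (c t))
      ((γ - 1) * (c' 3 - ((2 * mom (c t) 0 * c' 1 + 2 * mom (c t) 1 * c' 2) * (2 * dens (c t))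
        - (mom (c t) 0 ^ 2 + mom (c t) 1 ^ 2) * (2 * c' 0)) / (2 * dens (c t)) ^ 2)) s t := by
    have := (h3.sub (((h1.pow 2).add (h2.pow 2)).div (h0.const_mul 2) (by positivity))).const_mul
      (γ - 1)
    simpa [pressure] using this
  have hS := hasDerivWithinAt_log_div_rpow (γ := γ) hP h0 hp hρ
  have hη : HasDerivWithinAt (fun t => mathEntropy γ (c t)) _ s t :=
    ((h0.mul hS).neg).div_const (γ - 1)
  convert hη using 1
  rw [dotProduct, Fin.sum_univ_four]
  simp only [entropyVars, thermoEntropy]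
  generalize Real.log (pressure γ (c t) / dens (c t) ^ γ) = S
  generalize pressure γ (c t) = P at *
  simp [vel]
  generalize dens (c t) = ρ at *
  generalize mom (c t) 0 = m0 at *
  generalize mom (c t) 1 = m1 at *
  field_simp
  ring

end EntropyAlgebra

/-! ### Entropy dissipation of the local Lax-Friedrichs flux. -/

section FaceDissipation

/-- Equality holds at `1`, and the difference has the derivative `(1 - 1 / x) ^ 2 / 2`. It makes the
thermal part of the relative entropy at least `(x - 1) ^ 2 / (2 x)` for a temperature ratio `x ≥ 1`.
-/
lemma log_le_half_sub_inv {x : ℝ} (hx : 1 ≤ x) : Real.log x ≤ (x - 1 / x) / 2 := by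
  have hmono : MonotoneOn (fun x : ℝ => (x - 1 / x) / 2 - Real.log x) (Ici 1) := by
    apply monotoneOn_of_hasDerivWithinAt_nonneg (convex_Ici 1)
      (f' := fun x => (1 - (-(1 / x ^ 2))) / 2 - 1 / x)
    · apply ContinuousOn.sub
      · apply ContinuousOn.div_const
        exact continuousOn_id.sub (continuousOn_const.div continuousOn_id
          (fun x hx => by have : (1 : ℝ) ≤ x := hx; simp; linarith))
      · exact Real.continuousOn_log.mono (fun x hx => by
          have : (1 : ℝ) ≤ x := hx; simp; linarith)
    · intro x hx
      rw [interior_Ici] at hx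
      have hx0 : x ≠ 0 := by have : (1 : ℝ) < x := hx; linarith
      apply HasDerivAt.hasDerivWithinAt
      have h1 : HasDerivAt (fun y : ℝ => 1 / y) (-(1 / x ^ 2)) x := by
        simpa [one_div] using hasDerivAt_inv hx0
      have h2 := Real.hasDerivAt_log hx0
      rw [← one_div] at h2
      exact (((hasDerivAt_id x).sub h1).div_const 2).sub h2
    · intro x hx
      rw [interior_Ici] at hx
      have hx0 : 0 < x := by have : (1 : ℝ) < x := hx; linarith
      have : (1 - (-(1 / x ^ 2))) / 2 - 1 / x = (1 - 1 / x) ^ 2 / 2 := by field_simp; ring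
      rw [this]; positivity
  have := hmono (mem_Ici.2 le_rfl) (mem_Ici.2 hx) hx
  simp at this
  simp; linarith

/-- The counterpart for temperature ratios below `1`; here the difference has the derivative `-(1 -
y) ^ 2 / y`. -/
lemma sq_div_two_le_sub_one_sub_log {y : ℝ} (hy : 0 < y) (hy1 : y ≤ 1) :
    (1 - y) ^ 2 / 2 ≤ y - 1 - Real.log y := by
  have hanti : AntitoneOn (fun y : ℝ => y - 1 - Real.log y - (1 - y) ^ 2 / 2) (Ioc 0 1) := by
    apply antitoneOn_of_hasDerivWithinAt_nonpos (convex_Ioc 0 1)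
      (f' := fun x => 1 - 1 / x - (2 * (1 - x) * (-1)) / 2)
    · apply ContinuousOn.sub
      · apply ContinuousOn.sub (by fun_prop)
        exact Real.continuousOn_log.mono (fun x hx => by simp; exact hx.1.ne')
      · fun_prop
    · intro x hx
      rw [interior_Ioc] at hx
      apply HasDerivAt.hasDerivWithinAt
      have h2 := Real.hasDerivAt_log hx.1.ne'
      rw [← one_div] at h2
      have h3 : HasDerivAt (fun x : ℝ => (1 - x) ^ 2) (2 * (1 - x) * (-1)) x := by
        simpa using ((hasDerivAt_id' x).const_sub 1).fun_pow 2
      exact (((hasDerivAt_id x).sub_const 1).sub h2).sub (h3.div_const 2)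
    · intro x hx
      rw [interior_Ioc] at hx
      have : 1 - 1 / x - (2 * (1 - x) * (-1)) / 2 = -((1 - x) ^ 2 / x) := by
        have := hx.1.ne'; field_simp; ring
      rw [this]
      have := hx.1
      simp only [Left.neg_nonpos_iff]; positivity
  have := hanti ⟨hy, hy1⟩ (right_mem_Ioc.2 one_pos) hy1
  simp at this
  linarith

/-- The relative entropy of the state with density `ρ₁` and temperature `θ₁` with respect to the
one with `ρ₀` and `θ₀`, the squared velocity difference being `d`. -/
def relEntropy (γ d ρ₁ θ₁ ρ₀ θ₀ : ℝ) : ℝ :=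
  ρ₁ * d / (2 * θ₀) + (ρ₁ * (Real.log ρ₁ - Real.log ρ₀) - ρ₁ + ρ₀)
    + ρ₁ / (γ - 1) * (θ₁ / θ₀ - 1 - Real.log (θ₁ / θ₀))

lemma sub_add_log_nonneg {ρ₁ ρ₀ : ℝ} (h1 : 0 < ρ₁) (h0 : 0 < ρ₀) :
    0 ≤ ρ₁ * (Real.log ρ₁ - Real.log ρ₀) - ρ₁ + ρ₀ := by
  rw [← Real.log_div h1.ne' h0.ne']
  have := Real.one_sub_inv_le_log_of_pos (div_pos h1 h0)
  have h2 := mul_le_mul_of_nonneg_left this h1.le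
  have : ρ₁ * (1 - (ρ₁ / ρ₀)⁻¹) = ρ₁ - ρ₀ := by field_simp
  linarith

lemma sub_one_sub_log_nonneg {x : ℝ} (hx : 0 < x) : 0 ≤ x - 1 - Real.log x := by
  linarith [Real.log_le_sub_one_of_pos hx]

lemma le_relEntropy {γ d ρ₁ θ₁ ρ₀ θ₀ : ℝ} (h1 : 0 < ρ₁) (h0 : 0 < ρ₀) :
    ρ₁ * (d / (2 * θ₀) + 1 / (γ - 1) * (θ₁ / θ₀ - 1 - Real.log (θ₁ / θ₀)))
      ≤ relEntropy γ d ρ₁ θ₁ ρ₀ θ₀ := by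
  unfold relEntropy
  have := sub_add_log_nonneg h1 h0
  have e : ρ₁ * (d / (2 * θ₀) + 1 / (γ - 1) * (θ₁ / θ₀ - 1 - Real.log (θ₁ / θ₀))) =
    ρ₁ * d / (2 * θ₀) + ρ₁ / (γ - 1) * (θ₁ / θ₀ - 1 - Real.log (θ₁ / θ₀)) := by ring
  linarith

lemma relEntropy_nonneg {γ d ρ₁ θ₁ ρ₀ θ₀ : ℝ} (hγ : 1 < γ) (hd : 0 ≤ d) (h1 : 0 < ρ₁)
    (h0 : 0 < ρ₀) (ht1 : 0 < θ₁) (ht0 : 0 < θ₀) : 0 ≤ relEntropy γ d ρ₁ θ₁ ρ₀ θ₀ := by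
  refine le_trans ?_ (le_relEntropy h1 h0)
  have := sub_one_sub_log_nonneg (div_pos ht1 ht0)
  have : 0 < γ - 1 := by linarith
  positivity

/-- The ratio that quantifies how much of the Lax-Friedrichs dissipation is left over. -/
def dissRatio (γ : ℝ) : ℝ := Real.sqrt ((γ - 1) / γ)

lemma dissRatio_lt_one {γ : ℝ} (hγ : 1 < γ) : dissRatio γ < 1 := by
  unfold dissRatio
  rw [Real.sqrt_lt' one_pos, div_lt_iff₀ (by linarith)]; linarith

lemma dissRatio_nonneg (γ : ℝ) : 0 ≤ dissRatio γ := Real.sqrt_nonneg _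

/-- Balancing kinetic against thermal energy in the cross term needs only the speed `√((γ - 1) θ)`,
whereas the viscosity provides the speed of sound `√(γ θ)`. This gap makes the dissipation strict.
-/
lemma dissRatio_mul_sqrt {γ θ : ℝ} (hγ : 1 < γ) :
    dissRatio γ * Real.sqrt (γ * θ) = Real.sqrt ((γ - 1) * θ) := by
  unfold dissRatio
  rw [← Real.sqrt_mul (by apply div_nonneg <;> linarith)]
  congr 1
  have : γ ≠ 0 := by linarith
  field_simp

/-- One of the two densities contributes with a favourable sign, depending on the sign of `v`, and
is dropped. For the other one, completing the square bounds velocity jump times temperature jump by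
the kinetic plus the thermal part of a single relative entropy. When `v ≤ 0` this is the relative
entropy multiplied by `B`, but the speed required belongs to the hotter state, whence `hB'`. -/
lemma cross_term_le_aux {γ d v ρ₁ θ₁ ρ₀ θ₀ A B : ℝ} (hγ : 1 < γ) (hd : v ^ 2 ≤ d) (h1 : 0 < ρ₁)
    (h0 : 0 < ρ₀) (ht1 : 0 < θ₁) (ht0 : 0 < θ₀) (hθ : θ₀ ≤ θ₁)
    (hA : Real.sqrt (γ * θ₁) ≤ A) (hB : Real.sqrt (γ * θ₀) ≤ B)
    (hB' : v ≤ 0 → Real.sqrt (γ * θ₁) ≤ B) :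
    v * (ρ₁ * θ₁ - ρ₀ * θ₀) * (1 / θ₀ - 1 / θ₁) ≤
      dissRatio γ * (A * relEntropy γ d ρ₁ θ₁ ρ₀ θ₀ + B * relEntropy γ d ρ₀ θ₀ ρ₁ θ₁) := by
  have hd0 : 0 ≤ d := (sq_nonneg v).trans hd
  have hA0 : 0 ≤ A := (Real.sqrt_nonneg _).trans hA
  have hB0 : 0 ≤ B := (Real.sqrt_nonneg _).trans hB
  have hE1 := relEntropy_nonneg hγ hd0 h1 h0 ht1 ht0
  have hE0 := relEntropy_nonneg hγ hd0 h0 h1 ht0 ht1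
  have hκ := dissRatio_nonneg γ
  have hg : 0 < γ - 1 := by linarith
  have hAE := mul_nonneg hA0 hE1
  have hBE := mul_nonneg hB0 hE0
  have hβ : 0 ≤ 1 / θ₀ - 1 / θ₁ := sub_nonneg.2 (one_div_le_one_div_of_le ht0 hθ)
  -- The weight for which the sums of squares below become perfect squares; it belongs to the hotter
  -- state in both cases.
  set e := Real.sqrt ((γ - 1) * θ₁) with he
  have he2 : e ^ 2 = (γ - 1) * θ₁ := Real.sq_sqrt (by positivity)
  have he0 : 0 < e := Real.sqrt_pos.2 (by positivity)
  have hκe : dissRatio γ * Real.sqrt (γ * θ₁) = e := dissRatio_mul_sqrt hγ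
  rcases le_total 0 v with hv | hv
  · have hx : 1 ≤ θ₁ / θ₀ := by rw [le_div_iff₀ ht0]; linarith
    have h2 : v * (ρ₁ * θ₁ - ρ₀ * θ₀) * (1 / θ₀ - 1 / θ₁) ≤ ρ₁ * (v * (θ₁ / θ₀ - 1)) := by
      have : ρ₁ * (v * (θ₁ / θ₀ - 1)) - v * (ρ₁ * θ₁ - ρ₀ * θ₀) * (1 / θ₀ - 1 / θ₁)
          = v * (ρ₀ * θ₀) * (1 / θ₀ - 1 / θ₁) := by field_simp; ring
      have : 0 ≤ v * (ρ₀ * θ₀) * (1 / θ₀ - 1 / θ₁) := by positivity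
      linarith
    have hlog := log_le_half_sub_inv hx
    have h3 : v * (θ₁ / θ₀ - 1) ≤
        e * (d / (2 * θ₀) + 1 / (γ - 1) * (θ₁ / θ₀ - 1 - Real.log (θ₁ / θ₀))) := by
      have h4 : v * (θ₁ / θ₀ - 1) ≤ e * (v ^ 2 / (2 * θ₀)
          + 1 / (γ - 1) * (θ₁ / θ₀ - 1 - (θ₁ / θ₀ - 1 / (θ₁ / θ₀)) / 2)) := by
        have e5 : (θ₁ / θ₀ - 1 - (θ₁ / θ₀ - 1 / (θ₁ / θ₀)) / 2)
          = (θ₁ / θ₀ - 1) ^ 2 * θ₀ / (2 * θ₁) := by field_simp; ring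
        rw [e5]
        have e6 : e * (v ^ 2 / (2 * θ₀) + 1 / (γ - 1) * ((θ₁ / θ₀ - 1) ^ 2 * θ₀ / (2 * θ₁)))
            - v * (θ₁ / θ₀ - 1) = (e * v - (θ₁ / θ₀ - 1) * θ₀) ^ 2 / (2 * θ₀ * e) := by
          have : 1 / (γ - 1) * ((θ₁ / θ₀ - 1) ^ 2 * θ₀ / (2 * θ₁))
            = (θ₁ / θ₀ - 1) ^ 2 * θ₀ / (2 * e ^ 2) := by rw [he2]; field_simp
          rw [this]; field_simp; ring
        have : 0 ≤ (e * v - (θ₁ / θ₀ - 1) * θ₀) ^ 2 / (2 * θ₀ * e) := by positivity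
        linarith
      refine h4.trans ?_
      gcongr
    calc v * (ρ₁ * θ₁ - ρ₀ * θ₀) * (1 / θ₀ - 1 / θ₁) ≤ ρ₁ * (v * (θ₁ / θ₀ - 1)) := h2
      _ ≤ ρ₁ * (e * (d / (2 * θ₀) + 1 / (γ - 1) * (θ₁ / θ₀ - 1 - Real.log (θ₁ / θ₀)))) := by
          gcongr
      _ = e * (ρ₁ * (d / (2 * θ₀) + 1 / (γ - 1) * (θ₁ / θ₀ - 1 - Real.log (θ₁ / θ₀)))) := by ring
      _ ≤ e * relEntropy γ d ρ₁ θ₁ ρ₀ θ₀ := by gcongr; exact le_relEntropy h1 h0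
      _ = dissRatio γ * (Real.sqrt (γ * θ₁) * relEntropy γ d ρ₁ θ₁ ρ₀ θ₀) := by
          rw [← hκe]; ring
      _ ≤ dissRatio γ * (A * relEntropy γ d ρ₁ θ₁ ρ₀ θ₀ + B * relEntropy γ d ρ₀ θ₀ ρ₁ θ₁) := by
          apply mul_le_mul_of_nonneg_left _ hκ
          have := mul_le_mul_of_nonneg_right hA hE1
          linarith
  · have hy0 : 0 < θ₀ / θ₁ := by positivity
    have hy : θ₀ / θ₁ ≤ 1 := by rw [div_le_iff₀ ht1]; linarith
    have h2 : v * (ρ₁ * θ₁ - ρ₀ * θ₀) * (1 / θ₀ - 1 / θ₁) ≤ ρ₀ * (-v * (1 - θ₀ / θ₁)) := by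
      have : ρ₀ * (-v * (1 - θ₀ / θ₁)) - v * (ρ₁ * θ₁ - ρ₀ * θ₀) * (1 / θ₀ - 1 / θ₁)
          = -v * (ρ₁ * θ₁) * (1 / θ₀ - 1 / θ₁) := by field_simp; ring
      have hv' : 0 ≤ -v := by linarith
      have : 0 ≤ -v * (ρ₁ * θ₁) * (1 / θ₀ - 1 / θ₁) := by positivity
      linarith
    have hlog := sq_div_two_le_sub_one_sub_log hy0 hy
    have h3 : -v * (1 - θ₀ / θ₁) ≤
        e * (d / (2 * θ₁) + 1 / (γ - 1) * (θ₀ / θ₁ - 1 - Real.log (θ₀ / θ₁))) := by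
      have h4 : -v * (1 - θ₀ / θ₁) ≤ e * (v ^ 2 / (2 * θ₁)
          + 1 / (γ - 1) * ((1 - θ₀ / θ₁) ^ 2 / 2)) := by
        have e6 : e * (v ^ 2 / (2 * θ₁) + 1 / (γ - 1) * ((1 - θ₀ / θ₁) ^ 2 / 2))
            - -v * (1 - θ₀ / θ₁) = (e * v + (1 - θ₀ / θ₁) * θ₁) ^ 2 / (2 * θ₁ * e) := by
          have : 1 / (γ - 1) * ((1 - θ₀ / θ₁) ^ 2 / 2)
            = (1 - θ₀ / θ₁) ^ 2 * θ₁ / (2 * e ^ 2) := by rw [he2]; field_simp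
          rw [this]; field_simp; ring
        have : 0 ≤ (e * v + (1 - θ₀ / θ₁) * θ₁) ^ 2 / (2 * θ₁ * e) := by positivity
        linarith
      refine h4.trans ?_
      gcongr
    calc v * (ρ₁ * θ₁ - ρ₀ * θ₀) * (1 / θ₀ - 1 / θ₁) ≤ ρ₀ * (-v * (1 - θ₀ / θ₁)) := h2
      _ ≤ ρ₀ * (e * (d / (2 * θ₁) + 1 / (γ - 1) * (θ₀ / θ₁ - 1 - Real.log (θ₀ / θ₁)))) := by
          gcongr
      _ = e * (ρ₀ * (d / (2 * θ₁) + 1 / (γ - 1) * (θ₀ / θ₁ - 1 - Real.log (θ₀ / θ₁)))) := by ring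
      _ ≤ e * relEntropy γ d ρ₀ θ₀ ρ₁ θ₁ := by gcongr; exact le_relEntropy h0 h1
      _ = dissRatio γ * (Real.sqrt (γ * θ₁) * relEntropy γ d ρ₀ θ₀ ρ₁ θ₁) := by
          rw [← hκe]; ring
      _ ≤ dissRatio γ * (A * relEntropy γ d ρ₁ θ₁ ρ₀ θ₀ + B * relEntropy γ d ρ₀ θ₀ ρ₁ θ₁) := by
          apply mul_le_mul_of_nonneg_left _ hκ
          have := mul_le_mul_of_nonneg_right (hB' hv) hE0
          linarith

/-- The left side contains two antisymmetric factors and is unchanged when the states are exchanged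
with `v` kept fixed, so the hotter state may be taken as the first one. -/
lemma cross_term_le {γ d v ρ₁ θ₁ ρ₀ θ₀ A B : ℝ} (hγ : 1 < γ) (hd : v ^ 2 ≤ d) (h1 : 0 < ρ₁)
    (h0 : 0 < ρ₀) (ht1 : 0 < θ₁) (ht0 : 0 < θ₀)
    (hA : Real.sqrt (γ * θ₁) ≤ A) (hB : Real.sqrt (γ * θ₀) ≤ B)
    (hA' : v ≤ 0 → Real.sqrt (γ * θ₀) ≤ A) (hB' : v ≤ 0 → Real.sqrt (γ * θ₁) ≤ B) :
    v * (ρ₁ * θ₁ - ρ₀ * θ₀) * (1 / θ₀ - 1 / θ₁) ≤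
      dissRatio γ * (A * relEntropy γ d ρ₁ θ₁ ρ₀ θ₀ + B * relEntropy γ d ρ₀ θ₀ ρ₁ θ₁) := by
  rcases le_total θ₀ θ₁ with h | h
  · exact cross_term_le_aux hγ hd h1 h0 ht1 ht0 h hA hB hB'
  · have := cross_term_le_aux hγ hd h0 h1 ht0 ht1 h hB hA hA'
    calc _ = v * (ρ₀ * θ₀ - ρ₁ * θ₁) * (1 / θ₁ - 1 / θ₀) := by ring
      _ ≤ _ := this
      _ = _ := by ring

/-- Twice the symmetrised relative entropy, bounded from below by squared differences. -/
lemma sq_le_relEntropy_add {γ d ρ₁ θ₁ ρ₀ θ₀ r R Θ : ℝ} (hγ : 1 < γ) (hd : 0 ≤ d)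
    (hr : 0 < r) (h1 : r ≤ ρ₁) (h0 : r ≤ ρ₀) (h1' : ρ₁ ≤ R) (h0' : ρ₀ ≤ R)
    (ht1 : 0 < θ₁) (ht0 : 0 < θ₀) (ht1' : θ₁ ≤ Θ) (ht0' : θ₀ ≤ Θ) :
    r / Θ * d + (ρ₁ - ρ₀) ^ 2 / R + r / (γ - 1) * ((θ₁ - θ₀) ^ 2 / Θ ^ 2) ≤
      relEntropy γ d ρ₁ θ₁ ρ₀ θ₀ + relEntropy γ d ρ₀ θ₀ ρ₁ θ₁ := by
  have hρ1 : 0 < ρ₁ := hr.trans_le h1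
  have hρ0 : 0 < ρ₀ := hr.trans_le h0
  have hΘ : 0 < Θ := ht1.trans_le ht1'
  have hR : 0 < R := hρ1.trans_le h1'
  have hg : 0 < γ - 1 := by linarith
  have hk : ∀ {a t : ℝ}, r ≤ a → 0 < t → t ≤ Θ → r / Θ * d / 2 ≤ a * d / (2 * t) := by
    intro a t ha ht htΘ
    calc r / Θ * d / 2 = (r * d) / (2 * Θ) := by field_simp
      _ ≤ a * d / (2 * t) := by
          have := mul_nonneg (hr.le.trans ha) hd
          gcongr
  have hlog : (ρ₁ - ρ₀) ^ 2 / R ≤ (ρ₁ - ρ₀) * (Real.log ρ₁ - Real.log ρ₀) := by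
    have key : ∀ {a b : ℝ}, 0 < a → a ≤ b → b ≤ R →
        (b - a) ^ 2 / R ≤ (b - a) * (Real.log b - Real.log a) := by
      intro a b ha hab hb
      have hb0 : 0 < b := ha.trans_le hab
      have h := Real.one_sub_inv_le_log_of_pos (div_pos hb0 ha)
      rw [Real.log_div hb0.ne' ha.ne'] at h
      have h2 : (b - a) / R ≤ 1 - (b / a)⁻¹ := by
        have : 1 - (b / a)⁻¹ = (b - a) / b := by field_simp
        rw [this]; gcongr
      calc (b - a) ^ 2 / R = (b - a) * ((b - a) / R) := by ring
        _ ≤ _ := mul_le_mul_of_nonneg_left (h2.trans h) (by linarith)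
    rcases le_total ρ₀ ρ₁ with h | h
    · exact key hρ0 h h1'
    · have := key hρ1 h h0'
      calc _ = (ρ₀ - ρ₁) ^ 2 / R := by ring
        _ ≤ _ := this
        _ = _ := by ring
  have hth : r / (γ - 1) * ((θ₁ - θ₀) ^ 2 / Θ ^ 2) ≤
      ρ₁ / (γ - 1) * (θ₁ / θ₀ - 1 - Real.log (θ₁ / θ₀))
        + ρ₀ / (γ - 1) * (θ₀ / θ₁ - 1 - Real.log (θ₀ / θ₁)) := by
    have n1 := sub_one_sub_log_nonneg (div_pos ht1 ht0)
    have n0 := sub_one_sub_log_nonneg (div_pos ht0 ht1)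
    have e : (θ₁ / θ₀ - 1 - Real.log (θ₁ / θ₀)) + (θ₀ / θ₁ - 1 - Real.log (θ₀ / θ₁))
        = (θ₁ - θ₀) ^ 2 / (θ₁ * θ₀) := by
      rw [Real.log_div ht1.ne' ht0.ne', Real.log_div ht0.ne' ht1.ne']; field_simp; ring
    calc r / (γ - 1) * ((θ₁ - θ₀) ^ 2 / Θ ^ 2)
        ≤ r / (γ - 1) * ((θ₁ - θ₀) ^ 2 / (θ₁ * θ₀)) := by
          rw [sq Θ]; gcongr
      _ = r / (γ - 1) * (θ₁ / θ₀ - 1 - Real.log (θ₁ / θ₀))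
        + r / (γ - 1) * (θ₀ / θ₁ - 1 - Real.log (θ₀ / θ₁)) := by rw [← e]; ring
      _ ≤ _ := by gcongr
  unfold relEntropy
  have := hk h1 ht0 ht0'
  have := hk h0 ht1 ht1'
  have e : (ρ₁ * (Real.log ρ₁ - Real.log ρ₀) - ρ₁ + ρ₀)
    + (ρ₀ * (Real.log ρ₀ - Real.log ρ₁) - ρ₀ + ρ₁) = (ρ₁ - ρ₀) * (Real.log ρ₁ - Real.log ρ₀) := by
    ring
  linarith

/-- The face production of a pair of multiplier `g` and potential `ψ`. -/
def faceProduction (γ lam : ℝ) (g : State → State) (ψ : Fin 2 → State → ℝ) (a : Fin 2) (sgn : ℝ)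
    (U V : State) : ℝ :=
  dotProduct (g U - g V) (laxFriedrichs γ lam a sgn U V) - sgn * (ψ a U - ψ a V)

/-- Temperature. -/
def temperature (γ : ℝ) (U : State) : ℝ := pressure γ U / dens U

/-- The viscosity multiplies `[v] · [U]`, which is the sum of the two relative entropies, as for
every Bregman divergence. The central flux transports each relative entropy with its own normal
velocity and adds the only term of indefinite sign, a product of the jumps of velocity, pressure and
inverse temperature. -/
lemma two_mul_faceProduction_entropy {γ : ℝ} (hγ : 1 < γ) (lam : ℝ) (a : Fin 2) {sgn : ℝ}
    {U V : State} (hU : 0 < dens U) (hpU : 0 < pressure γ U) (hV : 0 < dens V)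
    (hpV : 0 < pressure γ V) :
    2 * faceProduction γ lam (entropyVars γ) entropyPotential a sgn U V =
      (lam - sgn * vel V a) * relEntropy γ ((vel V 0 - vel U 0) ^ 2 + (vel V 1 - vel U 1) ^ 2)
          (dens V) (temperature γ V) (dens U) (temperature γ U)
      + (lam + sgn * vel U a) * relEntropy γ ((vel V 0 - vel U 0) ^ 2 + (vel V 1 - vel U 1) ^ 2)
          (dens U) (temperature γ U) (dens V) (temperature γ V)
      - sgn * (vel V a - vel U a)
        * (dens V * temperature γ V - dens U * temperature γ U)
        * (1 / temperature γ U - 1 / temperature γ V) := by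
  have hγ1 : γ - 1 ≠ 0 := by linarith
  have sU := state_eq (γ := γ) hγ hU.ne'
  have sV := state_eq (γ := γ) hγ hV.ne'
  have eU : ∀ k, U k = _ := fun k => congrFun sU k
  have eV : ∀ k, V k = _ := fun k => congrFun sV k
  unfold faceProduction relEntropy temperature
  rw [dotProduct, Fin.sum_univ_four]
  simp only [laxFriedrichs, entropyVars, eulerFlux, entropyPotential, mom_eq hU.ne', mom_eq hV.ne',
    energy_eq (γ := γ) hγ hU.ne', energy_eq (γ := γ) hγ hV.ne', Pi.sub_apply, Pi.smul_apply,
    Pi.add_apply, thermoEntropy_eq hU hpU, thermoEntropy_eq hV hpV, smul_eq_mul]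
  rw [Real.log_div (div_pos hpV hV).ne' (div_pos hpU hU).ne',
    Real.log_div (div_pos hpU hU).ne' (div_pos hpV hV).ne',
    Real.log_div hpV.ne' hV.ne', Real.log_div hpU.ne' hU.ne',
    eU 0, eU 1, eU 2, eU 3, eV 0, eV 1, eV 2, eV 3]
  clear eU eV sU sV
  fin_cases a
  all_goals
    simp
    generalize Real.log (dens U) = l0
    generalize Real.log (dens V) = l1
    generalize Real.log (pressure γ U) = k0
    generalize Real.log (pressure γ V) = k1
    generalize vel U 0 = u0
    generalize vel V 0 = u1
    generalize vel U 1 = w0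
    generalize vel V 1 = w1
    generalize dens U = ρ0 at hU ⊢
    generalize dens V = ρ1 at hV ⊢
    generalize pressure γ U = p0 at hpU ⊢
    generalize pressure γ V = p1 at hpV ⊢
    field_simp
    ring

lemma waveSpeed_eq (γ : ℝ) (U : State) :
    waveSpeed γ U = Real.sqrt (vel U 0 ^ 2 + vel U 1 ^ 2) + Real.sqrt (γ * temperature γ U) := by
  unfold waveSpeed temperature; rw [mul_div_assoc]

lemma abs_vel_le (U : State) (a : Fin 2) : |vel U a| ≤ Real.sqrt (vel U 0 ^ 2 + vel U 1 ^ 2) := by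
  apply Real.abs_le_sqrt
  fin_cases a <;> simp <;> positivity

/-- The local Lax-Friedrichs flux is entropy dissipative, quantitatively. -/
lemma le_faceProduction_entropy {γ : ℝ} (hγ : 1 < γ) {lam : ℝ} (a : Fin 2) {sgn : ℝ}
    (hs : sgn = 1 ∨ sgn = -1) {U V : State} (hU : 0 < dens U) (hpU : 0 < pressure γ U)
    (hV : 0 < dens V) (hpV : 0 < pressure γ V) (hlam : lamMax γ U V ≤ lam) {c : ℝ}
    (hcU : c ≤ Real.sqrt (γ * temperature γ U)) (hcV : c ≤ Real.sqrt (γ * temperature γ V)) :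
    (1 - dissRatio γ) * c / 2 *
      (relEntropy γ ((vel V 0 - vel U 0) ^ 2 + (vel V 1 - vel U 1) ^ 2)
          (dens V) (temperature γ V) (dens U) (temperature γ U)
      + relEntropy γ ((vel V 0 - vel U 0) ^ 2 + (vel V 1 - vel U 1) ^ 2)
          (dens U) (temperature γ U) (dens V) (temperature γ V))
      ≤ faceProduction γ lam (entropyVars γ) entropyPotential a sgn U V := by
  have h := two_mul_faceProduction_entropy hγ lam a (sgn := sgn) hU hpU hV hpV
  have hl := max_le_iff.1 hlam
  rw [waveSpeed_eq, waveSpeed_eq] at hl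
  have htU : 0 < temperature γ U := div_pos hpU hU
  have htV : 0 < temperature γ V := div_pos hpV hV
  have aU := abs_le.1 (abs_vel_le U a)
  have aV := abs_le.1 (abs_vel_le V a)
  set d := (vel V 0 - vel U 0) ^ 2 + (vel V 1 - vel U 1) ^ 2 with hd
  have hdn : 0 ≤ d := by positivity
  have hda : (sgn * (vel V a - vel U a)) ^ 2 ≤ d := by
    have : sgn ^ 2 = 1 := by rcases hs with rfl | rfl <;> norm_num
    rw [mul_pow, this, one_mul, hd]
    fin_cases a <;> simp <;> positivity
  have hE1 := relEntropy_nonneg hγ hdn hV hU htV htU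
  have hE0 := relEntropy_nonneg hγ hdn hU hV htU htV
  have hκ := dissRatio_lt_one hγ
  have hA : Real.sqrt (γ * temperature γ V) ≤ lam - sgn * vel V a := by
    rcases hs with rfl | rfl <;> linarith [hl.1, hl.2]
  have hB : Real.sqrt (γ * temperature γ U) ≤ lam + sgn * vel U a := by
    rcases hs with rfl | rfl <;> linarith [hl.1, hl.2]
  -- If the oriented velocity jump is nonpositive, then `lam + sgn * vel U a ≥ lam + sgn * vel V a`,
  -- which exceeds the sound speed of `V`; likewise with the roles exchanged. Hence the two
  -- conditional bounds.
  have hX := cross_term_le (A := lam - sgn * vel V a) (B := lam + sgn * vel U a) hγ hda hV hU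
    htV htU hA hB (by intro hv; rcases hs with rfl | rfl <;> linarith [hl.1, hl.2])
    (by intro hv; rcases hs with rfl | rfl <;> linarith [hl.1, hl.2])
  set E1 := relEntropy γ d (dens V) (temperature γ V) (dens U) (temperature γ U)
  set E0 := relEntropy γ d (dens U) (temperature γ U) (dens V) (temperature γ V)
  have m1 := mul_le_mul_of_nonneg_right (hcV.trans hA) hE1
  have m0 := mul_le_mul_of_nonneg_right (hcU.trans hB) hE0
  have : (1 - dissRatio γ) * (c * (E1 + E0)) ≤
      (1 - dissRatio γ) * ((lam - sgn * vel V a) * E1 + (lam + sgn * vel U a) * E0) :=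
    mul_le_mul_of_nonneg_left (by linarith) (by linarith)
  linarith

end FaceDissipation

/-! ### Mirror states at walls. -/

section Mirror

lemma dens_mirror (a : Fin 2) (U : State) : dens (mirror a U) = dens U := by
  fin_cases a <;> simp [mirror, dens]

lemma energy_mirror (a : Fin 2) (U : State) : energy (mirror a U) = energy U := by
  fin_cases a <;> simp [mirror, energy]

lemma mom_mirror (a b : Fin 2) (U : State) :
    mom (mirror a U) b = if b = a then -mom U b else mom U b := by
  fin_cases a <;> fin_cases b <;> simp [mirror, mom]

lemma vel_mirror (a b : Fin 2) (U : State) :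
    vel (mirror a U) b = if b = a then -vel U b else vel U b := by
  unfold vel
  rw [mom_mirror, dens_mirror]
  split_ifs
  · rw [neg_div]
  · rfl

lemma pressure_mirror (γ : ℝ) (a : Fin 2) (U : State) :
    pressure γ (mirror a U) = pressure γ U := by
  unfold pressure
  rw [dens_mirror, energy_mirror, mom_mirror, mom_mirror]
  fin_cases a <;> simp

lemma thermoEntropy_mirror (γ : ℝ) (a : Fin 2) (U : State) :
    thermoEntropy γ (mirror a U) = thermoEntropy γ U := by
  unfold thermoEntropy
  rw [dens_mirror, pressure_mirror]

/-- Only the normal momentum flux is nonzero at a wall. -/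
lemma laxFriedrichs_mirror (γ lam : ℝ) (a : Fin 2) (sgn : ℝ) (U : State) (k : Fin 4)
    (hk : (k : ℕ) ≠ a + 1) : laxFriedrichs γ lam a sgn U (mirror a U) k = 0 := by
  simp only [laxFriedrichs, eulerFlux, dens_mirror, energy_mirror, mom_mirror, vel_mirror,
    pressure_mirror]
  fin_cases a <;> fin_cases k <;> simp [mirror] at hk ⊢ <;> exact Or.inr (sub_self _)

/-- At a wall the face production is twice the one-sided production. -/
lemma faceProduction_entropy_mirror (γ lam : ℝ) (a : Fin 2) (sgn : ℝ) (U : State) :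
    2 * (dotProduct (entropyVars γ U) (laxFriedrichs γ lam a sgn U (mirror a U))
        - sgn * entropyPotential a U)
      = faceProduction γ lam (entropyVars γ) entropyPotential a sgn U (mirror a U) := by
  have h := fun k hk => laxFriedrichs_mirror γ lam a sgn U k hk
  unfold faceProduction
  rw [dotProduct, dotProduct, Fin.sum_univ_four, Fin.sum_univ_four]
  fin_cases a
  · have h0 := h 0 (by simp)
    have h2 := h 2 (by simp)
    have h3 := h 3 (by simp)
    simp only [Fin.zero_eta, Fin.isValue] at h0 h2 h3 ⊢
    rw [h0, h2, h3]
    simp only [entropyPotential, entropyVars, dens_mirror, vel_mirror, pressure_mirror,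
      thermoEntropy_mirror]
    simp
    ring
  · have h0 := h 0 (by simp)
    have h2 := h 1 (by simp)
    have h3 := h 3 (by simp)
    simp only [Fin.mk_one, Fin.isValue] at h0 h2 h3 ⊢
    rw [h0, h2, h3]
    simp only [entropyPotential, entropyVars, dens_mirror, vel_mirror, pressure_mirror,
      thermoEntropy_mirror]
    simp
    ring

end Mirror

/-! ### A calculus of bounded Lipschitz and two-point functions. -/

/-- The two-point function `f` is bounded on `B`, and it is, up to a multiple of `d U V`, equal to
the bounded function `f₀` of the first argument. -/
def NearOn {X : Type*} (B : Set X) (d : X → X → ℝ) (f : X → X → ℝ) (f₀ : X → ℝ) : Prop :=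
  ∃ C, 0 ≤ C ∧ ∀ U ∈ B, ∀ V ∈ B, |f₀ U| ≤ C ∧ |f U V| ≤ C ∧ |f U V - f₀ U| ≤ C * d U V

/-- `f` is bounded on `B` and Lipschitz continuous with respect to `d`. -/
abbrev LipBddOn {X : Type*} (B : Set X) (d : X → X → ℝ) (f : X → ℝ) : Prop :=
  NearOn B d (fun _ V => f V) f

namespace NearOn

variable {X : Type*} {B : Set X} {d : X → X → ℝ} {f g : X → X → ℝ} {f₀ g₀ : X → ℝ}

lemma congr (h : NearOn B d f f₀) (hf : ∀ U ∈ B, ∀ V ∈ B, g U V = f U V)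
    (hf₀ : ∀ U ∈ B, g₀ U = f₀ U) : NearOn B d g g₀ := by
  obtain ⟨C, hC, h⟩ := h
  refine ⟨C, hC, fun U hU V hV => ?_⟩
  rw [hf U hU V hV, hf₀ U hU]
  exact h U hU V hV

lemma const (hd : ∀ U V, 0 ≤ d U V) (c : ℝ) : NearOn B d (fun _ _ => c) (fun _ => c) :=
  ⟨|c|, abs_nonneg c, fun U _ V _ => ⟨le_rfl, le_rfl, by
    simpa using mul_nonneg (abs_nonneg c) (hd U V)⟩⟩

lemma left (hd : ∀ U V, 0 ≤ d U V) (h : NearOn B d f f₀) : NearOn B d (fun U _ => f₀ U) f₀ := by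
  obtain ⟨C, hC, h⟩ := h
  refine ⟨C, hC, fun U hU V hV => ⟨(h U hU V hV).1, (h U hU V hV).1, ?_⟩⟩
  simpa using mul_nonneg hC (hd U V)

lemma add (_hd : ∀ U V, 0 ≤ d U V) (hf : NearOn B d f f₀) (hg : NearOn B d g g₀) :
    NearOn B d (fun U V => f U V + g U V) (fun U => f₀ U + g₀ U) := by
  obtain ⟨C, hC, hf⟩ := hf
  obtain ⟨D, hD, hg⟩ := hg
  refine ⟨C + D, add_nonneg hC hD, fun U hU V hV => ?_⟩
  obtain ⟨f1, f2, f3⟩ := hf U hU V hV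
  obtain ⟨g1, g2, g3⟩ := hg U hU V hV
  refine ⟨(abs_add_le _ _).trans (add_le_add f1 g1), (abs_add_le _ _).trans (add_le_add f2 g2), ?_⟩
  have : f U V + g U V - (f₀ U + g₀ U) = (f U V - f₀ U) + (g U V - g₀ U) := by ring
  rw [this, add_mul]
  exact (abs_add_le _ _).trans (add_le_add f3 g3)

lemma mul (hd : ∀ U V, 0 ≤ d U V) (hf : NearOn B d f f₀) (hg : NearOn B d g g₀) :
    NearOn B d (fun U V => f U V * g U V) (fun U => f₀ U * g₀ U) := by
  obtain ⟨C, hC, hf⟩ := hf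
  obtain ⟨D, hD, hg⟩ := hg
  refine ⟨C * D + C * D, by positivity, fun U hU V hV => ?_⟩
  obtain ⟨f1, f2, f3⟩ := hf U hU V hV
  obtain ⟨g1, g2, g3⟩ := hg U hU V hV
  have hCD := mul_nonneg hC hD
  refine ⟨?_, ?_, ?_⟩
  · rw [abs_mul]
    have := mul_le_mul f1 g1 (abs_nonneg _) hC
    linarith
  · rw [abs_mul]
    have := mul_le_mul f2 g2 (abs_nonneg _) hC
    linarith
  · have : f U V * g U V - f₀ U * g₀ U = f U V * (g U V - g₀ U) + (f U V - f₀ U) * g₀ U := by ring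
    rw [this]
    refine (abs_add_le _ _).trans ?_
    rw [abs_mul, abs_mul, add_mul]
    have h1 := mul_le_mul f2 g3 (abs_nonneg _) hC
    have h2 := mul_le_mul f3 g1 (abs_nonneg _) (mul_nonneg hC (hd U V))
    nlinarith

lemma const_mul (hd : ∀ U V, 0 ≤ d U V) (c : ℝ) (hf : NearOn B d f f₀) :
    NearOn B d (fun U V => c * f U V) (fun U => c * f₀ U) := (const hd c).mul hd hf

lemma neg (hd : ∀ U V, 0 ≤ d U V) (hf : NearOn B d f f₀) :
    NearOn B d (fun U V => -f U V) (fun U => -f₀ U) :=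
  (hf.const_mul hd (-1)).congr (fun _ _ _ _ => by ring) (fun _ _ => by ring)

lemma sub (hd : ∀ U V, 0 ≤ d U V) (hf : NearOn B d f f₀) (hg : NearOn B d g g₀) :
    NearOn B d (fun U V => f U V - g U V) (fun U => f₀ U - g₀ U) :=
  (hf.add hd (hg.neg hd)).congr (fun _ _ _ _ => by ring) (fun _ _ => by ring)

lemma sq (hd : ∀ U V, 0 ≤ d U V) (hf : NearOn B d f f₀) :
    NearOn B d (fun U V => f U V ^ 2) (fun U => f₀ U ^ 2) :=
  (hf.mul hd hf).congr (fun _ _ _ _ => by ring) (fun _ _ => by ring)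

lemma inv {δ : ℝ} (hd : ∀ U V, 0 ≤ d U V) (hδ : 0 < δ) (hf : NearOn B d f f₀) (h : ∀ U ∈ B, ∀ V ∈ B, δ ≤ f U V)
    (h₀ : ∀ U ∈ B, δ ≤ f₀ U) : NearOn B d (fun U V => (f U V)⁻¹) (fun U => (f₀ U)⁻¹) := by
  obtain ⟨C, hC, hf⟩ := hf
  refine ⟨δ⁻¹ + C * δ⁻¹ * δ⁻¹, by positivity, fun U hU V hV => ?_⟩
  obtain ⟨f1, f2, f3⟩ := hf U hU V hV
  have p1 := hδ.trans_le (h U hU V hV)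
  have p0 := hδ.trans_le (h₀ U hU)
  have i1 : (f U V)⁻¹ ≤ δ⁻¹ := inv_anti₀ hδ (h U hU V hV)
  have i0 : (f₀ U)⁻¹ ≤ δ⁻¹ := inv_anti₀ hδ (h₀ U hU)
  have hn : 0 ≤ C * δ⁻¹ * δ⁻¹ := by positivity
  have hdn : 0 ≤ C * d U V := (abs_nonneg _).trans f3
  refine ⟨?_, ?_, ?_⟩
  · rw [abs_of_pos (inv_pos.2 p0)]; linarith
  · rw [abs_of_pos (inv_pos.2 p1)]; linarith
  · have : (f U V)⁻¹ - (f₀ U)⁻¹ = -(f U V - f₀ U) * ((f U V)⁻¹ * (f₀ U)⁻¹) := by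
      field_simp; ring
    rw [this, abs_mul, abs_neg, abs_of_pos (mul_pos (inv_pos.2 p1) (inv_pos.2 p0))]
    have h2 : (f U V)⁻¹ * (f₀ U)⁻¹ ≤ δ⁻¹ * δ⁻¹ :=
      mul_le_mul i1 i0 (inv_pos.2 p0).le (inv_pos.2 hδ).le
    have h3 := mul_le_mul f3 h2 (mul_pos (inv_pos.2 p1) (inv_pos.2 p0)).le hdn
    have h4 : 0 ≤ δ⁻¹ * d U V := mul_nonneg (inv_pos.2 hδ).le (hd U V)
    nlinarith

lemma log {δ : ℝ} (hd : ∀ U V, 0 ≤ d U V) (hδ : 0 < δ) (hf : NearOn B d f f₀)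
    (h : ∀ U ∈ B, ∀ V ∈ B, δ ≤ f U V) (h₀ : ∀ U ∈ B, δ ≤ f₀ U) :
    NearOn B d (fun U V => Real.log (f U V)) (fun U => Real.log (f₀ U)) := by
  obtain ⟨C, hC, hf⟩ := hf
  have hb : ∀ x, δ ≤ x → |x| ≤ C → |Real.log x| ≤ |Real.log δ| + C := by
    intro x hx hxC
    have hx0 := hδ.trans_le hx
    have h1 := Real.log_le_log hδ hx
    have h2 := Real.log_le_sub_one_of_pos hx0
    have h3 := le_abs_self x
    have h4 := neg_abs_le (Real.log δ)
    have h5 := abs_nonneg (Real.log δ)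
    rw [abs_le]; constructor <;> linarith
  have hl : ∀ x y, δ ≤ x → δ ≤ y → Real.log x - Real.log y ≤ δ⁻¹ * |x - y| := by
    intro x y hx hy
    have hx0 := hδ.trans_le hx
    have hy0 := hδ.trans_le hy
    rw [← Real.log_div hx0.ne' hy0.ne']
    have h1 := Real.log_le_sub_one_of_pos (div_pos hx0 hy0)
    have h2 : x / y - 1 = y⁻¹ * (x - y) := by field_simp
    rw [h2] at h1
    refine h1.trans ((le_abs_self _).trans ?_)
    rw [abs_mul, abs_of_pos (inv_pos.2 hy0)]
    exact mul_le_mul_of_nonneg_right (inv_anti₀ hδ hy) (abs_nonneg _)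
  refine ⟨|Real.log δ| + C + δ⁻¹ * C, by positivity, fun U hU V hV => ?_⟩
  obtain ⟨f1, f2, f3⟩ := hf U hU V hV
  have hp : 0 ≤ δ⁻¹ * C := by positivity
  refine ⟨(hb _ (h₀ U hU) f1).trans (by linarith), (hb _ (h U hU V hV) f2).trans (by linarith), ?_⟩
  have key : |Real.log (f U V) - Real.log (f₀ U)| ≤ δ⁻¹ * |f U V - f₀ U| := by
    rw [abs_le]
    have h1 := hl _ _ (h U hU V hV) (h₀ U hU)
    have h2 := hl _ _ (h₀ U hU) (h U hU V hV)
    rw [abs_sub_comm] at h2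
    constructor <;> linarith
  have h4 := mul_le_mul_of_nonneg_left f3 (inv_pos.2 hδ).le
  have h5 : 0 ≤ (|Real.log δ| + C) * d U V := mul_nonneg (by positivity) (hd U V)
  linarith

lemma exp (hd : ∀ U V, 0 ≤ d U V) (hf : NearOn B d f f₀) :
    NearOn B d (fun U V => Real.exp (f U V)) (fun U => Real.exp (f₀ U)) := by
  obtain ⟨C, hC, hf⟩ := hf
  have hl : ∀ x y, |x| ≤ C → |y| ≤ C → Real.exp x - Real.exp y ≤ Real.exp C * |x - y| := by
    intro x y hx hy
    have h1 := Real.add_one_le_exp (y - x)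
    have h2 : Real.exp y = Real.exp x * Real.exp (y - x) := by rw [← Real.exp_add]; ring_nf
    have h3 : Real.exp x - Real.exp y ≤ Real.exp x * (x - y) := by
      rw [h2]; nlinarith [Real.exp_pos x]
    refine h3.trans ?_
    have h4 : Real.exp x ≤ Real.exp C := Real.exp_le_exp.2 ((le_abs_self x).trans hx)
    calc Real.exp x * (x - y) ≤ Real.exp x * |x - y| :=
          mul_le_mul_of_nonneg_left (le_abs_self _) (Real.exp_pos x).le
      _ ≤ _ := mul_le_mul_of_nonneg_right h4 (abs_nonneg _)
  refine ⟨Real.exp C + Real.exp C * C, by positivity, fun U hU V hV => ?_⟩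
  obtain ⟨f1, f2, f3⟩ := hf U hU V hV
  have hp : 0 ≤ Real.exp C * C := by positivity
  have hb : ∀ x, |x| ≤ C → |Real.exp x| ≤ Real.exp C := fun x hx => by
    rw [abs_of_pos (Real.exp_pos _)]; exact Real.exp_le_exp.2 ((le_abs_self x).trans hx)
  refine ⟨(hb _ f1).trans (by linarith), (hb _ f2).trans (by linarith), ?_⟩
  have key : |Real.exp (f U V) - Real.exp (f₀ U)| ≤ Real.exp C * |f U V - f₀ U| := by
    rw [abs_le]
    have h1 := hl _ _ f2 f1
    have h2 := hl _ _ f1 f2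
    rw [abs_sub_comm] at h2
    constructor <;> linarith
  have h4 := mul_le_mul_of_nonneg_left f3 (Real.exp_pos C).le
  have h5 : 0 ≤ Real.exp C * d U V := mul_nonneg (Real.exp_pos C).le (hd U V)
  linarith

lemma div {δ : ℝ} (hd : ∀ U V, 0 ≤ d U V) (hδ : 0 < δ) (hf : NearOn B d f f₀)
    (hg : NearOn B d g g₀) (h : ∀ U ∈ B, ∀ V ∈ B, δ ≤ g U V) (h₀ : ∀ U ∈ B, δ ≤ g₀ U) :
    NearOn B d (fun U V => f U V / g U V) (fun U => f₀ U / g₀ U) :=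
  (hf.mul hd (hg.inv hd hδ h h₀)).congr (fun _ _ _ _ => div_eq_mul_inv _ _)
    (fun _ _ => div_eq_mul_inv _ _)

lemma amean {f : X → ℝ} (hd : ∀ U V, 0 ≤ d U V) (hf : LipBddOn B d f) :
    NearOn B d (fun U V => amean (f U) (f V)) f :=
  (((hf.left hd).add hd hf).const_mul hd (1 / 2)).congr
    (fun _ _ _ _ => by unfold EulerDG.amean; ring) (fun _ _ => by ring)

/-- The logarithmic mean lies between its arguments, so the constant of `f` serves again and mere
positivity suffices. -/
lemma logMean {f : X → ℝ} (hf : LipBddOn B d f) (h0 : ∀ U ∈ B, 0 < f U) :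
    NearOn B d (fun U V => logMean (f U) (f V)) f := by
  obtain ⟨C, hC, hf⟩ := hf
  refine ⟨C, hC, fun U hU V hV => ?_⟩
  obtain ⟨f1, f2, f3⟩ := hf U hU V hV
  have pU := h0 U hU
  have pV := h0 V hV
  refine ⟨f1, ?_, (abs_logMean_sub_le pU pV).trans f3⟩
  rw [abs_of_pos (logMean_pos pU pV)]
  rw [abs_of_pos pU] at f1
  rw [abs_of_pos pV] at f2
  rcases le_total (f U) (f V) with h | h
  · exact (logMean_mem_of_le pU h).2.trans f2
  · rw [logMean_comm]; exact (logMean_mem_of_le pV h).2.trans f1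

lemma sum {ι : Type*} (s : Finset ι) {f : ι → X → X → ℝ} {f₀ : ι → X → ℝ}
    (hd : ∀ U V, 0 ≤ d U V) (h : ∀ i ∈ s, NearOn B d (f i) (f₀ i)) :
    NearOn B d (fun U V => ∑ i ∈ s, f i U V) (fun U => ∑ i ∈ s, f₀ i U) := by
  classical
  induction s using Finset.induction_on with
  | empty => simpa using const hd 0
  | insert i s hi ih =>
    simp only [Finset.sum_insert hi]
    exact (h i (Finset.mem_insert_self _ _)).add hd
      (ih fun j hj => h j (Finset.mem_insert_of_mem hj))

end NearOn

lemma le_logMean {δ x y : ℝ} (hδ : 0 < δ) (hx : δ ≤ x) (hy : δ ≤ y) : δ ≤ logMean x y := by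
  rcases le_total x y with h | h
  · exact hx.trans (logMean_mem_of_le (hδ.trans_le hx) h).1
  · rw [logMean_comm]; exact hy.trans (logMean_mem_of_le (hδ.trans_le hy) h).1

/-! ### Uniform estimates on the set of bounded states. -/

section BoundedStates

/-- The set of the states that satisfy the uniform bounds. -/
def boundedStates (γ ρmin Emax smin : ℝ) : Set State := {U | IsBoundedState γ ρmin Emax smin U}

variable {γ ρmin Emax smin : ℝ}

/-- Positivity of the pressure and the lower entropy bound merge into one non-strict inequality.
This gives a uniform lower bound of the pressure and passes to limits. -/
lemma isBoundedState_iff (hρ : 0 < ρmin) {U : State} :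
    IsBoundedState γ ρmin Emax smin U ↔
      ρmin ≤ dens U ∧ energy U ≤ Emax ∧ Real.exp smin * dens U ^ γ ≤ pressure γ U := by
  unfold IsBoundedState thermoEntropy
  constructor
  · rintro ⟨h1, h2, h3, h4⟩
    have hr := Real.rpow_pos_of_pos (hρ.trans_le h1) γ
    refine ⟨h1, h2, ?_⟩
    rwa [Real.le_log_iff_exp_le (div_pos h3 hr), le_div_iff₀ hr] at h4
  · rintro ⟨h1, h2, h3⟩
    have hr := Real.rpow_pos_of_pos (hρ.trans_le h1) γ
    have hp : 0 < pressure γ U := (mul_pos (Real.exp_pos _) hr).trans_le h3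
    refine ⟨h1, h2, hp, ?_⟩
    rwa [Real.le_log_iff_exp_le (div_pos hp hr), le_div_iff₀ hr]

/-- Uniform bounds of the primitive variables. -/
lemma exists_primitive_bounds (hγ : 1 < γ) (hρ : 0 < ρmin) (Emax smin : ℝ) :
    ∃ R δ P, 0 < R ∧ 0 < δ ∧ 0 < P ∧ ∀ U ∈ boundedStates γ ρmin Emax smin,
      dens U ≤ R ∧ δ ≤ pressure γ U ∧ pressure γ U ≤ P ∧ |mom U 0| ≤ R ∧ |mom U 1| ≤ R ∧
        |energy U| ≤ P := by
  have hg : 0 < γ - 1 := by linarith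
  set δ := Real.exp smin * ρmin ^ γ with hδ
  have hδ0 : 0 < δ := mul_pos (Real.exp_pos _) (Real.rpow_pos_of_pos hρ _)
  -- The pressure is at most `(γ - 1) E` and at least `exp smin * ρ ^ γ`, and `ρ ≤ ρ ^ γ` as soon as
  -- `ρ ≥ 1`; so the energy bound limits the density.
  set R₀ := 1 + (γ - 1) * |Emax| / Real.exp smin with hR₀
  have hR₀0 : 1 ≤ R₀ := by rw [hR₀]; have := Real.exp_pos smin; simp; positivity
  refine ⟨R₀ + 2 * R₀ * |Emax| + 1, δ, (γ - 1) * |Emax| + |Emax| + 1, by positivity, hδ0,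
    by positivity, fun U hU => ?_⟩
  obtain ⟨h1, h2, h3⟩ := (isBoundedState_iff hρ).1 hU
  have hd0 : 0 < dens U := hρ.trans_le h1
  have hδp : δ ≤ pressure γ U := by
    refine le_trans ?_ h3
    rw [hδ]
    exact mul_le_mul_of_nonneg_left (Real.rpow_le_rpow hρ.le h1 (by linarith)) (Real.exp_pos _).le
  have hp0 : 0 < pressure γ U := hδ0.trans_le hδp
  have hE := energy_eq hγ hd0.ne' (U := U)
  have hk : 0 ≤ dens U * (vel U 0 ^ 2 + vel U 1 ^ 2) / 2 := by positivity
  have hE0 : 0 ≤ energy U := by rw [hE]; positivity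
  have hEa : |energy U| ≤ |Emax| := by
    rw [abs_of_nonneg hE0]; exact h2.trans (le_abs_self _)
  have hEa' : energy U ≤ |Emax| := h2.trans (le_abs_self _)
  have hpE : pressure γ U ≤ (γ - 1) * |Emax| := by
    have : pressure γ U / (γ - 1) ≤ |Emax| := by linarith
    rw [div_le_iff₀ hg] at this; linarith
  have hρR : dens U ≤ R₀ := by
    rcases le_total (dens U) 1 with h | h
    · exact h.trans hR₀0
    · have h4 : dens U ≤ dens U ^ γ := by
        nth_rewrite 1 [← Real.rpow_one (dens U)]
        exact Real.rpow_le_rpow_of_exponent_le h hγ.le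
      have h5 : dens U ^ γ ≤ (γ - 1) * |Emax| / Real.exp smin := by
        rw [le_div_iff₀ (Real.exp_pos _)]; linarith
      linarith
  have hm : dens U * (vel U 0 ^ 2 + vel U 1 ^ 2) / 2 ≤ |Emax| := by
    have : 0 ≤ pressure γ U / (γ - 1) := by positivity
    linarith
  have hmom : ∀ a, |mom U a| ≤ R₀ + 2 * R₀ * |Emax| + 1 := by
    intro a
    have h6 : mom U a ^ 2 ≤ R₀ * (2 * |Emax|) := by
      rw [mom_eq hd0.ne']
      have h7 : vel U a ^ 2 ≤ vel U 0 ^ 2 + vel U 1 ^ 2 := by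
        fin_cases a <;> simp <;> positivity
      calc (dens U * vel U a) ^ 2 = dens U * (dens U * vel U a ^ 2) := by ring
        _ ≤ dens U * (dens U * (vel U 0 ^ 2 + vel U 1 ^ 2)) := by gcongr
        _ ≤ R₀ * (2 * |Emax|) := by
          apply mul_le_mul hρR (by linarith) (by positivity) (by positivity)
    have h8 : |mom U a| ≤ mom U a ^ 2 + 1 := by
      rw [← sq_abs]; nlinarith [sq_nonneg (|mom U a| - 1), abs_nonneg (mom U a)]
    linarith
  have hRE : 0 ≤ 2 * R₀ * |Emax| := by positivity
  have hgE : 0 ≤ (γ - 1) * |Emax| := by positivity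
  have := abs_nonneg Emax
  exact ⟨by linarith, hδp, by linarith, hmom 0, hmom 1, by linarith⟩

lemma dist_nonneg' (U V : State) : 0 ≤ ‖V - U‖ := norm_nonneg _

lemma lipBddOn_coord (hγ : 1 < γ) (hρ : 0 < ρmin) (k : Fin 4) :
    LipBddOn (boundedStates γ ρmin Emax smin) (fun U V => ‖V - U‖) (fun U => U k) := by
  obtain ⟨R, δ, P, hR, hδ, hP, h⟩ := exists_primitive_bounds hγ hρ Emax smin
  have hb : ∀ U ∈ boundedStates γ ρmin Emax smin, |U k| ≤ R + P + 1 := by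
    intro U hU
    obtain ⟨h1, h2, h3, h4, h5, h6⟩ := h U hU
    have h0 : 0 ≤ U 0 := hρ.le.trans hU.1
    fin_cases k
    · simp only [Fin.zero_eta]; rw [abs_of_nonneg h0]; change dens U ≤ _; linarith
    · simp only [Fin.mk_one]; change |mom U 0| ≤ _; linarith
    · change |mom U 1| ≤ _; linarith
    · change |energy U| ≤ _; linarith
  refine ⟨R + P + 1, by positivity, fun U hU V hV => ⟨hb U hU, hb V hV, ?_⟩⟩
  have h1 : |V k - U k| ≤ ‖V - U‖ := by
    have := norm_le_pi_norm (V - U) k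
    simpa using this
  have h2 := norm_nonneg (V - U)
  nlinarith

/-- The pointwise lower bounds that the calculus on the set of bounded states uses. -/
structure BoundedCalculus (γ : ℝ) (B : Set State) (d : State → State → ℝ) (δ : ℝ) : Prop where
  d_nonneg : ∀ U V, 0 ≤ d U V
  pos : 0 < δ
  coord : ∀ k : Fin 4, LipBddOn B d (fun U => U k)
  le_dens : ∀ U ∈ B, δ ≤ dens U
  le_pressure : ∀ U ∈ B, δ ≤ pressure γ U
  le_dens_div : ∀ U ∈ B, δ ≤ dens U / pressure γ U

lemma exists_boundedCalculus (hγ : 1 < γ) (hρ : 0 < ρmin) (Emax smin : ℝ) :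
    ∃ δ, BoundedCalculus γ (boundedStates γ ρmin Emax smin) (fun U V => ‖V - U‖) δ := by
  obtain ⟨R, δ, P, hR, hδ, hP, h⟩ := exists_primitive_bounds hγ hρ Emax smin
  refine ⟨min (min ρmin δ) (ρmin / P), dist_nonneg', by positivity, lipBddOn_coord hγ hρ, ?_, ?_, ?_⟩
  · intro U hU; exact (min_le_left _ _).trans ((min_le_left _ _).trans hU.1)
  · intro U hU; exact (min_le_left _ _).trans ((min_le_right _ _).trans (h U hU).2.1)
  · intro U hU
    refine (min_le_right _ _).trans ?_
    have := (h U hU).2.2.1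
    have h1 := hδ.trans_le (h U hU).2.1
    have h2 : ρmin ≤ dens U := hU.1
    have := hρ.trans_le h2
    gcongr

namespace BoundedCalculus

variable {B : Set State} {d : State → State → ℝ} {δ : ℝ} (h : BoundedCalculus γ B d δ)
include h

lemma dens : LipBddOn B d dens := h.coord 0

lemma energy : LipBddOn B d energy := h.coord 3

lemma mom (a : Fin 2) : LipBddOn B d (fun U => mom U a) := by
  fin_cases a
  · exact h.coord 1
  · exact h.coord 2

lemma vel (a : Fin 2) : LipBddOn B d (fun U => vel U a) :=
  (h.mom a).div h.d_nonneg h.pos h.dens (fun _ _ V hV => h.le_dens V hV) h.le_dens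

lemma pressure : LipBddOn B d (pressure γ) := by
  have hd := h.d_nonneg
  refine ((h.energy.sub hd (((((h.mom 0).sq hd).add hd ((h.mom 1).sq hd)).div hd h.pos h.dens
    (fun _ _ V hV => h.le_dens V hV) h.le_dens).const_mul hd (1 / 2))).const_mul hd (γ - 1)).congr
    ?_ ?_
  · intro U hU V hV
    have := (h.pos.trans_le (h.le_dens V hV)).ne'
    unfold EulerDG.pressure; field_simp
  · intro U hU
    have := (h.pos.trans_le (h.le_dens U hU)).ne'
    unfold EulerDG.pressure; field_simp

lemma temperature_inv : LipBddOn B d (fun U => EulerDG.dens U / EulerDG.pressure γ U) :=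
  h.dens.div h.d_nonneg h.pos h.pressure (fun _ _ V hV => h.le_pressure V hV) h.le_pressure

lemma thermoEntropy : LipBddOn B d (thermoEntropy γ) := by
  have hd := h.d_nonneg
  refine ((h.pressure.log hd h.pos (fun _ _ V hV => h.le_pressure V hV) h.le_pressure).sub hd
    ((h.dens.log hd h.pos (fun _ _ V hV => h.le_dens V hV) h.le_dens).const_mul hd γ)).congr
    ?_ ?_
  · intro U hU V hV
    exact thermoEntropy_eq (h.pos.trans_le (h.le_dens V hV)) (h.pos.trans_le (h.le_pressure V hV))
  · intro U hU
    exact thermoEntropy_eq (h.pos.trans_le (h.le_dens U hU)) (h.pos.trans_le (h.le_pressure U hU))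

lemma mathEntropy : LipBddOn B d (mathEntropy γ) := by
  have hd := h.d_nonneg
  refine ((h.dens.mul hd h.thermoEntropy).const_mul hd (-1 / (γ - 1))).congr ?_ ?_
  · intro U hU V hV; unfold EulerDG.mathEntropy; ring
  · intro U hU; unfold EulerDG.mathEntropy; ring

lemma entropyPotential (a : Fin 2) : LipBddOn B d (entropyPotential a) :=
  h.dens.mul h.d_nonneg (h.vel a)

lemma entropyVars (k : Fin 4) : LipBddOn B d (fun U => entropyVars γ U k) := by
  have hd := h.d_nonneg
  have hβ := h.temperature_inv
  fin_cases k
  · refine ((((NearOn.const hd γ).sub hd h.thermoEntropy).const_mul hd (1 / (γ - 1))).sub hd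
      ((hβ.mul hd (((h.vel 0).sq hd).add hd ((h.vel 1).sq hd))).const_mul hd (1 / 2))).congr ?_ ?_
    · intro U hU V hV; simp [EulerDG.entropyVars]; ring
    · intro U hU; simp [EulerDG.entropyVars]; ring
  · refine (hβ.mul hd (h.vel 0)).congr ?_ ?_
    · intro U hU V hV; simp [EulerDG.entropyVars]; ring
    · intro U hU; simp [EulerDG.entropyVars]; ring
  · refine (hβ.mul hd (h.vel 1)).congr ?_ ?_
    · intro U hU V hV; simp [EulerDG.entropyVars]; ring
    · intro U hU; simp [EulerDG.entropyVars]; ring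
  · refine (hβ.neg hd).congr ?_ ?_
    · intro U hU V hV; simp [EulerDG.entropyVars]
    · intro U hU; simp [EulerDG.entropyVars]

lemma eulerFlux (a : Fin 2) (k : Fin 4) : LipBddOn B d (fun U => eulerFlux γ a U k) := by
  have hd := h.d_nonneg
  have hif : ∀ b : Fin 2, LipBddOn B d (fun U => if a = b then EulerDG.pressure γ U else 0) := by
    intro b
    by_cases hb : a = b
    · simpa [hb] using h.pressure
    · simpa [hb] using NearOn.const hd 0
  fin_cases k
  · exact h.dens.mul hd (h.vel a)
  · exact ((h.vel a).mul hd (h.mom 0)).add hd (hif 0)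
  · exact ((h.vel a).mul hd (h.mom 1)).add hd (hif 1)
  · exact (h.vel a).mul hd (h.energy.add hd h.pressure)

/-- The flux is composed of means, products and a quotient, all covered by the calculus. The
resulting function of the first argument is the value on the diagonal, which `volumeFlux_self`
identifies with the Euler flux. The lower bound of `ρ / p` serves the division by its logarithmic
mean. -/
lemma volumeFlux (hγ : 1 < γ) (a : Fin 2) (k : Fin 4) :
    NearOn B d (fun U V => volumeFlux γ a U V k) (fun U => EulerDG.eulerFlux γ a U k) := by
  have hd := h.d_nonneg
  have hif : ∀ b : Fin 2, NearOn B d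
      (fun U V => if a = b then amean (EulerDG.pressure γ U) (EulerDG.pressure γ V) else 0)
      (fun U => if a = b then EulerDG.pressure γ U else 0) := by
    intro b
    by_cases hb : a = b
    · simpa [hb] using h.pressure.amean hd
    · simpa [hb] using NearOn.const hd 0
  have hr := h.dens.logMean (fun U hU => h.pos.trans_le (h.le_dens U hU))
  have hβ := h.temperature_inv.logMean (fun U hU => h.pos.trans_le (h.le_dens_div U hU))
  have hu : ∀ b, NearOn B d (fun U V => amean (EulerDG.vel U b) (EulerDG.vel V b)) _ :=
    fun b => (h.vel b).amean hd
  have hfρ := hr.mul hd (hu a)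
  have self : ∀ U ∈ B, EulerDG.eulerFlux γ a U k = EulerDG.volumeFlux γ a U U k := fun U hU => by
    rw [volumeFlux_self hγ a (h.pos.trans_le (h.le_dens U hU))]
  fin_cases k
  · refine hfρ.congr (fun U hU V hV => rfl) (fun U hU => rfl)
  · refine (((hu 0).mul hd hfρ).add hd (hif 0)).congr (fun U hU V hV => rfl) (fun U hU => ?_)
    rw [self U hU]; simp [EulerDG.volumeFlux, amean_self, logMean_self]
  · refine (((hu 1).mul hd hfρ).add hd (hif 1)).congr (fun U hU V hV => rfl) (fun U hU => ?_)
    rw [self U hU]; simp [EulerDG.volumeFlux, amean_self, logMean_self]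
  · refine (((((hr.mul hd ((((hu 0).sq hd).add hd ((hu 1).sq hd)).sub hd
      ((((((h.vel 0).sq hd).add hd ((h.vel 1).sq hd)).amean hd)).const_mul hd (1 / 2)))).add hd
      ((hr.div hd h.pos hβ (fun U hU V hV =>
        le_logMean h.pos (h.le_dens_div U hU) (h.le_dens_div V hV)) h.le_dens_div).const_mul hd
          (1 / (γ - 1)))).add hd (h.pressure.amean hd)).mul hd (hu a)).sub hd
      (((h.pressure.sub hd (h.pressure.left hd)).mul hd
        ((h.vel a).sub hd ((h.vel a).left hd))).const_mul hd (1 / 4))).congr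
      (fun U hU V hV => ?_) (fun U hU => ?_)
    · simp [EulerDG.volumeFlux]; ring
    · rw [self U hU]; simp [EulerDG.volumeFlux, amean_self, logMean_self]; left; left; ring

end BoundedCalculus

lemma norm_sub_le_of_components {C0 C1 C2 C3 d : ℝ} {U V : State} (p0 : 0 ≤ C0) (p1 : 0 ≤ C1)
    (p2 : 0 ≤ C2) (p3 : 0 ≤ C3) (hd : 0 ≤ d) (h0 : |dens V - dens U| ≤ C0 * d)
    (h1 : |mom V 0 - mom U 0| ≤ C1 * d) (h2 : |mom V 1 - mom U 1| ≤ C2 * d)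
    (h3 : |energy V - energy U| ≤ C3 * d) : ‖V - U‖ ≤ (C0 + C1 + C2 + C3) * d := by
  rw [pi_norm_le_iff_of_nonneg (by positivity)]
  have q0 := mul_nonneg p0 hd
  have q1 := mul_nonneg p1 hd
  have q2 := mul_nonneg p2 hd
  have q3 := mul_nonneg p3 hd
  intro k
  fin_cases k
  · change |dens V - dens U| ≤ _; linarith
  · change |mom V 0 - mom U 0| ≤ _; linarith
  · change |mom V 1 - mom U 1| ≤ _; linarith
  · change |energy V - energy U| ≤ _; linarith

/-- The conservative variables are Lipschitz functions of `(ρ, m, η)`. -/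
lemma exists_norm_sub_le_consEntropyVars (hγ : 1 < γ) (hρ : 0 < ρmin) (Emax smin : ℝ) :
    ∃ C, 0 ≤ C ∧ ∀ U ∈ boundedStates γ ρmin Emax smin, ∀ V ∈ boundedStates γ ρmin Emax smin,
      ‖V - U‖ ≤ C * ‖consEntropyVars γ V - consEntropyVars γ U‖ := by
  obtain ⟨δ, hB⟩ := exists_boundedCalculus hγ hρ Emax smin
  set B := boundedStates γ ρmin Emax smin
  set d : State → State → ℝ := fun U V => ‖consEntropyVars γ V - consEntropyVars γ U‖ with hd'
  have hd : ∀ U V, 0 ≤ d U V := fun _ _ => norm_nonneg _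
  -- The bounds are independent of the distance, and a component of `consEntropyVars` is trivially
  -- Lipschitz for the new one.
  have lift : ∀ (f : State → ℝ) (k : Fin 4), LipBddOn B (fun U V => ‖V - U‖) f →
      (∀ U, f U = consEntropyVars γ U k) → LipBddOn B d f := by
    rintro f k ⟨C, hC, h⟩ hf
    refine ⟨C + 1, by positivity, fun U hU V hV => ⟨(h U hU V hV).1.trans (by linarith),
      (h U hU V hV).2.1.trans (by linarith), ?_⟩⟩
    have h1 : |f V - f U| ≤ d U V := by
      rw [hf, hf]
      exact norm_le_pi_norm (consEntropyVars γ V - consEntropyVars γ U) k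
    have := hd U V
    nlinarith
  have hdens : LipBddOn B d dens := lift _ 0 hB.dens (fun _ => rfl)
  have hm0 : LipBddOn B d (fun U => mom U 0) := lift _ 1 (hB.mom 0) (fun _ => rfl)
  have hm1 : LipBddOn B d (fun U => mom U 1) := lift _ 2 (hB.mom 1) (fun _ => rfl)
  have hη : LipBddOn B d (mathEntropy γ) := lift _ 3 hB.mathEntropy (fun _ => rfl)
  have hld : ∀ U ∈ B, ∀ V ∈ B, δ ≤ dens V := fun _ _ V hV => hB.le_dens V hV
  -- Solving the definition of `η` for the pressure gives `log p = γ log ρ - (γ - 1) η / ρ`; the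
  -- exponential then recovers the energy.
  have hlogp : LipBddOn B d (fun U => Real.log (pressure γ U)) := by
    refine (((hη.div hd hB.pos hdens hld hB.le_dens).const_mul hd (-(γ - 1))).add hd
      ((hdens.log hd hB.pos hld hB.le_dens).const_mul hd γ)).congr ?_ ?_
    all_goals
      have key : ∀ U ∈ B, Real.log (pressure γ U) =
          -(γ - 1) * (mathEntropy γ U / dens U) + γ * Real.log (dens U) := by
        intro U hU
        have h1 := hB.pos.trans_le (hB.le_dens U hU)
        have h2 := hB.pos.trans_le (hB.le_pressure U hU)
        have h3 : γ - 1 ≠ 0 := by linarith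
        unfold mathEntropy
        rw [thermoEntropy_eq h1 h2]; field_simp; ring
    · intro U hU V hV; exact key V hV
    · intro U hU; exact key U hU
  have hE : LipBddOn B d energy := by
    refine (((hlogp.exp hd).const_mul hd (1 / (γ - 1))).add hd
      ((((hm0.sq hd).add hd (hm1.sq hd)).div hd hB.pos hdens hld hB.le_dens).const_mul hd
        (1 / 2))).congr ?_ ?_
    all_goals
      have key : ∀ U ∈ B, energy U = 1 / (γ - 1) * Real.exp (Real.log (pressure γ U)) +
          1 / 2 * ((mom U 0 ^ 2 + mom U 1 ^ 2) / dens U) := by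
        intro U hU
        have h1 := hB.pos.trans_le (hB.le_dens U hU)
        have h2 := hB.pos.trans_le (hB.le_pressure U hU)
        have h3 : γ - 1 ≠ 0 := by linarith
        rw [Real.exp_log h2]
        unfold pressure; field_simp; ring
    · intro U hU V hV; exact key V hV
    · intro U hU; exact key U hU
  obtain ⟨C0, p0, h0⟩ := hdens
  obtain ⟨C1, p1, h1⟩ := hm0
  obtain ⟨C2, p2, h2⟩ := hm1
  obtain ⟨C3, p3, h3⟩ := hE
  refine ⟨C0 + C1 + C2 + C3, by positivity, fun U hU V hV => ?_⟩
  exact norm_sub_le_of_components p0 p1 p2 p3 (hd U V) (h0 U hU V hV).2.2 (h1 U hU V hV).2.2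
    (h2 U hU V hV).2.2 (h3 U hU V hV).2.2

lemma NearOn.of_dist_le {X : Type*} {B : Set X} {d d' : X → X → ℝ} {f : X → ℝ}
    (h : LipBddOn B d f) (hd' : ∀ U ∈ B, ∀ V ∈ B, |f V - f U| ≤ d' U V) : LipBddOn B d' f := by
  obtain ⟨C, hC, h⟩ := h
  refine ⟨C + 1, by positivity, fun U hU V hV => ⟨(h U hU V hV).1.trans (by linarith),
    (h U hU V hV).2.1.trans (by linarith), ?_⟩⟩
  have h1 := hd' U hU V hV
  have h2 : 0 ≤ C * d' U V := mul_nonneg hC ((abs_nonneg _).trans h1)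
  linarith

/-- The conservative variables are Lipschitz functions of density, velocity and temperature. -/
lemma exists_norm_sub_le_primitive (hγ : 1 < γ) (hρ : 0 < ρmin) (Emax smin : ℝ) :
    ∃ C, 0 ≤ C ∧ ∀ U ∈ boundedStates γ ρmin Emax smin, ∀ V ∈ boundedStates γ ρmin Emax smin,
      ‖V - U‖ ≤ C * (|dens V - dens U| + |vel V 0 - vel U 0| + |vel V 1 - vel U 1|
        + |temperature γ V - temperature γ U|) := by
  obtain ⟨δ, hB⟩ := exists_boundedCalculus hγ hρ Emax smin
  set B := boundedStates γ ρmin Emax smin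
  set d : State → State → ℝ := fun U V => |dens V - dens U| + |vel V 0 - vel U 0|
    + |vel V 1 - vel U 1| + |temperature γ V - temperature γ U| with hd'
  have hd : ∀ U V, 0 ≤ d U V := fun _ _ => by simp only [hd']; positivity
  have hθ0 : LipBddOn B (fun U V => ‖V - U‖) (temperature γ) :=
    hB.pressure.div hB.d_nonneg hB.pos hB.dens (fun _ _ V hV => hB.le_dens V hV) hB.le_dens
  have hn : ∀ U V : State, 0 ≤ |dens V - dens U| ∧ 0 ≤ |vel V 0 - vel U 0| ∧
      0 ≤ |vel V 1 - vel U 1| ∧ 0 ≤ |temperature γ V - temperature γ U| := fun U V =>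
    ⟨abs_nonneg _, abs_nonneg _, abs_nonneg _, abs_nonneg _⟩
  have hdens : LipBddOn B d dens := hB.dens.of_dist_le fun U _ V _ => by
    simp only [hd']; linarith [hn U V]
  have hu0 : LipBddOn B d (fun U => vel U 0) := (hB.vel 0).of_dist_le fun U _ V _ => by
    simp only [hd']; linarith [hn U V]
  have hu1 : LipBddOn B d (fun U => vel U 1) := (hB.vel 1).of_dist_le fun U _ V _ => by
    simp only [hd']; linarith [hn U V]
  have hθ : LipBddOn B d (temperature γ) := hθ0.of_dist_le fun U _ V _ => by
    simp only [hd']; linarith [hn U V]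
  have hpos : ∀ U ∈ B, 0 < dens U := fun U hU => hB.pos.trans_le (hB.le_dens U hU)
  have hm : ∀ a, LipBddOn B d (fun U => vel U a) → LipBddOn B d (fun U => mom U a) := fun a ha =>
    (hdens.mul hd ha).congr (fun U _ V hV => mom_eq (hpos V hV).ne' a)
      (fun U hU => mom_eq (hpos U hU).ne' a)
  have hE : LipBddOn B d energy := by
    refine (((hdens.mul hd hθ).const_mul hd (1 / (γ - 1))).add hd
      ((hdens.mul hd ((hu0.sq hd).add hd (hu1.sq hd))).const_mul hd (1 / 2))).congr ?_ ?_
    all_goals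
      have key : ∀ U ∈ B, energy U = 1 / (γ - 1) * (dens U * temperature γ U) +
          1 / 2 * (dens U * (vel U 0 ^ 2 + vel U 1 ^ 2)) := by
        intro U hU
        have h1 := (hpos U hU).ne'
        have h3 : γ - 1 ≠ 0 := by linarith
        rw [energy_eq hγ h1]
        unfold temperature; field_simp
    · intro U hU V hV; exact key V hV
    · intro U hU; exact key U hU
  obtain ⟨C0, p0, h0⟩ := hdens
  obtain ⟨C1, p1, h1⟩ := hm 0 hu0
  obtain ⟨C2, p2, h2⟩ := hm 1 hu1
  obtain ⟨C3, p3, h3⟩ := hE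
  refine ⟨C0 + C1 + C2 + C3, by positivity, fun U hU V hV => ?_⟩
  exact norm_sub_le_of_components p0 p1 p2 p3 (hd U V) (h0 U hU V hV).2.2 (h1 U hU V hV).2.2
    (h2 U hU V hV).2.2 (h3 U hU V hV).2.2

/-- The entropy production of the Lax-Friedrichs flux controls the square of the jump. -/
lemma exists_le_faceProduction_entropy (hγ : 1 < γ) (hρ : 0 < ρmin) (Emax smin : ℝ) :
    ∃ κ, 0 < κ ∧ ∀ U ∈ boundedStates γ ρmin Emax smin, ∀ V ∈ boundedStates γ ρmin Emax smin,
      ∀ lam, lamMax γ U V ≤ lam → ∀ a sgn, (sgn = 1 ∨ sgn = -1) →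
        κ * ‖V - U‖ ^ 2 ≤ faceProduction γ lam (entropyVars γ) entropyPotential a sgn U V := by
  obtain ⟨R, δ, P, hR, hδ, hP, h⟩ := exists_primitive_bounds hγ hρ Emax smin
  obtain ⟨C, hC, hlip⟩ := exists_norm_sub_le_primitive hγ hρ Emax smin
  set Θ := P / ρmin with hΘ
  have hΘ0 : 0 < Θ := by positivity
  have hg : 0 < γ - 1 := by linarith
  -- A uniform lower bound of the speed of sound, since `p ≥ δ` and `ρ ≤ R`.
  set c := Real.sqrt (γ * (δ / R)) with hc
  have hc0 : 0 < c := Real.sqrt_pos.2 (by have : 0 < γ := by linarith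
                                          positivity)
  have hκ := dissRatio_lt_one hγ
  -- The least of the three coefficients in `sq_le_relEntropy_add`.
  set m := min (min (ρmin / Θ) (1 / R)) (ρmin / (γ - 1) / Θ ^ 2) with hm
  have hm0 : 0 < m := by positivity
  -- The factor `4` is from Cauchy-Schwarz for four summands; `C ^ 2 + 1` avoids dividing by zero.
  refine ⟨(1 - dissRatio γ) * c / 2 * m / (4 * (C ^ 2 + 1)), ?_, ?_⟩
  · have : 0 < 1 - dissRatio γ := by linarith
    positivity
  intro U hU V hV lam hlam a sgn hs
  have dU : 0 < dens U := hρ.trans_le hU.1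
  have dV : 0 < dens V := hρ.trans_le hV.1
  have pU : 0 < pressure γ U := hδ.trans_le (h U hU).2.1
  have pV : 0 < pressure γ V := hδ.trans_le (h V hV).2.1
  have tU : 0 < temperature γ U := div_pos pU dU
  have tV : 0 < temperature γ V := div_pos pV dV
  have hT : ∀ W ∈ boundedStates γ ρmin Emax smin, 0 < dens W → 0 < pressure γ W →
      temperature γ W ≤ Θ ∧ c ≤ Real.sqrt (γ * temperature γ W) := by
    intro W hW h1 h2
    constructor
    · exact div_le_div₀ hP.le (h W hW).2.2.1 hρ hW.1
    · apply Real.sqrt_le_sqrt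
      apply mul_le_mul_of_nonneg_left _ (by linarith)
      exact div_le_div₀ h2.le (h W hW).2.1 h1 (h W hW).1
  have hface := le_faceProduction_entropy hγ a hs dU pU dV pV hlam (hT U hU dU pU).2
    (hT V hV dV pV).2
  have hsq := sq_le_relEntropy_add (d := (vel V 0 - vel U 0) ^ 2 + (vel V 1 - vel U 1) ^ 2)
    hγ (by positivity) hρ hV.1 hU.1 (h V hV).1 (h U hU).1 tV tU (hT V hV dV pV).1 (hT U hU dU pU).1
  refine le_trans ?_ hface
  rw [mul_div_assoc, mul_assoc]
  apply mul_le_mul_of_nonneg_left _ (by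
    have : 0 < 1 - dissRatio γ := by linarith
    positivity)
  refine le_trans ?_ hsq
  have hl := hlip U hU V hV
  set x := dens V - dens U
  set y := vel V 0 - vel U 0
  set z := vel V 1 - vel U 1
  set w := temperature γ V - temperature γ U
  have h1 : ‖V - U‖ ^ 2 ≤ C ^ 2 * (4 * (x ^ 2 + y ^ 2 + z ^ 2 + w ^ 2)) := by
    calc ‖V - U‖ ^ 2 ≤ (C * (|x| + |y| + |z| + |w|)) ^ 2 :=
          pow_le_pow_left₀ (norm_nonneg _) hl 2
      _ = C ^ 2 * (|x| + |y| + |z| + |w|) ^ 2 := by ring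
      _ ≤ _ := by
          apply mul_le_mul_of_nonneg_left _ (sq_nonneg C)
          rw [← sq_abs x, ← sq_abs y, ← sq_abs z, ← sq_abs w]
          nlinarith [sq_nonneg (|x| - |y|), sq_nonneg (|x| - |z|), sq_nonneg (|x| - |w|),
            sq_nonneg (|y| - |z|), sq_nonneg (|y| - |w|), sq_nonneg (|z| - |w|)]
  have h2 : m / (4 * (C ^ 2 + 1)) * ‖V - U‖ ^ 2 ≤ m * (x ^ 2 + y ^ 2 + z ^ 2 + w ^ 2) := by
    rw [div_mul_eq_mul_div, div_le_iff₀ (by positivity), mul_assoc]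
    apply mul_le_mul_of_nonneg_left _ hm0.le
    have h3 : 0 ≤ x ^ 2 + y ^ 2 + z ^ 2 + w ^ 2 := by positivity
    have e : (x ^ 2 + y ^ 2 + z ^ 2 + w ^ 2) * (4 * (C ^ 2 + 1)) =
      C ^ 2 * (4 * (x ^ 2 + y ^ 2 + z ^ 2 + w ^ 2)) + 4 * (x ^ 2 + y ^ 2 + z ^ 2 + w ^ 2) := by ring
    rw [e]
    linarith only [h1, h3]
  refine h2.trans ?_
  have m1 : m ≤ ρmin / Θ := (min_le_left _ _).trans (min_le_left _ _)
  have m2 : m ≤ 1 / R := (min_le_left _ _).trans (min_le_right _ _)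
  have m3 : m ≤ ρmin / (γ - 1) / Θ ^ 2 := min_le_right _ _
  have q1 := mul_le_mul_of_nonneg_right m1 (add_nonneg (sq_nonneg y) (sq_nonneg z))
  have q2 := mul_le_mul_of_nonneg_right m2 (sq_nonneg x)
  have q3 := mul_le_mul_of_nonneg_right m3 (sq_nonneg w)
  have e2 : x ^ 2 / R = 1 / R * x ^ 2 := by ring
  have e3 : ρmin / (γ - 1) * (w ^ 2 / Θ ^ 2) = ρmin / (γ - 1) / Θ ^ 2 * w ^ 2 := by ring
  rw [e2, e3]
  calc m * (x ^ 2 + y ^ 2 + z ^ 2 + w ^ 2) = m * (y ^ 2 + z ^ 2) + m * x ^ 2 + m * w ^ 2 := by ring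
    _ ≤ _ := add_le_add (add_le_add q1 q2) q3

end BoundedStates

/-! ### Summation by parts for a balance law on a line of cells. -/

section DiscreteIdentity

/-- A multiplier `g` and a potential `ψ` for which the volume flux is conservative: Tadmor's
shuffle condition. -/
def IsShuffle (γ : ℝ) (g : State → State) (ψ : Fin 2 → State → ℝ) : Prop :=
  ∀ a U V, 0 < dens U → 0 < pressure γ U → 0 < dens V → 0 < pressure γ V →
    dotProduct (g V - g U) (volumeFlux γ a U V) = ψ a V - ψ a U

/-- The symmetric two-point flux of the balance law with multiplier `g` and potential `ψ`. -/
def twoPointFlux (γ : ℝ) (g : State → State) (ψ : Fin 2 → State → ℝ) (a : Fin 2)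
    (U V : State) : ℝ :=
  dotProduct (g U + g V) (volumeFlux γ a U V) / 2 - (ψ a U + ψ a V) / 2

/-- The production on one side of a face. -/
def sidedProduction (γ lam : ℝ) (g : State → State) (ψ : Fin 2 → State → ℝ) (a : Fin 2) (sgn : ℝ)
    (U V : State) : ℝ :=
  dotProduct (g U) (laxFriedrichs γ lam a sgn U V) - sgn * ψ a U

variable {γ : ℝ} {g : State → State} {ψ : Fin 2 → State → ℝ}

lemma twoPointFlux_comm (a : Fin 2) (U V : State) :
    twoPointFlux γ g ψ a U V = twoPointFlux γ g ψ a V U := by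
  unfold twoPointFlux
  rw [volumeFlux_comm, add_comm (g U), add_comm (ψ a U)]

/-- The shuffle condition removes the asymmetry in the multiplier up to a term that depends on `U`
alone, and such a term is annihilated by the differentiation matrix. -/
lemma IsShuffle.dot_volumeFlux (h : IsShuffle γ g ψ) (a : Fin 2) {U V : State} (hU : 0 < dens U)
    (hpU : 0 < pressure γ U) (hV : 0 < dens V) (hpV : 0 < pressure γ V) :
    dotProduct (g U) (volumeFlux γ a U V) = twoPointFlux γ g ψ a U V + ψ a U := by
  have := h a U V hU hpU hV hpV
  rw [sub_dotProduct] at this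
  unfold twoPointFlux
  rw [add_dotProduct]
  linarith

lemma twoPointFlux_self (hγ : 1 < γ) (a : Fin 2) {U : State} (hU : 0 < dens U) :
    twoPointFlux γ g ψ a U U = dotProduct (g U) (eulerFlux γ a U) - ψ a U := by
  unfold twoPointFlux
  rw [volumeFlux_self hγ a hU, add_dotProduct]
  ring

lemma laxFriedrichs_neg (lam : ℝ) (a : Fin 2) (sgn : ℝ) (U V : State) :
    laxFriedrichs γ lam a (-sgn) V U = -laxFriedrichs γ lam a sgn U V := by
  unfold laxFriedrichs
  ext k
  simp
  ring

/-- The Lax-Friedrichs flux changes sign when it is seen from the other side, which is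
conservativity; only the jumps of multiplier and potential survive. -/
lemma sidedProduction_add (lam : ℝ) (a : Fin 2) (sgn : ℝ) (U V : State) :
    sidedProduction γ lam g ψ a sgn U V + sidedProduction γ lam g ψ a (-sgn) V U =
      faceProduction γ lam g ψ a sgn U V := by
  unfold sidedProduction faceProduction
  rw [laxFriedrichs_neg, dotProduct_neg, sub_dotProduct]
  ring

lemma faceProduction_neg (lam : ℝ) (a : Fin 2) (sgn : ℝ) (U V : State) :
    faceProduction γ lam g ψ a (-sgn) V U = faceProduction γ lam g ψ a sgn U V := by
  unfold faceProduction
  rw [laxFriedrichs_neg, dotProduct_neg, sub_dotProduct, sub_dotProduct]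
  ring

variable {p : ℕ} {ξ ω : Fin (p + 1) → ℝ}

/-- The one-dimensional scheme on one cell, tested with a nodal function. -/
lemma cell_identity (hγ : 1 < γ) (hp : 1 ≤ p) (hGL : IsGaussLobatto p ξ ω)
    (hg : IsShuffle γ g ψ) (d : Fin 2) (lam : State → State → ℝ) (W : Fin (p + 1) → State)
    (hW : ∀ a, 0 < dens (W a) ∧ 0 < pressure γ (W a)) (x : Fin (p + 1) → ℝ) (VR VL : State) :
    ∑ a, ω a * (x a * dotProduct (g (W a))
      (-((2 : ℝ) • ∑ l, diffMatrix ξ a l • volumeFlux γ d (W a) (W l))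
        + (if a = Fin.last p then (1 / ω a) • facePenalty γ lam d 1 (W a) VR else 0)
        + (if a = 0 then (1 / ω a) • facePenalty γ lam d (-1) (W a) VL else 0)))
    = ∑ a, ∑ l, ω a * diffMatrix ξ a l * ((x l - x a) * twoPointFlux γ g ψ d (W a) (W l))
      - (x (Fin.last p) * sidedProduction γ (lam (W (Fin.last p)) VR) g ψ d 1 (W (Fin.last p)) VR
        + x 0 * sidedProduction γ (lam (W 0) VL) g ψ d (-1) (W 0) VL) := by
  have hvol : ∀ a, dotProduct (g (W a)) ((2 : ℝ) • ∑ l, diffMatrix ξ a l •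
      volumeFlux γ d (W a) (W l)) =
      2 * ∑ l, diffMatrix ξ a l * twoPointFlux γ g ψ d (W a) (W l) := by
    intro a
    rw [dotProduct_smul, dotProduct_sum, smul_eq_mul]
    congr 1
    have : ∀ l, dotProduct (g (W a)) (diffMatrix ξ a l • volumeFlux γ d (W a) (W l)) =
        diffMatrix ξ a l * twoPointFlux γ g ψ d (W a) (W l) + diffMatrix ξ a l * ψ d (W a) := by
      intro l
      rw [dotProduct_smul, smul_eq_mul,
        hg.dot_volumeFlux d (hW a).1 (hW a).2 (hW l).1 (hW l).2, mul_add]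
    simp only [this, Finset.sum_add_distrib, ← Finset.sum_mul, sum_diffMatrix hGL.strictMono,
      zero_mul, add_zero]
  have hq := (hGL.weight_pos hp (Fin.last p)).ne'
  have h0 := (hGL.weight_pos hp 0).ne'
  have e1 : ∀ a, ω a * (x a * dotProduct (g (W a))
      (-((2 : ℝ) • ∑ l, diffMatrix ξ a l • volumeFlux γ d (W a) (W l))
        + (if a = Fin.last p then (1 / ω a) • facePenalty γ lam d 1 (W a) VR else 0)
        + (if a = 0 then (1 / ω a) • facePenalty γ lam d (-1) (W a) VL else 0)))
      = -(ω a * (x a * (2 * ∑ l, diffMatrix ξ a l * twoPointFlux γ g ψ d (W a) (W l))))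
        + (if a = Fin.last p then x a * dotProduct (g (W a)) (facePenalty γ lam d 1 (W a) VR) else 0)
        + (if a = 0 then x a * dotProduct (g (W a)) (facePenalty γ lam d (-1) (W a) VL) else 0) := by
    intro a
    have hωa := (hGL.weight_pos hp a).ne'
    rw [dotProduct_add, dotProduct_add, dotProduct_neg, hvol]
    have aux : ∀ (P : Prop) [Decidable P] (F : State), dotProduct (g (W a))
        (if P then (1 / ω a) • F else 0) = if P then (1 / ω a) * dotProduct (g (W a)) F else 0 := by
      intro P _ F
      split_ifs
      · rw [dotProduct_smul, smul_eq_mul]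
      · rw [dotProduct_zero]
    rw [aux, aux]
    split_ifs <;> field_simp <;> ring
  simp only [e1, Finset.sum_add_distrib, Finset.sum_neg_distrib]
  rw [hGL.sum_flux_differencing x (fun a l => twoPointFlux γ g ψ d (W a) (W l))
    (fun a l => twoPointFlux_comm d _ _)]
  simp only [Finset.sum_ite_eq', Finset.mem_univ, if_true]
  -- The boundary terms of summation by parts contain `g · f - ψ` at the end nodes. Their part `g ·
  -- f` cancels the physical flux in the penalty, and minus the one-sided production is left.
  rw [twoPointFlux_self hγ d (hW _).1, twoPointFlux_self hγ d (hW _).1]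
  unfold sidedProduction facePenalty
  simp only [dotProduct_sub, dotProduct_smul, smul_eq_mul]
  ring

/-- Exterior trace at the right end of the cell `i` in a line of `N` cells. -/
def lineExtRight (bc : BoundaryCondition) (d : Fin 2) (N : ℕ) (W : ℕ → Fin (p + 1) → State)
    (i : ℕ) : State :=
  match bc with
  | .periodic => W ((i + 1) % N) 0
  | .noFlux => if i + 1 < N then W (i + 1) 0 else mirror d (W i (Fin.last p))

/-- Exterior trace at the left end of the cell `i` in a line of `N` cells. -/
def lineExtLeft (bc : BoundaryCondition) (d : Fin 2) (N : ℕ) (W : ℕ → Fin (p + 1) → State)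
    (i : ℕ) : State :=
  match bc with
  | .periodic => W ((i + N - 1) % N) (Fin.last p)
  | .noFlux => if 0 < i then W (i - 1) (Fin.last p) else mirror d (W i 0)

/-- The nodal values of a test function on a line of cells fit the boundary conditions. -/
structure LineCompatible (bc : BoundaryCondition) (γ : ℝ) (lam : State → State → ℝ)
    (g : State → State) (ψ : Fin 2 → State → ℝ) (d : Fin 2) (N : ℕ) (x : ℕ → Fin (p + 1) → ℝ) :
    Prop where
  interior : ∀ i, i + 1 < N → x i (Fin.last p) = x (i + 1) 0
  periodic : bc = .periodic → x (N - 1) (Fin.last p) = x 0 0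
  right : bc = .noFlux → ∀ U, x (N - 1) (Fin.last p) *
    (2 * sidedProduction γ (lam U (mirror d U)) g ψ d 1 U (mirror d U)
      - faceProduction γ (lam U (mirror d U)) g ψ d 1 U (mirror d U)) = 0
  left : bc = .noFlux → ∀ U, x 0 0 *
    (2 * sidedProduction γ (lam U (mirror d U)) g ψ d (-1) U (mirror d U)
      - faceProduction γ (lam U (mirror d U)) g ψ d (-1) U (mirror d U)) = 0

/-- It lets the left trace of a cell be counted with its left neighbour, so that both sides of a
face carry the same summation index. -/
lemma sum_range_cyclic {N : ℕ} (f : ℕ → ℝ) :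
    ∑ i ∈ Finset.range N, f ((i + 1) % N) = ∑ i ∈ Finset.range N, f i := by
  rcases N with _ | m
  · simp
  rw [Finset.sum_range_succ, Finset.sum_range_succ', Nat.mod_self]
  congr 1
  refine Finset.sum_congr rfl fun i hi => ?_
  rw [Nat.mod_eq_of_lt (by have := Finset.mem_range.1 hi; omega)]

/-- Summing the one-sided productions over a line of cells. -/
lemma line_faces {bc : BoundaryCondition} {lam : State → State → ℝ}
    (hlam : ∀ U V, lam U V = lam V U) {d : Fin 2} {N : ℕ} {x : ℕ → Fin (p + 1) → ℝ}
    (hx : LineCompatible bc γ lam g ψ d N x) (W : ℕ → Fin (p + 1) → State) :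
    ∑ i ∈ Finset.range N,
      (x i (Fin.last p) * sidedProduction γ (lam (W i (Fin.last p)) (lineExtRight bc d N W i)) g ψ d 1
          (W i (Fin.last p)) (lineExtRight bc d N W i)
        + x i 0 * sidedProduction γ (lam (W i 0) (lineExtLeft bc d N W i)) g ψ d (-1)
          (W i 0) (lineExtLeft bc d N W i))
    = (∑ i ∈ Finset.range N,
      (x i (Fin.last p) * faceProduction γ (lam (W i (Fin.last p)) (lineExtRight bc d N W i)) g ψ d 1
          (W i (Fin.last p)) (lineExtRight bc d N W i)
        + x i 0 * faceProduction γ (lam (W i 0) (lineExtLeft bc d N W i)) g ψ d (-1)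
          (W i 0) (lineExtLeft bc d N W i))) / 2 := by
  have hpair : ∀ U V, sidedProduction γ (lam U V) g ψ d 1 U V
      + sidedProduction γ (lam V U) g ψ d (-1) V U = faceProduction γ (lam U V) g ψ d 1 U V := by
    intro U V; rw [hlam V U, sidedProduction_add]
  have hneg : ∀ U V, faceProduction γ (lam V U) g ψ d (-1) V U =
      faceProduction γ (lam U V) g ψ d 1 U V := by
    intro U V; rw [hlam V U, faceProduction_neg]
  rcases N with _ | m
  · simp
  simp only [Finset.sum_add_distrib]
  cases bc with
  | periodic =>
    simp only [lineExtRight, lineExtLeft]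
    set L : ℕ → ℝ := fun i => x i 0 * sidedProduction γ
      (lam (W i 0) (W ((i + (m + 1) - 1) % (m + 1)) (Fin.last p))) g ψ d (-1) (W i 0)
      (W ((i + (m + 1) - 1) % (m + 1)) (Fin.last p)) with hL
    set PL : ℕ → ℝ := fun i => x i 0 * faceProduction γ
      (lam (W i 0) (W ((i + (m + 1) - 1) % (m + 1)) (Fin.last p))) g ψ d (-1) (W i 0)
      (W ((i + (m + 1) - 1) % (m + 1)) (Fin.last p)) with hPL
    rw [← sum_range_cyclic L, ← sum_range_cyclic PL, ← Finset.sum_add_distrib,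
      ← Finset.sum_add_distrib, Finset.sum_div]
    refine Finset.sum_congr rfl fun i hi => ?_
    have hi' := Finset.mem_range.1 hi
    have hx' : x i (Fin.last p) = x ((i + 1) % (m + 1)) 0 := by
      rcases (Nat.lt_succ_iff.1 hi').lt_or_eq with h | h
      · rw [Nat.mod_eq_of_lt (by omega)]; exact hx.interior i (by omega)
      · subst h; rw [Nat.mod_self]; exact hx.periodic rfl
    have hback : ((i + 1) % (m + 1) + (m + 1) - 1) % (m + 1) = i := by
      rcases (Nat.lt_succ_iff.1 hi').lt_or_eq with h | h
      · rw [Nat.mod_eq_of_lt (show i + 1 < m + 1 by omega)]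
        rw [show i + 1 + (m + 1) - 1 = i + (m + 1) by omega, Nat.add_mod_right,
          Nat.mod_eq_of_lt (by omega)]
      · subst h; simp
    simp only [hL, hPL]
    rw [hback, ← hx', ← mul_add, hpair, hneg]
    ring
  | noFlux =>
    -- The last right trace and the first left trace are the walls, where `LineCompatible` replaces
    -- the pairing; all other traces pair up as in the periodic case.
    rw [Finset.sum_range_succ, Finset.sum_range_succ', Finset.sum_range_succ,
      Finset.sum_range_succ' (fun i => x i 0 * faceProduction γ _ g ψ d (-1) (W i 0) _)]
    have hR := hx.right rfl (W m (Fin.last p))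
    have hL := hx.left rfl (W 0 0)
    simp only [lineExtRight, lineExtLeft, lt_self_iff_false, if_false, Nat.add_sub_cancel]
      at hR hL ⊢
    have hsum : ∑ i ∈ Finset.range m, x i (Fin.last p) * sidedProduction γ
        (lam (W i (Fin.last p)) (if i + 1 < m + 1 then W (i + 1) 0 else mirror d (W i (Fin.last p))))
          g ψ d 1 (W i (Fin.last p))
          (if i + 1 < m + 1 then W (i + 1) 0 else mirror d (W i (Fin.last p)))
        + ∑ i ∈ Finset.range m, x (i + 1) 0 * sidedProduction γ
          (lam (W (i + 1) 0) (if 0 < i + 1 then W i (Fin.last p) else mirror d (W (i + 1) 0)))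
          g ψ d (-1) (W (i + 1) 0)
          (if 0 < i + 1 then W i (Fin.last p) else mirror d (W (i + 1) 0))
        = (∑ i ∈ Finset.range m, x i (Fin.last p) * faceProduction γ
        (lam (W i (Fin.last p)) (if i + 1 < m + 1 then W (i + 1) 0 else mirror d (W i (Fin.last p))))
          g ψ d 1 (W i (Fin.last p))
          (if i + 1 < m + 1 then W (i + 1) 0 else mirror d (W i (Fin.last p)))
        + ∑ i ∈ Finset.range m, x (i + 1) 0 * faceProduction γ
          (lam (W (i + 1) 0) (if 0 < i + 1 then W i (Fin.last p) else mirror d (W (i + 1) 0)))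
          g ψ d (-1) (W (i + 1) 0)
          (if 0 < i + 1 then W i (Fin.last p) else mirror d (W (i + 1) 0))) / 2 := by
      rw [← Finset.sum_add_distrib, ← Finset.sum_add_distrib, Finset.sum_div]
      refine Finset.sum_congr rfl fun i hi => ?_
      have hi' := Finset.mem_range.1 hi
      rw [if_pos (by omega), if_pos (by omega), ← hx.interior i (by omega), ← mul_add, hpair, hneg]
      ring
    linarith

end DiscreteIdentity

/-! ### The discrete balance on the two-dimensional mesh. -/

section GridIdentity

variable {γ : ℝ} {g : State → State} {ψ : Fin 2 → State → ℝ}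
variable {p : ℕ} {ξ ω : Fin (p + 1) → ℝ} {L₁ L₂ : ℝ}

/-- The volume part of the scheme on the cell `(i, j)`, tested with nodal values `x`. -/
def cellVolume (γ : ℝ) (g : State → State) (ψ : Fin 2 → State → ℝ) (ξ ω : Fin (p + 1) → ℝ)
    (W : Fin (p + 1) → Fin (p + 1) → State) (x : Fin (p + 1) → Fin (p + 1) → ℝ) : ℝ :=
  ∑ b, ω b * (∑ a, ∑ l, ω a * diffMatrix ξ a l *
      ((x l b - x a b) * twoPointFlux γ g ψ 0 (W a b) (W l b)))
    + ∑ a, ω a * (∑ b, ∑ l, ω b * diffMatrix ξ b l *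
      ((x a l - x a b) * twoPointFlux γ g ψ 1 (W a b) (W a l)))

/-- The sum of a function of the interior and exterior traces over the sides of the cell
`(i, j)`, weighted with the Gauss-Lobatto weights and with nodal values `x`. -/
def cellFaces (bc : BoundaryCondition) (M : Mesh L₁ L₂) (ω : Fin (p + 1) → ℝ) (c : Coeffs p)
    (P : Fin 2 → ℝ → State → State → ℝ) (x : Fin (p + 1) → Fin (p + 1) → ℝ) (i j : ℕ) : ℝ :=
  ∑ b, ω b * (x (Fin.last p) b * P 0 1 (c i j (Fin.last p) b) (extRight bc M c i j b)
      + x 0 b * P 0 (-1) (c i j 0 b) (extLeft bc M c i j b))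
    + ∑ a, ω a * (x a (Fin.last p) * P 1 1 (c i j a (Fin.last p)) (extTop bc M c i j a)
      + x a 0 * P 1 (-1) (c i j a 0) (extBottom bc M c i j a))

/-- Face production with state dependent viscosity. -/
def viscousProduction (γ : ℝ) (lam : State → State → ℝ) (g : State → State) (ψ : Fin 2 → State → ℝ)
    (a : Fin 2) (sgn : ℝ) (U V : State) : ℝ := faceProduction γ (lam U V) g ψ a sgn U V

lemma extRight_eq (bc : BoundaryCondition) (M : Mesh L₁ L₂) (c : Coeffs p) (i j : ℕ)
    (b : Fin (p + 1)) :
    extRight bc M c i j b = lineExtRight bc 0 M.N₁ (fun i a => c i j a b) i := by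
  cases bc <;> rfl

lemma extLeft_eq (bc : BoundaryCondition) (M : Mesh L₁ L₂) (c : Coeffs p) (i j : ℕ)
    (b : Fin (p + 1)) :
    extLeft bc M c i j b = lineExtLeft bc 0 M.N₁ (fun i a => c i j a b) i := by
  cases bc <;> rfl

lemma extTop_eq (bc : BoundaryCondition) (M : Mesh L₁ L₂) (c : Coeffs p) (i j : ℕ)
    (a : Fin (p + 1)) :
    extTop bc M c i j a = lineExtRight bc 1 M.N₂ (fun j b => c i j a b) j := by
  cases bc <;> rfl

lemma extBottom_eq (bc : BoundaryCondition) (M : Mesh L₁ L₂) (c : Coeffs p) (i j : ℕ)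
    (a : Fin (p + 1)) :
    extBottom bc M c i j a = lineExtLeft bc 1 M.N₂ (fun j b => c i j a b) j := by
  cases bc <;> rfl

/-- The one-dimensional scheme on a line of cells. -/
lemma line_identity (hγ : 1 < γ) (hp : 1 ≤ p) (hGL : IsGaussLobatto p ξ ω)
    (hg : IsShuffle γ g ψ) {bc : BoundaryCondition} {d : Fin 2} {lam : State → State → ℝ}
    (hlam : ∀ U V, lam U V = lam V U) {N : ℕ} {W : ℕ → Fin (p + 1) → State}
    (hW : ∀ i < N, ∀ a, 0 < dens (W i a) ∧ 0 < pressure γ (W i a)) {x : ℕ → Fin (p + 1) → ℝ}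
    (hx : LineCompatible bc γ lam g ψ d N x) :
    ∑ i ∈ Finset.range N, ∑ a, ω a * (x i a * dotProduct (g (W i a))
      (-((2 : ℝ) • ∑ l, diffMatrix ξ a l • volumeFlux γ d (W i a) (W i l))
        + (if a = Fin.last p then
            (1 / ω a) • facePenalty γ lam d 1 (W i a) (lineExtRight bc d N W i) else 0)
        + (if a = 0 then
            (1 / ω a) • facePenalty γ lam d (-1) (W i a) (lineExtLeft bc d N W i) else 0)))
    = ∑ i ∈ Finset.range N, (∑ a, ∑ l, ω a * diffMatrix ξ a l *
        ((x i l - x i a) * twoPointFlux γ g ψ d (W i a) (W i l))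
      - (x i (Fin.last p) * viscousProduction γ lam g ψ d 1 (W i (Fin.last p)) (lineExtRight bc d N W i)
        + x i 0 * viscousProduction γ lam g ψ d (-1) (W i 0) (lineExtLeft bc d N W i)) / 2) := by
  have h1 : ∀ i ∈ Finset.range N, _ := fun i hi =>
    cell_identity hγ hp hGL hg d lam (W i) (hW i (Finset.mem_range.1 hi)) (x i)
      (lineExtRight bc d N W i) (lineExtLeft bc d N W i)
  rw [Finset.sum_congr rfl h1, Finset.sum_sub_distrib, Finset.sum_sub_distrib, line_faces hlam hx W,
    Finset.sum_div]
  rfl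

/-- The scheme, multiplied by `g` and tested with the nodal values `x`, summed over all cells. -/
lemma grid_identity (hγ : 1 < γ) (hp : 1 ≤ p) (hGL : IsGaussLobatto p ξ ω)
    (hg : IsShuffle γ g ψ) {bc : BoundaryCondition} {lam : State → State → ℝ}
    (hlam : ∀ U V, lam U V = lam V U) (M : Mesh L₁ L₂) {c : Coeffs p}
    (hc : ∀ i < M.N₁, ∀ j < M.N₂, ∀ a b, 0 < dens (c i j a b) ∧ 0 < pressure γ (c i j a b))
    {x : ℕ → ℕ → Fin (p + 1) → Fin (p + 1) → ℝ}
    (hx₁ : ∀ j < M.N₂, ∀ b, LineCompatible bc γ lam g ψ 0 M.N₁ (fun i a => x i j a b))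
    (hx₂ : ∀ i < M.N₁, ∀ a, LineCompatible bc γ lam g ψ 1 M.N₂ (fun j b => x i j a b)) :
    ∑ i ∈ Finset.range M.N₁, ∑ j ∈ Finset.range M.N₂, ∑ a, ∑ b,
      ω a * ω b * (x i j a b * dotProduct (g (c i j a b)) (dgRHS γ bc M ξ ω lam c i j a b))
    = 2 / M.h * ∑ i ∈ Finset.range M.N₁, ∑ j ∈ Finset.range M.N₂,
        (cellVolume γ g ψ ξ ω (c i j) (x i j)
          - cellFaces bc M ω c (viscousProduction γ lam g ψ) (x i j) i j / 2) := by
  -- `A` and `B` are the parts of the scheme in the two directions. Each is handled by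
  -- `line_identity` along lines of nodes, weighted with the weight of the transversal index.
  set A : ℕ → ℕ → Fin (p + 1) → Fin (p + 1) → ℝ := fun i j a b => dotProduct (g (c i j a b))
      (-((2 : ℝ) • ∑ l, diffMatrix ξ a l • volumeFlux γ 0 (c i j a b) (c i j l b))
        + (if a = Fin.last p then
            (1 / ω a) • facePenalty γ lam 0 1 (c i j a b) (extRight bc M c i j b) else 0)
        + (if a = 0 then
            (1 / ω a) • facePenalty γ lam 0 (-1) (c i j a b) (extLeft bc M c i j b) else 0)) with hA
  set B : ℕ → ℕ → Fin (p + 1) → Fin (p + 1) → ℝ := fun i j a b => dotProduct (g (c i j a b))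
      (-((2 : ℝ) • ∑ l, diffMatrix ξ b l • volumeFlux γ 1 (c i j a b) (c i j a l))
        + (if b = Fin.last p then
            (1 / ω b) • facePenalty γ lam 1 1 (c i j a b) (extTop bc M c i j a) else 0)
        + (if b = 0 then
            (1 / ω b) • facePenalty γ lam 1 (-1) (c i j a b) (extBottom bc M c i j a) else 0))
    with hB
  have hsplit : ∀ i j a b, ω a * ω b * (x i j a b * dotProduct (g (c i j a b))
      (dgRHS γ bc M ξ ω lam c i j a b)) =
      2 / M.h * (ω b * (ω a * (x i j a b * A i j a b)) + ω a * (ω b * (x i j a b * B i j a b))) := by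
    intro i j a b
    have : dotProduct (g (c i j a b)) (dgRHS γ bc M ξ ω lam c i j a b) =
        2 / M.h * (A i j a b + B i j a b) := by
      simp only [hA, hB, dgRHS]
      rw [dotProduct_smul, smul_eq_mul, ← dotProduct_add]
      congr 2
      rw [Finset.sum_add_distrib, smul_add]
      abel
    rw [this]; ring
  have e0 : ∑ i ∈ Finset.range M.N₁, ∑ j ∈ Finset.range M.N₂, ∑ a, ∑ b,
      ω a * ω b * (x i j a b * dotProduct (g (c i j a b)) (dgRHS γ bc M ξ ω lam c i j a b)) =
      2 / M.h * (∑ i ∈ Finset.range M.N₁, ∑ j ∈ Finset.range M.N₂, ∑ a, ∑ b,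
        ω b * (ω a * (x i j a b * A i j a b))
        + ∑ i ∈ Finset.range M.N₁, ∑ j ∈ Finset.range M.N₂, ∑ a, ∑ b,
        ω a * (ω b * (x i j a b * B i j a b))) := by
    simp only [hsplit, mul_add, Finset.sum_add_distrib, Finset.mul_sum]
  have e1 : ∑ i ∈ Finset.range M.N₁, ∑ j ∈ Finset.range M.N₂, ∑ a, ∑ b,
      ω b * (ω a * (x i j a b * A i j a b)) =
      ∑ i ∈ Finset.range M.N₁, ∑ j ∈ Finset.range M.N₂, ∑ b, ω b * (∑ a, ∑ l, ω a * diffMatrix ξ a l *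
        ((x i j l b - x i j a b) * twoPointFlux γ g ψ 0 (c i j a b) (c i j l b))
        - (x i j (Fin.last p) b * viscousProduction γ lam g ψ 0 1 (c i j (Fin.last p) b) (extRight bc M c i j b)
        + x i j 0 b * viscousProduction γ lam g ψ 0 (-1) (c i j 0 b) (extLeft bc M c i j b)) / 2) := by
    rw [Finset.sum_comm]
    nth_rewrite 2 [Finset.sum_comm]
    refine Finset.sum_congr rfl fun j hj => ?_
    have hj' := Finset.mem_range.1 hj
    have s1 : ∀ i, ∑ a, ∑ b, ω b * (ω a * (x i j a b * A i j a b)) =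
        ∑ b, ω b * ∑ a, ω a * (x i j a b * A i j a b) := by
      intro i; rw [Finset.sum_comm]; simp only [Finset.mul_sum]
    simp only [s1]
    rw [Finset.sum_comm]
    nth_rewrite 2 [Finset.sum_comm]
    refine Finset.sum_congr rfl fun b _ => ?_
    rw [← Finset.mul_sum, ← Finset.mul_sum]
    congr 1
    simp only [hA, extRight_eq, extLeft_eq]
    exact line_identity hγ hp hGL hg hlam (W := fun i a => c i j a b)
      (fun i hi a => hc i hi j hj' a b) (hx₁ j hj' b)
  have e2 : ∑ i ∈ Finset.range M.N₁, ∑ j ∈ Finset.range M.N₂, ∑ a, ∑ b,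
      ω a * (ω b * (x i j a b * B i j a b)) =
      ∑ i ∈ Finset.range M.N₁, ∑ j ∈ Finset.range M.N₂, ∑ a, ω a * (∑ b, ∑ l, ω b * diffMatrix ξ b l *
        ((x i j a l - x i j a b) * twoPointFlux γ g ψ 1 (c i j a b) (c i j a l))
        - (x i j a (Fin.last p) * viscousProduction γ lam g ψ 1 1 (c i j a (Fin.last p)) (extTop bc M c i j a)
        + x i j a 0 * viscousProduction γ lam g ψ 1 (-1) (c i j a 0) (extBottom bc M c i j a)) / 2) := by
    refine Finset.sum_congr rfl fun i hi => ?_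
    have hi' := Finset.mem_range.1 hi
    simp only [← Finset.mul_sum]
    rw [Finset.sum_comm]
    nth_rewrite 2 [Finset.sum_comm]
    refine Finset.sum_congr rfl fun a _ => ?_
    rw [← Finset.mul_sum, ← Finset.mul_sum]
    congr 1
    simp only [hB, extTop_eq, extBottom_eq]
    exact line_identity hγ hp hGL hg hlam (W := fun j b => c i j a b)
      (fun j hj b => hc i hi' j hj a b) (hx₂ i hi' a)
  rw [e0, e1, e2]
  congr 1
  simp only [cellVolume, cellFaces]
  simp only [mul_sub, Finset.sum_sub_distrib, Finset.sum_add_distrib, add_div, Finset.sum_div,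
    mul_div_assoc]
  ring

end GridIdentity

/-! ### Cells, nodes, and integrals of piecewise polynomials. -/

section Geometry

variable {p : ℕ} {ξ ω : Fin (p + 1) → ℝ} {L₁ L₂ : ℝ}

/-- The open cell `(i, j)`. -/
def cellSet (h : ℝ) (i j : ℕ) : Set (ℝ × ℝ) :=
  Ioo (i * h) ((i + 1) * h) ×ˢ Ioo (j * h) ((j + 1) * h)

/-- The coordinate of the node `a` in the one-dimensional cell `i`. -/
def nodeCoord (h : ℝ) (ξ : Fin (p + 1) → ℝ) (i : ℕ) (a : Fin (p + 1)) : ℝ :=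
  (i + (ξ a + 1) / 2) * h

/-- The polynomial with nodal values `w` on the cell `(i, j)`. -/
def cellPoly (h : ℝ) (ξ : Fin (p + 1) → ℝ) (i j : ℕ) (w : Fin (p + 1) → Fin (p + 1) → ℝ)
    (x : ℝ × ℝ) : ℝ :=
  ∑ a, ∑ b, ((lagrange ξ a).eval (2 * (x.1 - i * h) / h - 1)
    * (lagrange ξ b).eval (2 * (x.2 - j * h) / h - 1)) * w a b

lemma floor_div_eq {h x : ℝ} (hh : 0 < h) {i : ℕ} (hx : x ∈ Ico (i * h) ((i + 1) * h)) :
    ⌊x / h⌋₊ = i := by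
  rw [Nat.floor_eq_iff (div_nonneg (le_trans (by positivity) hx.1) hh.le)]
  exact ⟨(le_div_iff₀ hh).2 hx.1, (div_lt_iff₀ hh).2 hx.2⟩

lemma evalDG_eq_of_mem_Ico (M : Mesh L₁ L₂) (c : Coeffs p) {i j : ℕ} {x : ℝ × ℝ}
    (hx₁ : x.1 ∈ Ico (i * M.h) ((i + 1) * M.h)) (hx₂ : x.2 ∈ Ico (j * M.h) ((j + 1) * M.h)) :
    evalDG M ξ c x = ∑ a, ∑ b, ((lagrange ξ a).eval (2 * (x.1 - i * M.h) / M.h - 1)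
      * (lagrange ξ b).eval (2 * (x.2 - j * M.h) / M.h - 1)) • c i j a b := by
  simp only [evalDG, floor_div_eq M.h_pos hx₁, floor_div_eq M.h_pos hx₂]

lemma evalDG_apply (M : Mesh L₁ L₂) (c : Coeffs p) {i j : ℕ} {x : ℝ × ℝ}
    (hx : x ∈ cellSet M.h i j) (k : Fin 4) :
    evalDG M ξ c x k = cellPoly M.h ξ i j (fun a b => c i j a b k) x := by
  rw [evalDG_eq_of_mem_Ico M c (Ioo_subset_Ico_self hx.1) (Ioo_subset_Ico_self hx.2)]
  simp [cellPoly, Finset.sum_apply]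

lemma refCoord_mem {h x : ℝ} (hh : 0 < h) {i : ℕ} (hx : x ∈ Icc (i * h) ((i + 1) * h)) :
    2 * (x - i * h) / h - 1 ∈ Icc (-1 : ℝ) 1 := by
  constructor
  · have : 0 ≤ 2 * (x - i * h) / h := div_nonneg (by linarith [hx.1]) hh.le
    linarith
  · have : 2 * (x - i * h) / h ≤ 2 := by rw [div_le_iff₀ hh]; linarith [hx.2]
    linarith

lemma mesh_N_pos (M : Mesh L₁ L₂) (h₁ : 0 < L₁) (h₂ : 0 < L₂) : 0 < M.N₁ ∧ 0 < M.N₂ := by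
  constructor
  · rcases Nat.eq_zero_or_pos M.N₁ with h | h
    · have := M.length₁; rw [h] at this; simp at this; linarith
    · exact h
  · rcases Nat.eq_zero_or_pos M.N₂ with h | h
    · have := M.length₂; rw [h] at this; simp at this; linarith
    · exact h

lemma mul_le_length {N i : ℕ} {h L : ℝ} (hh : 0 < h) (hL : N * h = L) (hi : i < N) :
    ((i : ℝ) + 1) * h ≤ L := by
  rw [← hL]
  have : (i : ℝ) + 1 ≤ N := by exact_mod_cast hi
  gcongr

lemma sum_lagrange_mul (hξ : StrictMono ξ) (r s : ℝ) :
    ∑ a, ∑ b, (lagrange ξ a).eval r * (lagrange ξ b).eval s = 1 := by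
  simp only [← Finset.mul_sum, sum_eval_lagrange hξ, mul_one]

/-- Bound of the Lebesgue constant type for the tensor product Lagrange basis. -/
lemma exists_lebesgue_bound (ξ : Fin (p + 1) → ℝ) : ∃ C : ℝ, 1 ≤ C ∧
    ∀ r ∈ Icc (-1 : ℝ) 1, ∀ s ∈ Icc (-1 : ℝ) 1,
      ∀ (E : Type) [NormedAddCommGroup E] [NormedSpace ℝ E] (w : Fin (p + 1) → Fin (p + 1) → E) (m : ℝ),
        (∀ a b, ‖w a b‖ ≤ m) →
        ‖∑ a, ∑ b, ((lagrange ξ a).eval r * (lagrange ξ b).eval s) • w a b‖ ≤ C * m := by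
  obtain ⟨D, hD, h⟩ := exists_lagrange_bound ξ
  refine ⟨(p + 1) * ((p + 1) * (D * D)) + 1, by
    have : 0 ≤ ((p : ℝ) + 1) * ((p + 1) * (D * D)) := by positivity
    linarith, ?_⟩
  intro r hr s hs E _ _ w m hw
  have hm : 0 ≤ m := (norm_nonneg _).trans (hw 0 0)
  have h1 : ∀ a b, ‖((lagrange ξ a).eval r * (lagrange ξ b).eval s) • w a b‖ ≤ D * D * m := by
    intro a b
    rw [norm_smul, norm_mul]
    exact mul_le_mul (mul_le_mul (h a r hr) (h b s hs) (norm_nonneg _) hD) (hw a b)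
      (norm_nonneg _) (by positivity)
  calc _ ≤ ∑ a : Fin (p + 1), ∑ b : Fin (p + 1), D * D * m := by
        refine (norm_sum_le _ _).trans (Finset.sum_le_sum fun a _ => ?_)
        exact (norm_sum_le _ _).trans (Finset.sum_le_sum fun b _ => h1 a b)
    _ = (p + 1) * ((p + 1) * (D * D)) * m := by simp; ring
    _ ≤ _ := by rw [add_mul]; linarith

lemma cellSet_subset (M : Mesh L₁ L₂) {i j : ℕ} (hi : i < M.N₁) (hj : j < M.N₂) :
    cellSet M.h i j ⊆ Ioo 0 L₁ ×ˢ Ioo 0 L₂ := by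
  have hh := M.h_pos
  have h1 := mul_le_length hh M.length₁ hi
  have h2 := mul_le_length hh M.length₂ hj
  have h3 : 0 ≤ (i : ℝ) * M.h := by positivity
  have h4 : 0 ≤ (j : ℝ) * M.h := by positivity
  intro x hx
  exact ⟨⟨by linarith [hx.1.1], by linarith [hx.1.2]⟩, ⟨by linarith [hx.2.1], by linarith [hx.2.2]⟩⟩

lemma nodeCoord_mem (hGL : IsGaussLobatto p ξ ω) {h : ℝ} (hh : 0 < h) (i : ℕ) (a : Fin (p + 1)) :
    nodeCoord h ξ i a ∈ Icc (i * h) ((i + 1) * h) := by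
  have := hGL.mem_Icc a
  unfold nodeCoord
  constructor
  · gcongr; linarith [this.1]
  · gcongr; linarith [this.2]

lemma nodeCoord_mem_Icc (hGL : IsGaussLobatto p ξ ω) {h L : ℝ} (hh : 0 < h) {N i : ℕ}
    (hL : N * h = L) (hi : i < N) (a : Fin (p + 1)) : nodeCoord h ξ i a ∈ Icc 0 L := by
  have h1 := nodeCoord_mem hGL hh i a
  have h2 := mul_le_length hh hL hi
  exact ⟨le_trans (by positivity) h1.1, h1.2.trans h2⟩

lemma nodeCoord_last (hGL : IsGaussLobatto p ξ ω) (h : ℝ) (i : ℕ) :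
    nodeCoord h ξ i (Fin.last p) = (i + 1) * h := by
  unfold nodeCoord; rw [hGL.last]; ring

lemma nodeCoord_zero (hGL : IsGaussLobatto p ξ ω) (h : ℝ) (i : ℕ) :
    nodeCoord h ξ i 0 = i * h := by
  unfold nodeCoord; rw [hGL.first]; ring

/-- The nodal values satisfy the uniform bounds if the piecewise polynomial does. -/
lemma nodal_mem_boundedStates {γ ρmin Emax smin : ℝ} (hρ : 0 < ρmin)
    (hGL : IsGaussLobatto p ξ ω) (M : Mesh L₁ L₂) {c : Coeffs p}
    (h : ∀ x ∈ Ico 0 L₁ ×ˢ Ico 0 L₂, IsBoundedState γ ρmin Emax smin (evalDG M ξ c x))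
    {i j : ℕ} (hi : i < M.N₁) (hj : j < M.N₂) (a b : Fin (p + 1)) :
    c i j a b ∈ boundedStates γ ρmin Emax smin := by
  have hh := M.h_pos
  -- A segment from the centre of the cell to the node. The node may lie on an edge that `evalDG`
  -- assigns to another cell, but for `s < 1` the point is inside the cell, and the bounds pass to
  -- the limit `s → 1`.
  set f : ℝ → State := fun s => ∑ a', ∑ b', ((lagrange ξ a').eval (s * ξ a)
      * (lagrange ξ b').eval (s * ξ b)) • c i j a' b' with hf
  have hfc : Continuous f := by
    apply continuous_finsetSum _ fun a' _ => continuous_finsetSum _ fun b' _ => ?_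
    have h1 : Continuous fun s : ℝ => (lagrange ξ a').eval (s * ξ a) :=
      (lagrange ξ a').continuous.comp (by fun_prop)
    have h2 : Continuous fun s : ℝ => (lagrange ξ b').eval (s * ξ b) :=
      (lagrange ξ b').continuous.comp (by fun_prop)
    exact (h1.mul h2).smul continuous_const
  have hf1 : f 1 = c i j a b := by
    simp [hf, eval_lagrange hGL.strictMono]
  have hmem : ∀ s ∈ Ioo (0 : ℝ) 1, f s ∈ boundedStates γ ρmin Emax smin := by
    intro s hs
    have key : ∀ (k : ℕ) (a : Fin (p + 1)), ((k : ℝ) + (s * ξ a + 1) / 2) * M.h ∈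
        Ico ((k : ℝ) * M.h) ((k + 1) * M.h) := by
      intro k a
      have h1 := hGL.mem_Icc a
      have h2 : -1 ≤ s * ξ a := by nlinarith [h1.1, h1.2, hs.1, hs.2]
      have h3 : s * ξ a < 1 := by nlinarith [h1.1, h1.2, hs.1, hs.2]
      constructor
      · gcongr; linarith
      · gcongr; linarith
    have hx := evalDG_eq_of_mem_Ico (ξ := ξ) M c
      (x := (((i : ℝ) + (s * ξ a + 1) / 2) * M.h, ((j : ℝ) + (s * ξ b + 1) / 2) * M.h))
      (key i a) (key j b)
    have e : ∀ (k : ℕ) (a : Fin (p + 1)),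
        2 * (((k : ℝ) + (s * ξ a + 1) / 2) * M.h - k * M.h) / M.h - 1 = s * ξ a := by
      intro k a; field_simp; ring
    simp only [e] at hx
    rw [← hf] at *
    change IsBoundedState γ ρmin Emax smin (f s)
    have : f s = evalDG M ξ c _ := hx.symm
    rw [this]
    apply h
    have b1 := mul_le_length hh M.length₁ hi
    have b2 := mul_le_length hh M.length₂ hj
    have k1 := key i a
    have k2 := key j b
    have z1 : (0 : ℝ) ≤ i * M.h := by positivity
    have z2 : (0 : ℝ) ≤ j * M.h := by positivity
    exact ⟨⟨z1.trans k1.1, k1.2.trans_le b1⟩, ⟨z2.trans k2.1, k2.2.trans_le b2⟩⟩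
  have hnhds : (𝓝[<] (1 : ℝ)).NeBot := inferInstance
  have hev : ∀ᶠ s in 𝓝[<] (1 : ℝ), f s ∈ boundedStates γ ρmin Emax smin := by
    filter_upwards [Ioo_mem_nhdsLT (zero_lt_one' ℝ)] with s hs using hmem s hs
  have hlim : Tendsto f (𝓝[<] 1) (𝓝 (c i j a b)) := by
    rw [← hf1]; exact hfc.continuousAt.tendsto.mono_left nhdsWithin_le_nhds
  have hk : ∀ k, Tendsto (fun s => f s k) (𝓝[<] 1) (𝓝 (c i j a b k)) :=
    fun k => (tendsto_pi_nhds.1 hlim) k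
  have h1 : ρmin ≤ dens (c i j a b) :=
    ge_of_tendsto (hk 0) (hev.mono fun s hs => hs.1)
  have h2 : energy (c i j a b) ≤ Emax :=
    le_of_tendsto (hk 3) (hev.mono fun s hs => hs.2.1)
  have hd0 : dens (c i j a b) ≠ 0 := (hρ.trans_le h1).ne'
  have hP : Tendsto (fun s => pressure γ (f s)) (𝓝[<] 1) (𝓝 (pressure γ (c i j a b))) :=
    ((hk 3).sub ((((hk 1).pow 2).add ((hk 2).pow 2)).div ((hk 0).const_mul 2)
      (mul_ne_zero two_ne_zero hd0))).const_mul (γ - 1)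
  have hR : Tendsto (fun s => Real.exp smin * dens (f s) ^ γ) (𝓝[<] 1)
      (𝓝 (Real.exp smin * dens (c i j a b) ^ γ)) :=
    ((hk 0).rpow_const (Or.inl hd0)).const_mul _
  -- The strict inequality for the pressure would not survive the limit; the closed form of the
  -- bounds does.
  have h3 : Real.exp smin * dens (c i j a b) ^ γ ≤ pressure γ (c i j a b) :=
    le_of_tendsto_of_tendsto hR hP
      (hev.mono fun s hs => ((isBoundedState_iff hρ).1 hs).2.2)
  exact (isBoundedState_iff hρ).2 ⟨h1, h2, h3⟩

lemma integral_lagrange_cell (hp : 1 ≤ p) (hGL : IsGaussLobatto p ξ ω) {h : ℝ} (hh : 0 < h) (i : ℕ)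
    (a : Fin (p + 1)) :
    ∫ x in Ioo (i * h) ((i + 1) * h), (lagrange ξ a).eval (2 * (x - i * h) / h - 1)
      = h / 2 * ω a := by
  rw [← integral_Ioc_eq_integral_Ioo, ← intervalIntegral.integral_of_le (by nlinarith)]
  have e : ∀ x : ℝ, 2 * (x - i * h) / h - 1 = 2 / h * x + (-(2 * i) - 1) := by
    intro x; field_simp; ring
  simp only [e]
  rw [intervalIntegral.integral_comp_mul_add (fun y => (lagrange ξ a).eval y) (by positivity)]
  have e1 : 2 / h * (i * h) + (-(2 * i) - 1) = -1 := by field_simp; ring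
  have e2 : 2 / h * ((i + 1) * h) + (-(2 * i) - 1) = 1 := by field_simp; ring
  rw [e1, e2, hGL.integral_lagrange hp]
  simp

lemma continuous_cellPoly (h : ℝ) (i j : ℕ) (w : Fin (p + 1) → Fin (p + 1) → ℝ) :
    Continuous (cellPoly h ξ i j w) := by
  unfold cellPoly
  refine continuous_finsetSum _ fun a _ => continuous_finsetSum _ fun b _ => ?_
  have h1 : Continuous fun x : ℝ × ℝ => (lagrange ξ a).eval (2 * (x.1 - i * h) / h - 1) :=
    (lagrange ξ a).continuous.comp (by fun_prop)
  have h2 : Continuous fun x : ℝ × ℝ => (lagrange ξ b).eval (2 * (x.2 - j * h) / h - 1) :=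
    (lagrange ξ b).continuous.comp (by fun_prop)
  exact (h1.mul h2).mul continuous_const

lemma integrableOn_cellSet_of_continuous {f : ℝ × ℝ → ℝ} (hf : Continuous f) (h : ℝ) (i j : ℕ) :
    IntegrableOn f (cellSet h i j) :=
  (hf.continuousOn.integrableOn_compact (isCompact_Icc.prod isCompact_Icc)).mono_set
    (prod_mono Ioo_subset_Icc_self Ioo_subset_Icc_self)

/-- Exactness of the tensor product Gauss-Lobatto rule on a cell. -/
lemma integral_cellPoly (hp : 1 ≤ p) (hGL : IsGaussLobatto p ξ ω) {h : ℝ} (hh : 0 < h) (i j : ℕ)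
    (w : Fin (p + 1) → Fin (p + 1) → ℝ) :
    ∫ x in cellSet h i j, cellPoly h ξ i j w x = h ^ 2 / 4 * ∑ a, ∑ b, ω a * ω b * w a b := by
  unfold cellPoly
  have hc : ∀ a b, Continuous fun x : ℝ × ℝ => (lagrange ξ a).eval (2 * (x.1 - i * h) / h - 1)
      * (lagrange ξ b).eval (2 * (x.2 - j * h) / h - 1) * w a b := by
    intro a b
    have h1 : Continuous fun x : ℝ × ℝ => (lagrange ξ a).eval (2 * (x.1 - i * h) / h - 1) :=
      (lagrange ξ a).continuous.comp (by fun_prop)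
    have h2 : Continuous fun x : ℝ × ℝ => (lagrange ξ b).eval (2 * (x.2 - j * h) / h - 1) :=
      (lagrange ξ b).continuous.comp (by fun_prop)
    exact (h1.mul h2).mul continuous_const
  rw [integral_finsetSum _ fun a _ =>
    integrable_finsetSum _ fun b _ => integrableOn_cellSet_of_continuous (hc a b) h i j]
  rw [Finset.mul_sum]
  refine Finset.sum_congr rfl fun a _ => ?_
  rw [integral_finsetSum _ fun b _ => integrableOn_cellSet_of_continuous (hc a b) h i j,
    Finset.mul_sum]
  refine Finset.sum_congr rfl fun b _ => ?_
  rw [integral_mul_const]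
  unfold cellSet
  rw [Measure.volume_eq_prod,
    setIntegral_prod_mul (fun x => (lagrange ξ a).eval (2 * (x - i * h) / h - 1))
      (fun y => (lagrange ξ b).eval (2 * (y - j * h) / h - 1)),
    integral_lagrange_cell hp hGL hh, integral_lagrange_cell hp hGL hh]
  ring

lemma volume_cellSet {h : ℝ} (hh : 0 < h) (i j : ℕ) : volume.real (cellSet h i j) = h ^ 2 := by
  unfold cellSet
  rw [measureReal_def, Measure.volume_eq_prod, Measure.prod_prod, Real.volume_Ioo, Real.volume_Ioo,
    ← ENNReal.ofReal_mul (by nlinarith), ENNReal.toReal_ofReal (by nlinarith)]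
  ring

lemma measurableSet_cellSet (h : ℝ) (i j : ℕ) : MeasurableSet (cellSet h i j) :=
  measurableSet_Ioo.prod measurableSet_Ioo

lemma rect_ae_eq_Ioo (L₁ L₂ : ℝ) : rect L₁ L₂ =ᵐ[volume] (Ioo 0 L₁ ×ˢ Ioo 0 L₂ : Set (ℝ × ℝ)) := by
  rw [Measure.volume_eq_prod]
  exact Measure.set_prod_ae_eq Ioo_ae_eq_Icc.symm Ioo_ae_eq_Icc.symm

lemma rect_ae_eq_Ico (L₁ L₂ : ℝ) : rect L₁ L₂ =ᵐ[volume] (Ico 0 L₁ ×ˢ Ico 0 L₂ : Set (ℝ × ℝ)) := by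
  rw [Measure.volume_eq_prod]
  exact Measure.set_prod_ae_eq Ico_ae_eq_Icc.symm Ico_ae_eq_Icc.symm

lemma cellSet_ae_eq_Ico (h : ℝ) (i j : ℕ) : (Ico (i * h) ((i + 1) * h) ×ˢ
    Ico (j * h) ((j + 1) * h) : Set (ℝ × ℝ)) =ᵐ[volume] cellSet h i j := by
  rw [Measure.volume_eq_prod]
  exact Measure.set_prod_ae_eq Ioo_ae_eq_Ico.symm Ioo_ae_eq_Ico.symm

lemma exists_cell_of_mem {N : ℕ} {h L x : ℝ} (hh : 0 < h) (hL : N * h = L) (hx : x ∈ Ico 0 L) :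
    ⌊x / h⌋₊ < N ∧ x ∈ Ico ((⌊x / h⌋₊ : ℝ) * h) ((⌊x / h⌋₊ + 1) * h) := by
  have h0 : 0 ≤ x / h := div_nonneg hx.1 hh.le
  refine ⟨?_, ?_, ?_⟩
  · rw [Nat.floor_lt h0, div_lt_iff₀ hh, hL]; exact hx.2
  · rw [← le_div_iff₀ hh]; exact Nat.floor_le h0
  · rw [← div_lt_iff₀ hh]; exact Nat.lt_floor_add_one _

/-- An integral over the rectangle is the sum of the integrals over the cells. -/
lemma integral_rect_eq_sum (M : Mesh L₁ L₂) {f : ℝ × ℝ → ℝ} (hf : IntegrableOn f (rect L₁ L₂)) :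
    ∫ x in rect L₁ L₂, f x =
      ∑ i ∈ Finset.range M.N₁, ∑ j ∈ Finset.range M.N₂, ∫ x in cellSet M.h i j, f x := by
  have hh := M.h_pos
  have hU : (Ico 0 L₁ ×ˢ Ico 0 L₂ : Set (ℝ × ℝ)) =
      ⋃ q ∈ Finset.range M.N₁ ×ˢ Finset.range M.N₂, (Ico ((q.1 : ℝ) * M.h) ((q.1 + 1) * M.h) ×ˢ
        Ico ((q.2 : ℝ) * M.h) ((q.2 + 1) * M.h) : Set (ℝ × ℝ)) := by
    ext x
    simp only [mem_iUnion, Finset.mem_product, Finset.mem_range, exists_prop, Prod.exists]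
    constructor
    · intro hx
      obtain ⟨h1, h2⟩ := exists_cell_of_mem hh M.length₁ hx.1
      obtain ⟨h3, h4⟩ := exists_cell_of_mem hh M.length₂ hx.2
      exact ⟨_, _, ⟨h1, h3⟩, h2, h4⟩
    · rintro ⟨i, j, ⟨hi, hj⟩, h1, h2⟩
      have b1 := mul_le_length hh M.length₁ hi
      have b2 := mul_le_length hh M.length₂ hj
      have z1 : (0 : ℝ) ≤ i * M.h := by positivity
      have z2 : (0 : ℝ) ≤ j * M.h := by positivity
      exact ⟨⟨z1.trans h1.1, h1.2.trans_le b1⟩, ⟨z2.trans h2.1, h2.2.trans_le b2⟩⟩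
  rw [setIntegral_congr_set (rect_ae_eq_Ico L₁ L₂), hU, integral_biUnion_finset]
  · rw [Finset.sum_product]
    refine Finset.sum_congr rfl fun i _ => Finset.sum_congr rfl fun j _ => ?_
    exact setIntegral_congr_set (cellSet_ae_eq_Ico M.h i j)
  · intro q _; exact measurableSet_Ico.prod measurableSet_Ico
  · intro q _ q' _ hne
    rw [Function.onFun, Set.disjoint_left]
    intro x hx hx'
    apply hne
    exact Prod.ext ((floor_div_eq hh hx.1).symm.trans (floor_div_eq hh hx'.1))
      ((floor_div_eq hh hx.2).symm.trans (floor_div_eq hh hx'.2))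
  · intro q hq
    have hf' : IntegrableOn f (Ico 0 L₁ ×ˢ Ico 0 L₂) := hf.congr_set_ae (rect_ae_eq_Ico L₁ L₂).symm
    refine hf'.mono_set ?_
    rw [hU]
    exact Set.subset_biUnion_of_mem (u := fun q : ℕ × ℕ => (Ico ((q.1 : ℝ) * M.h) ((q.1 + 1) * M.h) ×ˢ
        Ico ((q.2 : ℝ) * M.h) ((q.2 + 1) * M.h) : Set (ℝ × ℝ))) hq

lemma measurable_evalDG (M : Mesh L₁ L₂) (c : Coeffs p) : Measurable (evalDG M ξ c) := by
  unfold evalDG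
  have hi : Measurable fun x : ℝ × ℝ => ⌊x.1 / M.h⌋₊ :=
    Nat.measurable_floor.comp (measurable_fst.div_const _)
  have hj : Measurable fun x : ℝ × ℝ => ⌊x.2 / M.h⌋₊ :=
    Nat.measurable_floor.comp (measurable_snd.div_const _)
  have hi' : Measurable fun x : ℝ × ℝ => (⌊x.1 / M.h⌋₊ : ℝ) := measurable_from_nat.comp hi
  have hj' : Measurable fun x : ℝ × ℝ => (⌊x.2 / M.h⌋₊ : ℝ) := measurable_from_nat.comp hj
  refine Finset.measurable_sum _ fun a _ => Finset.measurable_sum _ fun b _ => ?_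
  refine measurable_pi_lambda _ fun k => ?_
  simp only [Pi.smul_apply, smul_eq_mul]
  refine Measurable.mul ?_ ?_
  · exact ((lagrange ξ a).continuous.measurable.comp
      ((((measurable_fst.sub (hi'.mul_const _)).const_mul 2).div_const _).sub_const 1)).mul
      ((lagrange ξ b).continuous.measurable.comp
      ((((measurable_snd.sub (hj'.mul_const _)).const_mul 2).div_const _).sub_const 1))
  · have : Measurable fun q : ℕ × ℕ => c q.1 q.2 a b k := .of_discrete
    exact this.comp (hi.prodMk hj)

end Geometry

/-! ### Regularity of test functions up to the boundary. -/

section TestFunctions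

/-- The unit vector in the direction `d`. -/
def unitVec (d : Fin 2) : ℝ × ℝ := if d = 0 then (1, 0) else (0, 1)

/-- The space-time cylinder. -/
def cylinder (T L₁ L₂ : ℝ) : Set (ℝ × (ℝ × ℝ)) := Icc 0 T ×ˢ rect L₁ L₂

/-- The open space-time cylinder. -/
def openCylinder (T L₁ L₂ : ℝ) : Set (ℝ × (ℝ × ℝ)) := Ioo 0 T ×ˢ (Ioo 0 L₁ ×ˢ Ioo 0 L₂)

variable {T L₁ L₂ : ℝ} {k : ℕ} {φ : ℝ → ℝ × ℝ → ℝ}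

lemma openCylinder_subset : openCylinder T L₁ L₂ ⊆ cylinder T L₁ L₂ :=
  prod_mono Ioo_subset_Icc_self (prod_mono Ioo_subset_Icc_self Ioo_subset_Icc_self)

lemma isOpen_openCylinder : IsOpen (openCylinder T L₁ L₂) :=
  isOpen_Ioo.prod (isOpen_Ioo.prod isOpen_Ioo)

lemma cylinder_mem_nhds {z : ℝ × (ℝ × ℝ)} (hz : z ∈ openCylinder T L₁ L₂) :
    cylinder T L₁ L₂ ∈ 𝓝 z :=
  mem_of_superset (isOpen_openCylinder.mem_nhds hz) openCylinder_subset

lemma isCompact_cylinder : IsCompact (cylinder T L₁ L₂) :=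
  isCompact_Icc.prod (isCompact_Icc.prod isCompact_Icc)

lemma convex_cylinder : Convex ℝ (cylinder T L₁ L₂) :=
  (convex_Icc _ _).prod ((convex_Icc _ _).prod (convex_Icc _ _))

lemma uniqueDiffOn_cylinder (hT : 0 < T) (h₁ : 0 < L₁) (h₂ : 0 < L₂) :
    UniqueDiffOn ℝ (cylinder T L₁ L₂) :=
  (uniqueDiffOn_Icc hT).prod ((uniqueDiffOn_Icc h₁).prod (uniqueDiffOn_Icc h₂))

/-- The full derivative of a test function, up to the boundary. -/
def testDeriv (T L₁ L₂ : ℝ) (φ : ℝ → ℝ × ℝ → ℝ) (z : ℝ × (ℝ × ℝ)) : ℝ × (ℝ × ℝ) →L[ℝ] ℝ :=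
  fderivWithin ℝ (fun z : ℝ × (ℝ × ℝ) => φ z.1 z.2) (cylinder T L₁ L₂) z

namespace IsSmoothTest

variable (hφ : IsSmoothTest (k + 1) T L₁ L₂ φ)
include hφ

lemma continuousOn : ContinuousOn (fun z : ℝ × (ℝ × ℝ) => φ z.1 z.2) (cylinder T L₁ L₂) :=
  ContDiffOn.continuousOn hφ

lemma hasFDerivWithinAt {z : ℝ × (ℝ × ℝ)} (hz : z ∈ cylinder T L₁ L₂) :
    HasFDerivWithinAt (fun z : ℝ × (ℝ × ℝ) => φ z.1 z.2) (testDeriv T L₁ L₂ φ z)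
      (cylinder T L₁ L₂) z :=
  (ContDiffOn.differentiableOn hφ (by simp) z hz).hasFDerivWithinAt

lemma hasFDerivAt {z : ℝ × (ℝ × ℝ)} (hz : z ∈ openCylinder T L₁ L₂) :
    HasFDerivAt (fun z : ℝ × (ℝ × ℝ) => φ z.1 z.2) (testDeriv T L₁ L₂ φ z) z :=
  (hφ.hasFDerivWithinAt (openCylinder_subset hz)).hasFDerivAt (cylinder_mem_nhds hz)

lemma continuousOn_testDeriv (hT : 0 < T) (h₁ : 0 < L₁) (h₂ : 0 < L₂) :
    ContinuousOn (testDeriv T L₁ L₂ φ) (cylinder T L₁ L₂) :=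
  ContDiffOn.continuousOn_fderivWithin hφ (uniqueDiffOn_cylinder hT h₁ h₂) (by simp)

lemma hasDerivAt_time {t : ℝ} {x : ℝ × ℝ} (hz : (t, x) ∈ openCylinder T L₁ L₂) :
    HasDerivAt (fun s => φ s x) (testDeriv T L₁ L₂ φ (t, x) (1, 0)) t := by
  have h := hφ.hasFDerivAt hz
  have h2 : HasDerivAt (fun s : ℝ => (s, x)) ((1 : ℝ), (0 : ℝ × ℝ)) t :=
    (hasDerivAt_id t).prodMk (hasDerivAt_const t x)
  exact h.comp_hasDerivAt t h2

/-- The test function is prescribed only on the closed cylinder, so on its boundary the two-sided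
derivative need not be meaningful. All later estimates use partial derivatives in the open cylinder
only, whose complement in the cylinder is a null set. -/
lemma dt_eq {t : ℝ} {x : ℝ × ℝ} (hz : (t, x) ∈ openCylinder T L₁ L₂) :
    dt φ t x = testDeriv T L₁ L₂ φ (t, x) (1, 0) := (hφ.hasDerivAt_time hz).deriv

lemma dx_eq (d : Fin 2) {t : ℝ} {x : ℝ × ℝ} (hz : (t, x) ∈ openCylinder T L₁ L₂) :
    dx d φ t x = testDeriv T L₁ L₂ φ (t, x) (0, unitVec d) := by
  have h := hφ.hasFDerivAt hz
  fin_cases d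
  · have h2 : HasDerivAt (fun s : ℝ => (t, (s, x.2))) ((0 : ℝ), ((1 : ℝ), (0 : ℝ))) x.1 :=
      (hasDerivAt_const _ t).prodMk ((hasDerivAt_id _).prodMk (hasDerivAt_const _ x.2))
    have h3 := (HasFDerivAt.comp_hasDerivAt (f := fun s : ℝ => (t, (s, x.2))) x.1 h h2).deriv
    simp only [dx, unitVec]
    exact h3
  · have h2 : HasDerivAt (fun s : ℝ => (t, (x.1, s))) ((0 : ℝ), ((0 : ℝ), (1 : ℝ))) x.2 :=
      (hasDerivAt_const _ t).prodMk ((hasDerivAt_const _ x.1).prodMk (hasDerivAt_id _))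
    have h3 := (HasFDerivAt.comp_hasDerivAt (f := fun s : ℝ => (t, (x.1, s))) x.2 h h2).deriv
    simp only [dx, unitVec]
    exact h3

lemma continuousOn_dt (hT : 0 < T) (h₁ : 0 < L₁) (h₂ : 0 < L₂) :
    ContinuousOn (fun z : ℝ × (ℝ × ℝ) => dt φ z.1 z.2) (openCylinder T L₁ L₂) := by
  have h := ((hφ.continuousOn_testDeriv hT h₁ h₂).mono openCylinder_subset).clm_apply
    (continuousOn_const (c := ((1 : ℝ), (0 : ℝ × ℝ))))
  exact h.congr fun z hz => hφ.dt_eq hz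

lemma continuousOn_dx (hT : 0 < T) (h₁ : 0 < L₁) (h₂ : 0 < L₂) (d : Fin 2) :
    ContinuousOn (fun z : ℝ × (ℝ × ℝ) => dx d φ z.1 z.2) (openCylinder T L₁ L₂) := by
  have h := ((hφ.continuousOn_testDeriv hT h₁ h₂).mono openCylinder_subset).clm_apply
    (continuousOn_const (c := ((0 : ℝ), unitVec d)))
  exact h.congr fun z hz => hφ.dx_eq d hz

end IsSmoothTest

lemma norm_unitVec (d : Fin 2) : ‖unitVec d‖ = 1 := by
  fin_cases d <;> simp [unitVec, Prod.norm_def]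

/-- Quantitative smoothness of a test function. -/
structure TestBounds (T L₁ L₂ : ℝ) (φ : ℝ → ℝ × ℝ → ℝ) (C : ℝ) : Prop where
  nonneg : 0 ≤ C
  abs_le : ∀ t ∈ Icc 0 T, ∀ x ∈ rect L₁ L₂, |φ t x| ≤ C
  lipschitz : ∀ t ∈ Icc 0 T, ∀ x ∈ rect L₁ L₂, ∀ y ∈ rect L₁ L₂, |φ t y - φ t x| ≤ C * ‖y - x‖
  dt_le : ∀ t ∈ Ioo 0 T, ∀ x ∈ Ioo 0 L₁ ×ˢ Ioo 0 L₂, |dt φ t x| ≤ C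
  dx_le : ∀ t ∈ Ioo 0 T, ∀ x ∈ Ioo 0 L₁ ×ˢ Ioo 0 L₂, ∀ d, |dx d φ t x| ≤ C
  taylor : ∀ t ∈ Ioo 0 T, ∀ z ∈ Ioo 0 L₁ ×ˢ Ioo 0 L₂, ∀ d, ∀ r, 0 ≤ r → ∀ x ∈ rect L₁ L₂,
    x + r • unitVec d ∈ rect L₁ L₂ → ‖x - z‖ ≤ r → ‖x + r • unitVec d - z‖ ≤ r →
      |φ t (x + r • unitVec d) - φ t x - r * dx d φ t z| ≤ C * r ^ 2

/-- Two continuous derivatives on a compact convex set: bounds by compactness, Lipschitz estimates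
for the function and its derivative by the mean value inequality. -/
lemma IsSmoothTest.exists_testBounds (hφ : IsSmoothTest (k + 1) T L₁ L₂ φ) (hk : 1 ≤ k)
    (hT : 0 < T) (h₁ : 0 < L₁) (h₂ : 0 < L₂) : ∃ C, TestBounds T L₁ L₂ φ C := by
  set S := cylinder T L₁ L₂ with hS
  set f : ℝ × (ℝ × ℝ) → ℝ := fun z => φ z.1 z.2 with hf
  set D := testDeriv T L₁ L₂ φ with hD
  have hu := uniqueDiffOn_cylinder hT h₁ h₂
  obtain ⟨C0, hC0⟩ := isCompact_cylinder.exists_bound_of_continuousOn hφ.continuousOn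
  obtain ⟨C1, hC1⟩ := isCompact_cylinder.exists_bound_of_continuousOn
    (hφ.continuousOn_testDeriv hT h₁ h₂)
  have hD1 : ContDiffOn ℝ 1 D S := by
    refine ContDiffOn.fderivWithin hφ hu ?_
    norm_cast
    omega
  obtain ⟨C2, hC2⟩ := isCompact_cylinder.exists_bound_of_continuousOn
    (hD1.continuousOn_fderivWithin hu (by simp))
  have hDlip : ∀ z ∈ S, ∀ w ∈ S, ‖D w - D z‖ ≤ C2 * ‖w - z‖ := fun z hz w hw =>
    convex_cylinder.norm_image_sub_le_of_norm_hasFDerivWithin_le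
      (fun y hy => (hD1.differentiableOn (by simp) y hy).hasFDerivWithinAt) hC2 hz hw
  have hne : ((0 : ℝ), ((0 : ℝ), (0 : ℝ))) ∈ S :=
    ⟨⟨le_rfl, hT.le⟩, ⟨le_rfl, h₁.le⟩, ⟨le_rfl, h₂.le⟩⟩
  have p0 : 0 ≤ C0 := (norm_nonneg _).trans (hC0 _ hne)
  have p1 : 0 ≤ C1 := (norm_nonneg _).trans (hC1 _ hne)
  have p2 : 0 ≤ C2 := (norm_nonneg _).trans (hC2 _ hne)
  have hsub : ∀ {t : ℝ} {x : ℝ × ℝ}, t ∈ Ioo 0 T → x ∈ Ioo 0 L₁ ×ˢ Ioo 0 L₂ →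
    (t, x) ∈ openCylinder T L₁ L₂ := fun ht hx => ⟨ht, hx⟩
  have hev : ∀ z ∈ S, ∀ v : ℝ × (ℝ × ℝ), ‖v‖ = 1 → |D z v| ≤ C1 := by
    intro z hz v hv
    have := (D z).le_of_opNorm_le (hC1 z hz) v
    rwa [hv, mul_one] at this
  refine ⟨C0 + C1 + C2, by positivity, ?_, ?_, ?_, ?_, ?_⟩
  · intro t ht x hx
    have := hC0 (t, x) ⟨ht, hx⟩
    rw [Real.norm_eq_abs] at this
    linarith
  · intro t ht x hx y hy
    have h := convex_cylinder.norm_image_sub_le_of_norm_hasFDerivWithin_le (𝕜 := ℝ)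
      (fun z hz => hφ.hasFDerivWithinAt hz) hC1 (x := (t, x)) (y := (t, y)) ⟨ht, hx⟩ ⟨ht, hy⟩
    have e : ‖((t, y) : ℝ × (ℝ × ℝ)) - (t, x)‖ = ‖y - x‖ := by
      rw [Prod.mk_sub_mk, sub_self, Prod.norm_def]
      simp
    rw [e] at h
    have := norm_nonneg (y - x)
    rw [Real.norm_eq_abs] at h
    simp only at h
    nlinarith
  · intro t ht x hx
    rw [hφ.dt_eq (hsub ht hx)]
    have := hev (t, x) (openCylinder_subset (hsub ht hx)) (1, 0) (by simp [Prod.norm_def])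
    linarith
  · intro t ht x hx d
    rw [hφ.dx_eq d (hsub ht hx)]
    have := hev (t, x) (openCylinder_subset (hsub ht hx)) (0, unitVec d)
      (by rw [Prod.norm_def]; simp [norm_unitVec])
    linarith
  · intro t ht z hz d r hr x hx hy hxz hyz
    have hzc := openCylinder_subset (hsub ht hz)
    rw [hφ.dx_eq d (hsub ht hz)]
    have hn : ∀ w : ℝ × ℝ, ‖((t, w) : ℝ × (ℝ × ℝ)) - (t, z)‖ = ‖w - z‖ := by
      intro w
      rw [Prod.mk_sub_mk, sub_self, Prod.norm_def]
      simp
    -- The mean value inequality with the derivative frozen at `z`. Intersecting with the ball keeps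
    -- the domain convex and the derivative within `C2 * r` of its value at `z`.
    have h := (convex_cylinder.inter (convex_closedBall (t, z) r)
      ).norm_image_sub_le_of_norm_hasFDerivWithin_le' (𝕜 := ℝ) (f := f) (f' := D) (φ := D (t, z))
      (C := C2 * r) (x := (t, x)) (y := (t, x + r • unitVec d))
      (fun w hw => (hφ.hasFDerivWithinAt hw.1).mono inter_subset_left)
      (fun w hw => (hDlip _ hzc w hw.1).trans
        (mul_le_mul_of_nonneg_left (mem_closedBall_iff_norm.1 hw.2) p2))
      ⟨⟨Ioo_subset_Icc_self ht, hx⟩, by rw [mem_closedBall_iff_norm, hn]; exact hxz⟩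
      ⟨⟨Ioo_subset_Icc_self ht, hy⟩, by rw [mem_closedBall_iff_norm, hn]; exact hyz⟩
    have e : ((t, x + r • unitVec d) : ℝ × (ℝ × ℝ)) - (t, x) = r • (0, unitVec d) := by
      rw [Prod.mk_sub_mk, sub_self, add_sub_cancel_left]
      ext <;> simp
    have e2 : ‖((0 : ℝ), unitVec d)‖ = 1 := by rw [Prod.norm_def]; simp [norm_unitVec]
    rw [e, map_smul, norm_smul, e2, Real.norm_eq_abs r, abs_of_nonneg hr, Real.norm_eq_abs,
      smul_eq_mul] at h
    refine h.trans ?_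
    have : 0 ≤ (C0 + C1) * r ^ 2 := by positivity
    nlinarith

end TestFunctions

/-! ### Balance laws as a common frame for conserved variables and entropy. -/

/-- A balance law `∂ₜ G + div F = 0` of the Euler equations: `g` is the gradient of the density `G`
and `ψ` the potential of the flux. -/
structure IsBalanceLaw (γ : ℝ) (G : State → ℝ) (g : State → State) (ψ : Fin 2 → State → ℝ) :
    Prop where
  shuffle : IsShuffle γ g ψ
  hasDeriv : ∀ (c : ℝ → State) (c' : State) (s : Set ℝ) (t : ℝ), HasDerivWithinAt c c' s t →
    0 < dens (c t) → 0 < pressure γ (c t) →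
      HasDerivWithinAt (fun t => G (c t)) (dotProduct (g (c t)) c') s t
  lip_density : ∀ B d δ, BoundedCalculus γ B d δ → LipBddOn B d G
  lip_multiplier : ∀ B d δ, BoundedCalculus γ B d δ → ∀ k, LipBddOn B d (fun U => g U k)
  lip_potential : ∀ B d δ, BoundedCalculus γ B d δ → ∀ a, LipBddOn B d (ψ a)
  measurable_density : Measurable G
  measurable_multiplier : ∀ k, Measurable (fun U => g U k)
  measurable_potential : ∀ a, Measurable (ψ a)

/-- The flux of a balance law. -/
def balanceFlux (γ : ℝ) (g : State → State) (ψ : Fin 2 → State → ℝ) (a : Fin 2) (U : State) : ℝ :=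
  dotProduct (g U) (eulerFlux γ a U) - ψ a U

/-! ### Measurability of the thermodynamic quantities and fluxes. -/

section Measurability

lemma measurable_dens : Measurable dens := measurable_pi_apply 0

lemma measurable_energy : Measurable energy := measurable_pi_apply 3

lemma measurable_mom (a : Fin 2) : Measurable (fun U => mom U a) := by
  fin_cases a
  · exact measurable_pi_apply 1
  · exact measurable_pi_apply 2

lemma measurable_vel (a : Fin 2) : Measurable (fun U => vel U a) :=
  (measurable_mom a).div measurable_dens

lemma measurable_pressure (γ : ℝ) : Measurable (pressure γ) := by
  have := measurable_mom 0
  have := measurable_mom 1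
  have := measurable_dens
  have := measurable_energy
  unfold pressure
  fun_prop

lemma measurable_thermoEntropy (γ : ℝ) : Measurable (thermoEntropy γ) := by
  have := measurable_pressure γ
  have := measurable_dens
  unfold thermoEntropy
  fun_prop

lemma measurable_mathEntropy (γ : ℝ) : Measurable (mathEntropy γ) := by
  have := measurable_thermoEntropy γ
  have := measurable_dens
  unfold mathEntropy
  fun_prop

lemma measurable_entropyVars (γ : ℝ) (k : Fin 4) : Measurable (fun U => entropyVars γ U k) := by
  have := measurable_thermoEntropy γ
  have := measurable_dens
  have := measurable_pressure γ
  have h0 := measurable_vel 0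
  have h1 := measurable_vel 1
  unfold entropyVars
  fin_cases k <;> simp <;> fun_prop

lemma measurable_eulerFlux (γ : ℝ) (a : Fin 2) (k : Fin 4) :
    Measurable (fun U => eulerFlux γ a U k) := by
  have := measurable_dens
  have := measurable_energy
  have := measurable_pressure γ
  have h0 := measurable_vel a
  have h1 := measurable_mom 0
  have h2 := measurable_mom 1
  have hif : ∀ b : Fin 2, Measurable (fun U => if a = b then pressure γ U else 0) := by
    intro b; by_cases h : a = b <;> simp [h, this]
  have := hif 0
  have := hif 1
  unfold eulerFlux
  fin_cases k <;> simp <;> fun_prop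

lemma IsBalanceLaw.measurable_flux {γ : ℝ} {G : State → ℝ} {g : State → State}
    {ψ : Fin 2 → State → ℝ} (h : IsBalanceLaw γ G g ψ) (a : Fin 2) :
    Measurable (balanceFlux γ g ψ a) := by
  have h1 := h.measurable_multiplier
  have h2 := measurable_eulerFlux γ a
  have h3 := h.measurable_potential a
  unfold balanceFlux dotProduct
  fun_prop

end Measurability

/-! ### Conserved variables and entropy as balance laws. -/

section Instances

/-- A constant multiplier and the zero potential make the shuffle condition trivial, whatever the
volume flux. -/
lemma isBalanceLaw_coord {γ : ℝ} (k : Fin 4) :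
    IsBalanceLaw γ (fun U => U k) (fun _ => Pi.single k 1) (fun _ _ => 0) where
  shuffle := fun a U V _ _ _ _ => by simp
  hasDeriv := fun c c' s t hc _ _ => by
    have := (hasDerivWithinAt_pi.1 hc) k
    simpa [single_dotProduct] using this
  lip_density := fun B d δ hB => hB.coord k
  lip_multiplier := fun B d δ hB l => NearOn.const hB.d_nonneg _
  lip_potential := fun B d δ hB a => NearOn.const hB.d_nonneg _
  measurable_density := measurable_pi_apply k
  measurable_multiplier := fun _ => measurable_const
  measurable_potential := fun _ => measurable_const

lemma balanceFlux_coord (γ : ℝ) (k : Fin 4) (a : Fin 2) (U : State) :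
    balanceFlux γ (fun _ => Pi.single k 1) (fun _ _ => 0) a U = eulerFlux γ a U k := by
  simp [balanceFlux, single_dotProduct]

lemma isBalanceLaw_entropy {γ : ℝ} (hγ : 1 < γ) :
    IsBalanceLaw γ (mathEntropy γ) (entropyVars γ) entropyPotential where
  shuffle := fun a _ _ h1 h2 h3 h4 => volumeFlux_entropy_conservative hγ a h1 h2 h3 h4
  hasDeriv := fun _ _ _ _ hc h1 h2 => hasDerivWithinAt_mathEntropy hγ hc h1 h2
  lip_density := fun _ _ _ hB => hB.mathEntropy
  lip_multiplier := fun _ _ _ hB k => hB.entropyVars k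
  lip_potential := fun _ _ _ hB a => hB.entropyPotential a
  measurable_density := measurable_mathEntropy γ
  measurable_multiplier := measurable_entropyVars γ
  measurable_potential := fun a => measurable_dens.mul (measurable_vel a)

end Instances

/-! ### One constant for all the estimates of a balance law. -/

section Constants

variable {γ : ℝ} {G : State → ℝ} {g : State → State} {ψ : Fin 2 → State → ℝ}

/-- Quantitative bounds of the functions of a balance law on the set `B`. -/
structure BalanceBounds (γ : ℝ) (G : State → ℝ) (g : State → State) (ψ : Fin 2 → State → ℝ)
    (B : Set State) (C : ℝ) : Prop where
  nonneg : 0 ≤ C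
  density_le : ∀ U ∈ B, |G U| ≤ C
  multiplier_le : ∀ U ∈ B, ∀ k, |g U k| ≤ C
  multiplier_lip : ∀ U ∈ B, ∀ V ∈ B, ∀ k, |g V k - g U k| ≤ C * ‖V - U‖
  flux_le : ∀ U ∈ B, ∀ a, |balanceFlux γ g ψ a U| ≤ C
  flux_lip : ∀ U ∈ B, ∀ V ∈ B, ∀ a,
    |balanceFlux γ g ψ a V - balanceFlux γ g ψ a U| ≤ C * ‖V - U‖
  twoPoint : ∀ U ∈ B, ∀ V ∈ B, ∀ a,
    |twoPointFlux γ g ψ a U V - balanceFlux γ g ψ a U| ≤ C * ‖V - U‖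
  euler_lip : ∀ U ∈ B, ∀ V ∈ B, ∀ a k,
    |eulerFlux γ a V k - eulerFlux γ a U k| ≤ C * ‖V - U‖
  volume : ∀ U ∈ B, ∀ V ∈ B, ∀ a k,
    |volumeFlux γ a U V k - eulerFlux γ a U k| ≤ C * ‖V - U‖

lemma exists_common_bound {X ι : Type*} [Fintype ι] {B : Set X} {d : X → X → ℝ}
    (hd : ∀ U V, 0 ≤ d U V) {f : ι → X → X → ℝ} {f₀ : ι → X → ℝ} (h : ∀ i, NearOn B d (f i) (f₀ i)) :
    ∃ C, 0 ≤ C ∧ ∀ i, ∀ U ∈ B, ∀ V ∈ B, |f₀ i U| ≤ C ∧ |f i U V - f₀ i U| ≤ C * d U V := by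
  choose C hC h using h
  have hle : ∀ i, C i ≤ ∑ j, C j := fun i => Finset.single_le_sum (fun j _ => hC j)
    (Finset.mem_univ i)
  refine ⟨∑ i, C i, Finset.sum_nonneg fun i _ => hC i, fun i U hU V hV => ?_⟩
  obtain ⟨h1, _, h3⟩ := h i U hU V hV
  exact ⟨h1.trans (hle i), h3.trans (mul_le_mul_of_nonneg_right (hle i) (hd U V))⟩

/-- Each quantity is a finite combination of functions covered by the calculus `NearOn`, and the sum
of the individual constants serves for all of them. -/
lemma IsBalanceLaw.exists_bounds (hγ : 1 < γ) (h : IsBalanceLaw γ G g ψ) {B : Set State} {δ : ℝ}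
    (hB : BoundedCalculus γ B (fun U V => ‖V - U‖) δ) : ∃ C, BalanceBounds γ G g ψ B C := by
  have hd := hB.d_nonneg
  have hg := h.lip_multiplier _ _ _ hB
  have hψ := h.lip_potential _ _ _ hB
  have hvol := fun a k => hB.volumeFlux hγ a k
  have hF : ∀ a, LipBddOn B (fun U V => ‖V - U‖) (balanceFlux γ g ψ a) := fun a =>
    (NearOn.sum Finset.univ hd fun k _ => (hg k).mul hd (hB.eulerFlux a k)).sub hd (hψ a)
  have hT : ∀ a, NearOn B (fun U V => ‖V - U‖) (twoPointFlux γ g ψ a) (balanceFlux γ g ψ a) := by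
    intro a
    refine (((NearOn.sum Finset.univ hd fun k _ =>
      ((((hg k).left hd).add hd (hg k)).mul hd (hvol a k))).const_mul hd (1 / 2)).sub hd
      ((((hψ a).left hd).add hd (hψ a)).const_mul hd (1 / 2))).congr ?_ ?_
    · intro U _ V _
      simp only [twoPointFlux, dotProduct, Pi.add_apply]; ring
    · intro U _
      simp only [balanceFlux, dotProduct, Finset.mul_sum]
      congr 1
      · exact Finset.sum_congr rfl fun i _ => by ring
      · ring
  obtain ⟨C0, p0, c0⟩ := exists_common_bound hd (fun _ : Unit => h.lip_density _ _ _ hB)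
  obtain ⟨C1, p1, c1⟩ := exists_common_bound hd hg
  obtain ⟨C2, p2, c2⟩ := exists_common_bound hd hF
  obtain ⟨C3, p3, c3⟩ := exists_common_bound hd hT
  obtain ⟨C4, p4, c4⟩ := exists_common_bound hd
    (fun q : Fin 2 × Fin 4 => hB.eulerFlux q.1 q.2)
  obtain ⟨C5, p5, c5⟩ := exists_common_bound hd (fun q : Fin 2 × Fin 4 => hvol q.1 q.2)
  have hle : ∀ {C x : ℝ} {U V : State}, C ≤ C0 + C1 + C2 + C3 + C4 + C5 → x ≤ C * ‖V - U‖ →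
      x ≤ (C0 + C1 + C2 + C3 + C4 + C5) * ‖V - U‖ := fun h1 h2 =>
    h2.trans (mul_le_mul_of_nonneg_right h1 (norm_nonneg _))
  exact ⟨C0 + C1 + C2 + C3 + C4 + C5,
    { nonneg := by positivity
      density_le := fun U hU => (c0 () U hU U hU).1.trans (by linarith)
      multiplier_le := fun U hU k => (c1 k U hU U hU).1.trans (by linarith)
      multiplier_lip := fun U hU V hV k => hle (by linarith) (c1 k U hU V hV).2
      flux_le := fun U hU a => (c2 a U hU U hU).1.trans (by linarith)
      flux_lip := fun U hU V hV a => hle (by linarith) (c2 a U hU V hV).2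
      twoPoint := fun U hU V hV a => hle (by linarith) (c3 a U hU V hV).2
      euler_lip := fun U hU V hV a k => hle (by linarith) (c4 (a, k) U hU V hV).2
      volume := fun U hU V hV a k => hle (by linarith) (c5 (a, k) U hU V hV).2 }⟩

end Constants

/-! ### Exterior traces of bounded states are bounded states. -/

section Mirror

lemma mirror_mem_boundedStates {γ ρmin Emax smin : ℝ} {U : State} (a : Fin 2)
    (hU : U ∈ boundedStates γ ρmin Emax smin) :
    mirror a U ∈ boundedStates γ ρmin Emax smin := by
  change IsBoundedState _ _ _ _ _
  unfold IsBoundedState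
  rw [dens_mirror, energy_mirror, pressure_mirror, thermoEntropy_mirror]
  exact hU

variable {p : ℕ}

lemma lineExtRight_mem {B : Set State} (hB : ∀ d, ∀ U ∈ B, mirror d U ∈ B)
    (bc : BoundaryCondition) (d : Fin 2) {N : ℕ} {W : ℕ → Fin (p + 1) → State}
    (hW : ∀ i < N, ∀ a, W i a ∈ B) {i : ℕ} (hi : i < N) : lineExtRight bc d N W i ∈ B := by
  cases bc with
  | periodic => exact hW _ (Nat.mod_lt _ (by omega)) _
  | noFlux =>
    simp only [lineExtRight]
    split_ifs with h
    · exact hW _ h _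
    · exact hB _ _ (hW _ hi _)

lemma lineExtLeft_mem {B : Set State} (hB : ∀ d, ∀ U ∈ B, mirror d U ∈ B)
    (bc : BoundaryCondition) (d : Fin 2) {N : ℕ} {W : ℕ → Fin (p + 1) → State}
    (hW : ∀ i < N, ∀ a, W i a ∈ B) {i : ℕ} (hi : i < N) : lineExtLeft bc d N W i ∈ B := by
  cases bc with
  | periodic => exact hW _ (Nat.mod_lt _ (by omega)) _
  | noFlux =>
    simp only [lineExtLeft]
    split_ifs with h
    · exact hW _ (by omega) _
    · exact hB _ _ (hW _ hi _)

end Mirror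

/-! ### Consistency of flux differencing and quadrature in one cell. -/

section CellTools

variable {γ : ℝ} {G : State → ℝ} {g : State → State} {ψ : Fin 2 → State → ℝ}
variable {p : ℕ} {ξ ω : Fin (p + 1) → ℝ} {L₁ L₂ : ℝ}

/-- Consistency of the split form of the one-dimensional derivative. -/
lemma exists_line_consistency (hGL : IsGaussLobatto p ξ ω) :
    ∃ C, 0 ≤ C ∧ ∀ (x : Fin (p + 1) → ℝ) (f : Fin (p + 1) → Fin (p + 1) → ℝ)
      (F m e₁ e₂ e₃ y : ℝ), 0 ≤ e₁ → (∀ a l, |x l - x a| ≤ e₁) → (∀ a l, |f a l - F| ≤ e₂) →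
      |x (Fin.last p) - x 0 - y| ≤ e₃ → |F| ≤ m →
      |∑ a, ∑ l, ω a * diffMatrix ξ a l * ((x l - x a) * f a l) - F * y| ≤
        C * (e₁ * e₂) + m * e₃ := by
  refine ⟨∑ a, ∑ l, |ω a * diffMatrix ξ a l|, Finset.sum_nonneg fun _ _ =>
    Finset.sum_nonneg fun _ _ => abs_nonneg _, fun x f F m e₁ e₂ e₃ y he₁ h₁ h₂ h₃ hF => ?_⟩
  -- Splitting off the constant `F` from the two-point flux: this part sums exactly to the
  -- difference of the end values, and the rest is a product of two small quantities.
  have e : ∑ a, ∑ l, ω a * diffMatrix ξ a l * ((x l - x a) * f a l) - F * y =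
      ∑ a, ∑ l, ω a * diffMatrix ξ a l * ((x l - x a) * (f a l - F))
        + F * (x (Fin.last p) - x 0 - y) := by
    rw [mul_sub F, ← hGL.sum_weight_diffMatrix_mul_sub x, Finset.mul_sum, add_sub_assoc',
      ← Finset.sum_add_distrib]
    congr 1
    refine Finset.sum_congr rfl fun a _ => ?_
    rw [Finset.mul_sum, ← Finset.sum_add_distrib]
    exact Finset.sum_congr rfl fun l _ => by ring
  rw [e]
  refine (abs_add_le _ _).trans (add_le_add ?_ ?_)
  · rw [Finset.sum_mul]
    refine (Finset.abs_sum_le_sum_abs _ _).trans (Finset.sum_le_sum fun a _ => ?_)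
    rw [Finset.sum_mul]
    refine (Finset.abs_sum_le_sum_abs _ _).trans (Finset.sum_le_sum fun l _ => ?_)
    rw [abs_mul, abs_mul (x l - x a)]
    exact mul_le_mul_of_nonneg_left (mul_le_mul (h₁ a l) (h₂ a l) (abs_nonneg _) he₁)
      (abs_nonneg _)
  · rw [abs_mul]
    exact mul_le_mul hF h₃ (abs_nonneg _) ((abs_nonneg _).trans hF)

/-- Consistency of the volume term of a cell. -/
lemma exists_cellVolume_consistency (hp : 1 ≤ p) (hGL : IsGaussLobatto p ξ ω) :
    ∃ C, 0 ≤ C ∧ ∀ (γ : ℝ) (g : State → State) (ψ : Fin 2 → State → ℝ)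
      (W : Fin (p + 1) → Fin (p + 1) → State) (x : Fin (p + 1) → Fin (p + 1) → ℝ)
      (F y : Fin 2 → ℝ) (m e₁ e₂ e₃ : ℝ), 0 ≤ e₁ →
      (∀ a b a' b', |x a' b' - x a b| ≤ e₁) →
      (∀ d a b a' b', |twoPointFlux γ g ψ d (W a b) (W a' b') - F d| ≤ e₂) →
      (∀ b, |x (Fin.last p) b - x 0 b - y 0| ≤ e₃) →
      (∀ a, |x a (Fin.last p) - x a 0 - y 1| ≤ e₃) → (∀ d, |F d| ≤ m) →
      |cellVolume γ g ψ ξ ω W x - 2 * ∑ d, F d * y d| ≤ 4 * (C * (e₁ * e₂) + m * e₃) := by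
  obtain ⟨C, hC, h⟩ := exists_line_consistency hGL
  refine ⟨C, hC, fun γ g ψ W x F y m e₁ e₂ e₃ he₁ h₁ h₂ h₃ h₃' hF => ?_⟩
  have hω := hGL.sum_weights
  have hpos := fun a => (hGL.weight_pos hp a).le
  have sumb : ∀ (S : Fin (p + 1) → ℝ) (z e : ℝ), (∀ b, |S b - z| ≤ e) →
      |∑ b, ω b * S b - 2 * z| ≤ 2 * e := by
    intro S z e hS
    rw [← hω, Finset.sum_mul, Finset.sum_mul, ← Finset.sum_sub_distrib]
    refine (Finset.abs_sum_le_sum_abs _ _).trans (Finset.sum_le_sum fun b _ => ?_)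
    rw [← mul_sub, abs_mul, abs_of_nonneg (hpos b)]
    exact mul_le_mul_of_nonneg_left (hS b) (hpos b)
  have t0 := sumb _ (F 0 * y 0) _ fun b => h (fun a => x a b)
    (fun a l => twoPointFlux γ g ψ 0 (W a b) (W l b)) (F 0) m e₁ e₂ e₃ (y 0) he₁
    (fun a l => h₁ _ _ _ _) (fun a l => h₂ _ _ _ _ _) (h₃ b) (hF 0)
  have t1 := sumb _ (F 1 * y 1) _ fun a => h (fun b => x a b)
    (fun b l => twoPointFlux γ g ψ 1 (W a b) (W a l)) (F 1) m e₁ e₂ e₃ (y 1) he₁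
    (fun a l => h₁ _ _ _ _) (fun a l => h₂ _ _ _ _ _) (h₃' a) (hF 1)
  rw [Fin.sum_univ_two, mul_add, cellVolume, add_sub_add_comm]
  refine (abs_add_le _ _).trans ?_
  linarith

/-- Error of the Gauss-Lobatto rule for the product of a slowly varying function and a
polynomial. -/
lemma exists_quadrature_error (hp : 1 ≤ p) (hGL : IsGaussLobatto p ξ ω) :
    ∃ C, 0 ≤ C ∧ ∀ (h : ℝ), 0 < h → ∀ (i j : ℕ) (w : ℝ × ℝ → ℝ)
      (v P : Fin (p + 1) → Fin (p + 1) → ℝ) (w₀ ε m : ℝ),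
      AEStronglyMeasurable w (volume.restrict (cellSet h i j)) →
      (∀ x ∈ cellSet h i j, |w x - w₀| ≤ ε) → (∀ a b, |v a b - w₀| ≤ ε) → (∀ a b, |P a b| ≤ m) →
      IntegrableOn (fun x => w x * cellPoly h ξ i j P x) (cellSet h i j) ∧
      |(∫ x in cellSet h i j, w x * cellPoly h ξ i j P x)
        - h ^ 2 / 4 * ∑ a, ∑ b, ω a * ω b * (v a b * P a b)| ≤ C * (ε * m * h ^ 2) := by
  obtain ⟨L, hL, hLeb⟩ := exists_lebesgue_bound ξ
  refine ⟨L + 1, by linarith, fun h hh i j w v P w₀ ε m hw h₁ h₂ h₃ => ?_⟩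
  have hms := measurableSet_cellSet h i j
  have hvol := volume_cellSet hh i j
  have hfin : volume (cellSet h i j) < ⊤ := by
    by_contra hne
    rw [not_lt, top_le_iff] at hne
    rw [measureReal_def, hne] at hvol
    simp at hvol
    exact (pow_pos hh 2).ne hvol
  have hε : 0 ≤ ε := (abs_nonneg _).trans (h₂ 0 0)
  have hm : 0 ≤ m := (abs_nonneg _).trans (h₃ 0 0)
  have hP : ∀ x ∈ cellSet h i j, |cellPoly h ξ i j P x| ≤ L * m := by
    intro x hx
    have := hLeb _ (refCoord_mem hh (Ioo_subset_Icc_self hx.1)) _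
      (refCoord_mem hh (Ioo_subset_Icc_self hx.2)) ℝ P m h₃
    simpa only [cellPoly, smul_eq_mul, Real.norm_eq_abs] using this
  have hcp := integrableOn_cellSet_of_continuous (continuous_cellPoly (ξ := ξ) h i j P) h i j
  have hb : ∀ x ∈ cellSet h i j, ‖(w x - w₀) * cellPoly h ξ i j P x‖ ≤ ε * (L * m) := by
    intro x hx
    rw [Real.norm_eq_abs, abs_mul]
    exact mul_le_mul (h₁ x hx) (hP x hx) (abs_nonneg _) hε
  have hint1 : IntegrableOn (fun x => (w x - w₀) * cellPoly h ξ i j P x) (cellSet h i j) := by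
    refine IntegrableOn.of_bound hfin ?_ (ε * (L * m)) ?_
    · exact (hw.sub aestronglyMeasurable_const).mul (continuous_cellPoly h i j P).aestronglyMeasurable
    · exact (ae_restrict_iff' hms).2 (ae_of_all _ hb)
  have hint2 : IntegrableOn (fun x => w₀ * cellPoly h ξ i j P x) (cellSet h i j) := hcp.const_mul w₀
  -- The product need not be polynomial, but with `w` frozen at `w₀` the rule is exact; only the
  -- oscillation of `w` is charged to the error.
  have esum : ∀ x, w x * cellPoly h ξ i j P x =
      (w x - w₀) * cellPoly h ξ i j P x + w₀ * cellPoly h ξ i j P x := fun x => by ring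
  have hint : IntegrableOn (fun x => w x * cellPoly h ξ i j P x) (cellSet h i j) := by
    simp only [esum]; exact hint1.add hint2
  refine ⟨hint, ?_⟩
  have e1 : ∫ x in cellSet h i j, w x * cellPoly h ξ i j P x =
      (∫ x in cellSet h i j, (w x - w₀) * cellPoly h ξ i j P x)
        + w₀ * (h ^ 2 / 4 * ∑ a, ∑ b, ω a * ω b * P a b) := by
    simp only [esum]
    rw [integral_add hint1 hint2, integral_const_mul, integral_cellPoly hp hGL hh]
  have e2 : ∑ a, ∑ b, ω a * ω b * (v a b * P a b) = ∑ a, ∑ b, ω a * ω b * ((v a b - w₀) * P a b)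
      + w₀ * ∑ a, ∑ b, ω a * ω b * P a b := by
    simp only [Finset.mul_sum, ← Finset.sum_add_distrib]
    exact Finset.sum_congr rfl fun a _ => Finset.sum_congr rfl fun b _ => by ring
  have b1 := norm_setIntegral_le_of_norm_le_const hfin hb
  rw [hvol, Real.norm_eq_abs] at b1
  have b2 : |∑ a, ∑ b, ω a * ω b * ((v a b - w₀) * P a b)| ≤ 4 * (ε * m) := by
    have hω := hGL.sum_weights
    have hpos := fun a => (hGL.weight_pos hp a).le
    have : (4 : ℝ) * (ε * m) = ∑ a, ∑ b, ω a * ω b * (ε * m) := by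
      simp only [← Finset.sum_mul, ← Finset.mul_sum, hω]; norm_num
    rw [this]
    refine (Finset.abs_sum_le_sum_abs _ _).trans (Finset.sum_le_sum fun a _ => ?_)
    refine (Finset.abs_sum_le_sum_abs _ _).trans (Finset.sum_le_sum fun b _ => ?_)
    rw [abs_mul, abs_of_nonneg (mul_nonneg (hpos a) (hpos b)), abs_mul]
    exact mul_le_mul_of_nonneg_left (mul_le_mul (h₂ a b) (h₃ a b) (abs_nonneg _) hε)
      (mul_nonneg (hpos a) (hpos b))
  rw [e1, e2]
  have e3 : ∀ X A B : ℝ, X + w₀ * (h ^ 2 / 4 * B) - h ^ 2 / 4 * (A + w₀ * B) = X - h ^ 2 / 4 * A := by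
    intros; ring
  rw [e3]
  refine (abs_sub _ _).trans ?_
  rw [abs_mul, abs_of_nonneg (by positivity : 0 ≤ h ^ 2 / 4)]
  have := mul_le_mul_of_nonneg_left b2 (by positivity : 0 ≤ h ^ 2 / 4)
  nlinarith

end CellTools

/-! ### Sums over the sides of a cell, and jumps. -/

section Faces

variable {p : ℕ} {ξ ω : Fin (p + 1) → ℝ} {L₁ L₂ : ℝ} {B : Set State}

lemma ext_mem (hB : ∀ d, ∀ U ∈ B, mirror d U ∈ B) (bc : BoundaryCondition) (M : Mesh L₁ L₂)
    {c : Coeffs p} (hc : ∀ i < M.N₁, ∀ j < M.N₂, ∀ a b, c i j a b ∈ B) {i j : ℕ} (hi : i < M.N₁)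
    (hj : j < M.N₂) (a : Fin (p + 1)) :
    extRight bc M c i j a ∈ B ∧ extLeft bc M c i j a ∈ B ∧ extTop bc M c i j a ∈ B ∧
      extBottom bc M c i j a ∈ B := by
  rw [extRight_eq, extLeft_eq, extTop_eq, extBottom_eq]
  exact ⟨lineExtRight_mem hB bc 0 (fun i hi b => hc i hi j hj b a) hi,
    lineExtLeft_mem hB bc 0 (fun i hi b => hc i hi j hj b a) hi,
    lineExtRight_mem hB bc 1 (fun j hj b => hc i hi j hj a b) hj,
    lineExtLeft_mem hB bc 1 (fun j hj b => hc i hi j hj a b) hj⟩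

lemma cellFaces_mono (hp : 1 ≤ p) (hGL : IsGaussLobatto p ξ ω)
    (hB : ∀ d, ∀ U ∈ B, mirror d U ∈ B) (bc : BoundaryCondition) (M : Mesh L₁ L₂)
    {c : Coeffs p} (hc : ∀ i < M.N₁, ∀ j < M.N₂, ∀ a b, c i j a b ∈ B)
    {P Q : Fin 2 → ℝ → State → State → ℝ}
    (hPQ : ∀ d sgn, sgn = 1 ∨ sgn = -1 → ∀ U ∈ B, ∀ V ∈ B, P d sgn U V ≤ Q d sgn U V)
    {x : Fin (p + 1) → Fin (p + 1) → ℝ} (hx : ∀ a b, 0 ≤ x a b) {i j : ℕ} (hi : i < M.N₁)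
    (hj : j < M.N₂) : cellFaces bc M ω c P x i j ≤ cellFaces bc M ω c Q x i j := by
  have hpos := fun a => (hGL.weight_pos hp a).le
  have he := fun a => ext_mem hB bc M hc hi hj a
  have hci := hc i hi j hj
  unfold cellFaces
  refine add_le_add (Finset.sum_le_sum fun b _ => mul_le_mul_of_nonneg_left (add_le_add
    (mul_le_mul_of_nonneg_left (hPQ _ _ (Or.inl rfl) _ (hci _ _) _ (he _).1) (hx _ _))
    (mul_le_mul_of_nonneg_left (hPQ _ _ (Or.inr rfl) _ (hci _ _) _ (he _).2.1) (hx _ _))) (hpos b))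
    (Finset.sum_le_sum fun b _ => mul_le_mul_of_nonneg_left (add_le_add
    (mul_le_mul_of_nonneg_left (hPQ _ _ (Or.inl rfl) _ (hci _ _) _ (he _).2.2.1) (hx _ _))
    (mul_le_mul_of_nonneg_left (hPQ _ _ (Or.inr rfl) _ (hci _ _) _ (he _).2.2.2) (hx _ _)))
      (hpos b))

/-- The number `8` is four sides times the total weight `2`. -/
lemma cellFaces_affine (hGL : IsGaussLobatto p ξ ω) (bc : BoundaryCondition) (M : Mesh L₁ L₂)
    (c : Coeffs p) (P : Fin 2 → ℝ → State → State → ℝ) (r s : ℝ) (i j : ℕ) :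
    cellFaces bc M ω c (fun d sgn U V => r + s * P d sgn U V) (fun _ _ => 1) i j =
      8 * r + s * cellFaces bc M ω c P (fun _ _ => 1) i j := by
  have e : ∀ (A B : Fin (p + 1) → ℝ), ∑ b, ω b * (1 * (r + s * A b) + 1 * (r + s * B b)) =
      4 * r + s * ∑ b, ω b * (1 * A b + 1 * B b) := by
    intro A B
    have h4 : 4 * r = ∑ b, ω b * (2 * r) := by
      rw [← Finset.sum_mul, hGL.sum_weights]; ring
    rw [h4, Finset.mul_sum, ← Finset.sum_add_distrib]
    exact Finset.sum_congr rfl fun b _ => by ring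
  unfold cellFaces
  rw [e, e]
  ring

/-- The size of the jumps at the sides of the cell `(i, j)`. -/
def jumpSum (bc : BoundaryCondition) (M : Mesh L₁ L₂) (ω : Fin (p + 1) → ℝ) (c : Coeffs p)
    (i j : ℕ) : ℝ := cellFaces bc M ω c (fun _ _ U V => ‖V - U‖) (fun _ _ => 1) i j

/-- The sum of the squared jumps at the sides of the cell `(i, j)`. -/
def jumpSqSum (bc : BoundaryCondition) (M : Mesh L₁ L₂) (ω : Fin (p + 1) → ℝ) (c : Coeffs p)
    (i j : ℕ) : ℝ := cellFaces bc M ω c (fun _ _ U V => ‖V - U‖ ^ 2) (fun _ _ => 1) i j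

lemma jump_le_jumpSum (hp : 1 ≤ p) (hGL : IsGaussLobatto p ξ ω) (bc : BoundaryCondition)
    (M : Mesh L₁ L₂) (c : Coeffs p) (i j : ℕ) (b : Fin (p + 1)) :
    ω b * ‖extRight bc M c i j b - c i j (Fin.last p) b‖ ≤ jumpSum bc M ω c i j ∧
    ω b * ‖extLeft bc M c i j b - c i j 0 b‖ ≤ jumpSum bc M ω c i j ∧
    ω b * ‖extTop bc M c i j b - c i j b (Fin.last p)‖ ≤ jumpSum bc M ω c i j ∧
    ω b * ‖extBottom bc M c i j b - c i j b 0‖ ≤ jumpSum bc M ω c i j := by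
  have hpos := fun a => (hGL.weight_pos hp a).le
  have key : ∀ (A A' : Fin (p + 1) → ℝ), (∀ b, 0 ≤ A b) → (∀ b, 0 ≤ A' b) →
      ω b * A b ≤ ∑ b, ω b * (1 * A b + 1 * A' b) ∧ ω b * A' b ≤ ∑ b, ω b * (1 * A b + 1 * A' b)
      := by
    intro A A' hA hA'
    have : ω b * (1 * A b + 1 * A' b) ≤ ∑ b, ω b * (1 * A b + 1 * A' b) := Finset.single_le_sum (f := fun b => ω b * (1 * A b + 1 * A' b))
      (fun b _ => mul_nonneg (hpos b) (by have := hA b; have := hA' b; linarith))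
      (Finset.mem_univ b)
    have h1 := mul_nonneg (hpos b) (hA b)
    have h2 := mul_nonneg (hpos b) (hA' b)
    constructor <;> linarith
  have k1 := key (fun b => ‖extRight bc M c i j b - c i j (Fin.last p) b‖)
    (fun b => ‖extLeft bc M c i j b - c i j 0 b‖) (fun _ => norm_nonneg _) (fun _ => norm_nonneg _)
  have k2 := key (fun b => ‖extTop bc M c i j b - c i j b (Fin.last p)‖)
    (fun b => ‖extBottom bc M c i j b - c i j b 0‖) (fun _ => norm_nonneg _) (fun _ => norm_nonneg _)
  have n1 := (mul_nonneg (hpos b) (norm_nonneg _)).trans k1.1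
  have n2 := (mul_nonneg (hpos b) (norm_nonneg _)).trans k2.1
  unfold jumpSum cellFaces
  exact ⟨by linarith [k1.1], by linarith [k1.2], by linarith [k2.1], by linarith [k2.2]⟩

lemma jumpSum_nonneg (hp : 1 ≤ p) (hGL : IsGaussLobatto p ξ ω) (bc : BoundaryCondition)
    (M : Mesh L₁ L₂) (c : Coeffs p) (i j : ℕ) : 0 ≤ jumpSum bc M ω c i j :=
  (mul_nonneg (hGL.weight_pos hp 0).le (norm_nonneg _)).trans
    (jump_le_jumpSum hp hGL bc M c i j 0).1

/-- The scale `√h` balances the two contributions: after summation over the cells with the weight `h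
^ 2`, both are of order `√h` once `h` times the sum of the squared jumps is bounded. -/
lemma young_sqrt {h y : ℝ} (hh : 0 < h) : y ≤ √h / 2 + 1 / (2 * √h) * y ^ 2 := by
  have hs : 0 < √h := Real.sqrt_pos.2 hh
  have : √h / 2 + 1 / (2 * √h) * y ^ 2 - y = (√h - y) ^ 2 / (2 * √h) := by
    field_simp
    ring
  have h2 : 0 ≤ (√h - y) ^ 2 / (2 * √h) := by positivity
  linarith

lemma jumpSum_le (hp : 1 ≤ p) (hGL : IsGaussLobatto p ξ ω) (bc : BoundaryCondition)
    (M : Mesh L₁ L₂) (c : Coeffs p) {h : ℝ} (hh : 0 < h) {i j : ℕ} (hi : i < M.N₁) (hj : j < M.N₂) :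
    jumpSum bc M ω c i j ≤ 4 * √h + 1 / (2 * √h) * jumpSqSum bc M ω c i j := by
  have := cellFaces_mono (B := univ) hp hGL (fun _ _ _ => mem_univ _) bc M (c := c)
    (fun _ _ _ _ _ _ => mem_univ _) (P := fun _ _ U V => ‖V - U‖)
    (Q := fun _ _ U V => √h / 2 + 1 / (2 * √h) * ‖V - U‖ ^ 2)
    (fun _ _ _ _ _ _ _ => young_sqrt hh) (x := fun _ _ => 1) (fun _ _ => zero_le_one) hi hj
  rw [cellFaces_affine hGL bc M c (fun _ _ U V => ‖V - U‖ ^ 2)] at this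
  unfold jumpSum jumpSqSum
  linarith

end Faces

/-! ### Bounds for states on the mesh and for their time derivative. -/

section Scheme

variable {γ : ℝ} {G : State → ℝ} {g : State → State} {ψ : Fin 2 → State → ℝ}
variable {p : ℕ} {ξ ω : Fin (p + 1) → ℝ} {T L₁ L₂ : ℝ} {B : Set State} {Cb D lamBar : ℝ}

/-- An admissible viscosity coefficient of the local Lax-Friedrichs flux. -/
structure IsViscosity (γ : ℝ) (B : Set State) (lamBar : ℝ) (lam : State → State → ℝ) : Prop where
  symm : ∀ U V, lam U V = lam V U
  ge : ∀ U V, lamMax γ U V ≤ lam U V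
  le : ∀ U ∈ B, ∀ V ∈ B, lam U V ≤ lamBar

/-- A piecewise polynomial state with values in `B` and variation of order `h` in the cells. -/
structure GridState (B : Set State) (D : ℝ) (M : Mesh L₁ L₂) (ξ : Fin (p + 1) → ℝ)
    (c : Coeffs p) : Prop where
  field_mem : ∀ x ∈ Ico 0 L₁ ×ˢ Ico 0 L₂, evalDG M ξ c x ∈ B
  nodal_mem : ∀ i < M.N₁, ∀ j < M.N₂, ∀ a b, c i j a b ∈ B
  osc : ∀ i < M.N₁, ∀ j < M.N₂, ∀ a b a' b', ‖c i j a' b' - c i j a b‖ ≤ D * M.h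

lemma lamMax_nonneg (γ : ℝ) (U V : State) : 0 ≤ lamMax γ U V :=
  le_max_of_le_left (add_nonneg (Real.sqrt_nonneg _) (Real.sqrt_nonneg _))

/-- The penalty is half the flux jump plus a viscous term, both proportional to the jump of the
states. -/
lemma abs_facePenalty_le (hb : BalanceBounds γ G g ψ B Cb) {lam : State → State → ℝ}
    (hlam : IsViscosity γ B lamBar lam) (d : Fin 2) {sgn : ℝ} (hs : sgn = 1 ∨ sgn = -1)
    {U V : State} (hU : U ∈ B) (hV : V ∈ B) (k : Fin 4) :
    |facePenalty γ lam d sgn U V k| ≤ (Cb + |lamBar|) * ‖V - U‖ := by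
  have h1 := hb.euler_lip U hU V hV d k
  have h2 : |V k - U k| ≤ ‖V - U‖ := norm_le_pi_norm (V - U) k
  have h3 := (lamMax_nonneg γ U V).trans (hlam.ge U V)
  have h4 := (hlam.le U hU V hV).trans (le_abs_self _)
  have hsgn : |sgn| = 1 := by rcases hs with h | h <;> simp [h]
  have e : facePenalty γ lam d sgn U V k =
      -(sgn / 2) * (eulerFlux γ d V k - eulerFlux γ d U k) + lam U V / 2 * (V k - U k) := by
    simp only [facePenalty, laxFriedrichs, Pi.sub_apply, Pi.smul_apply, Pi.add_apply, smul_eq_mul]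
    ring
  rw [e]
  refine (abs_add_le _ _).trans ?_
  rw [abs_mul, abs_mul, abs_neg, abs_div, hsgn, abs_two, abs_of_nonneg (by positivity : 0 ≤ lam U V / 2)]
  have h5 : lam U V / 2 * |V k - U k| ≤ |lamBar| * ‖V - U‖ :=
    mul_le_mul (by linarith) h2 (abs_nonneg _) (abs_nonneg _)
  have h6 := abs_nonneg (eulerFlux γ d V k - eulerFlux γ d U k)
  linarith

/-- Since the rows of the differentiation matrix sum to zero, the Euler flux at `U` can be
subtracted, which makes the volume term as small as the oscillation in the cell. -/
lemma abs_volume_sum_le (hξ : StrictMono ξ) (hb : BalanceBounds γ G g ψ B Cb) (d : Fin 2)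
    {U : State} {V : Fin (p + 1) → State} (hU : U ∈ B) (hV : ∀ l, V l ∈ B) {e : ℝ}
    (he : ∀ l, ‖V l - U‖ ≤ e) (a : Fin (p + 1)) (k : Fin 4) :
    |∑ l, diffMatrix ξ a l * volumeFlux γ d U (V l) k| ≤
      (∑ a, ∑ l, |diffMatrix ξ a l|) * (Cb * e) := by
  have e1 : ∑ l, diffMatrix ξ a l * volumeFlux γ d U (V l) k =
      ∑ l, diffMatrix ξ a l * (volumeFlux γ d U (V l) k - eulerFlux γ d U k) := by
    simp only [mul_sub, Finset.sum_sub_distrib, ← Finset.sum_mul, sum_diffMatrix hξ]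
    ring
  have he0 : 0 ≤ Cb * e := mul_nonneg hb.nonneg ((norm_nonneg _).trans (he 0))
  rw [e1]
  refine (Finset.abs_sum_le_sum_abs _ _).trans ?_
  refine le_trans ?_ (mul_le_mul_of_nonneg_right (Finset.single_le_sum
    (f := fun a => ∑ l, |diffMatrix ξ a l|)
    (fun a _ => Finset.sum_nonneg fun _ _ => abs_nonneg _) (Finset.mem_univ a)) he0)
  simp only [Finset.sum_mul]
  refine Finset.sum_le_sum fun l _ => ?_
  rw [abs_mul]
  exact mul_le_mul_of_nonneg_left ((hb.volume U hU (V l) (hV l) d k).trans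
    (mul_le_mul_of_nonneg_left (he l) hb.nonneg)) (abs_nonneg _)

/-- The time derivative prescribed by the scheme is controlled by the jumps. -/
lemma exists_dgRHS_bound (hp : 1 ≤ p) (hGL : IsGaussLobatto p ξ ω)
    (hB : ∀ d, ∀ U ∈ B, mirror d U ∈ B) (hb : BalanceBounds γ G g ψ B Cb) (hD : 0 ≤ D)
    (lamBar : ℝ) (bc : BoundaryCondition) :
    ∃ C, 0 ≤ C ∧ ∀ (M : Mesh L₁ L₂) (c : Coeffs p) (lam : State → State → ℝ),
      IsViscosity γ B lamBar lam → GridState B D M ξ c →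
      ∀ i < M.N₁, ∀ j < M.N₂, ∀ a b k,
        |dgRHS γ bc M ξ ω lam c i j a b k| ≤ C / M.h * (M.h + jumpSum bc M ω c i j) := by
  set S := ∑ a, ∑ l, |diffMatrix ξ a l| with hS
  set O := ∑ a, 1 / ω a with hO
  have hS0 : 0 ≤ S := Finset.sum_nonneg fun _ _ => Finset.sum_nonneg fun _ _ => abs_nonneg _
  have hpos := hGL.weight_pos hp
  have hO1 : ∀ a, 1 / ω a ≤ O := fun a => Finset.single_le_sum (f := fun a => 1 / ω a)
    (fun a _ => (one_div_pos.2 (hpos a)).le) (Finset.mem_univ a)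
  have hO0 : 0 ≤ O := (one_div_pos.2 (hpos 0)).le.trans (hO1 0)
  have hC0 := hb.nonneg
  refine ⟨2 * (4 * S * (Cb * D) + 4 * (O * ((Cb + |lamBar|) * O))), by positivity,
    fun M c lam hlam hc i hi j hj a b k => ?_⟩
  have hh := M.h_pos
  set J := jumpSum bc M ω c i j with hJ
  have hJ0 : 0 ≤ J := jumpSum_nonneg hp hGL bc M c i j
  have hn := hc.nodal_mem i hi j hj
  have v0 := abs_volume_sum_le hGL.strictMono hb 0 (hn a b) (fun l => hn l b)
    (fun l => hc.osc i hi j hj a b l b) a k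
  have v1 := abs_volume_sum_le hGL.strictMono hb 1 (hn a b) (fun l => hn a l)
    (fun l => hc.osc i hi j hj a b a l) b k
  have hjump := fun b => jump_le_jumpSum hp hGL bc M c i j b
  have hext := fun b => ext_mem hB bc M hc.nodal_mem hi hj b
  -- `a'` is the index across the face, whose weight divides the penalty; `b'` is the index along
  -- the face, whose weight accompanies the jump in `jumpSum`. Both reciprocals are bounded by `O`.
  have face : ∀ (Q : Prop) [Decidable Q] (a' b' : Fin (p + 1)) (d : Fin 2) (sgn : ℝ) (V : State),
      sgn = 1 ∨ sgn = -1 → V ∈ B → (Q → ω b' * ‖V - c i j a b‖ ≤ J) →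
      |(if Q then (1 / ω a') • facePenalty γ lam d sgn (c i j a b) V else 0) k| ≤
        O * ((Cb + |lamBar|) * O) * J := by
    intro Q _ a' b' d sgn V hs hV hQ
    split_ifs with h
    · have f1 := abs_facePenalty_le hb hlam d hs (hn a b) hV k
      have f2 : ‖V - c i j a b‖ ≤ O * J := by
        have : ‖V - c i j a b‖ ≤ 1 / ω b' * J := by
          rw [one_div, ← div_eq_inv_mul, le_div_iff₀' (hpos b')]; exact hQ h
        exact this.trans (mul_le_mul_of_nonneg_right (hO1 b') hJ0)
      rw [Pi.smul_apply, smul_eq_mul, abs_mul, abs_of_pos (one_div_pos.2 (hpos a'))]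
      have f3 : |facePenalty γ lam d sgn (c i j a b) V k| ≤ (Cb + |lamBar|) * (O * J) :=
        f1.trans (mul_le_mul_of_nonneg_left f2 (by positivity))
      calc _ ≤ O * ((Cb + |lamBar|) * (O * J)) :=
            mul_le_mul (hO1 a') f3 (abs_nonneg _) hO0
        _ = _ := by ring
    · simp only [Pi.zero_apply, abs_zero]; positivity
  have f1 := face (a = Fin.last p) a b 0 1 _ (Or.inl rfl) (hext b).1
    (fun h => by subst h; exact (hjump b).1)
  have f2 := face (a = 0) a b 0 (-1) _ (Or.inr rfl) (hext b).2.1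
    (fun h => by subst h; exact (hjump b).2.1)
  have f3 := face (b = Fin.last p) b a 1 1 _ (Or.inl rfl) (hext a).2.2.1
    (fun h => by subst h; exact (hjump a).2.2.1)
  have f4 := face (b = 0) b a 1 (-1) _ (Or.inr rfl) (hext a).2.2.2
    (fun h => by subst h; exact (hjump a).2.2.2)
  set X := O * ((Cb + |lamBar|) * O) with hX
  have hX0 : 0 ≤ X := by positivity
  rw [abs_le] at v0 v1 f1 f2 f3 f4
  have main : |-(2 * (∑ l, diffMatrix ξ a l * volumeFlux γ 0 (c i j a b) (c i j l b) k
      + ∑ l, diffMatrix ξ b l * volumeFlux γ 1 (c i j a b) (c i j a l) k))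
      + (if a = Fin.last p then
          (1 / ω a) • facePenalty γ lam 0 1 (c i j a b) (extRight bc M c i j b) else 0) k
      + (if a = 0 then
          (1 / ω a) • facePenalty γ lam 0 (-1) (c i j a b) (extLeft bc M c i j b) else 0) k
      + (if b = Fin.last p then
          (1 / ω b) • facePenalty γ lam 1 1 (c i j a b) (extTop bc M c i j a) else 0) k
      + (if b = 0 then
          (1 / ω b) • facePenalty γ lam 1 (-1) (c i j a b) (extBottom bc M c i j a) else 0) k|
      ≤ 4 * S * (Cb * D) * M.h + 4 * X * J := by
    rw [abs_le]
    constructor <;> linarith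
  have e : dgRHS γ bc M ξ ω lam c i j a b k = 2 / M.h *
      (-(2 * (∑ l, diffMatrix ξ a l * volumeFlux γ 0 (c i j a b) (c i j l b) k
      + ∑ l, diffMatrix ξ b l * volumeFlux γ 1 (c i j a b) (c i j a l) k))
      + (if a = Fin.last p then
          (1 / ω a) • facePenalty γ lam 0 1 (c i j a b) (extRight bc M c i j b) else 0) k
      + (if a = 0 then
          (1 / ω a) • facePenalty γ lam 0 (-1) (c i j a b) (extLeft bc M c i j b) else 0) k
      + (if b = Fin.last p then
          (1 / ω b) • facePenalty γ lam 1 1 (c i j a b) (extTop bc M c i j a) else 0) k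
      + (if b = 0 then
          (1 / ω b) • facePenalty γ lam 1 (-1) (c i j a b) (extBottom bc M c i j a) else 0) k) := by
    simp only [dgRHS, Pi.smul_apply, Pi.add_apply, Pi.neg_apply, Finset.sum_apply, smul_eq_mul,
      Finset.sum_add_distrib]
  rw [e, abs_mul, abs_of_pos (by positivity : 0 < 2 / M.h)]
  refine (mul_le_mul_of_nonneg_left main (by positivity)).trans ?_
  have : 2 * (4 * S * (Cb * D) + 4 * X) / M.h * (M.h + J) -
      2 / M.h * (4 * S * (Cb * D) * M.h + 4 * X * J) =
      2 / M.h * (4 * S * (Cb * D) * J + 4 * X * M.h) := by ring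
  have h2 : 0 ≤ 2 / M.h * (4 * S * (Cb * D) * J + 4 * X * M.h) := by positivity
  linarith

/-- The tensor product basis sums to one, so the difference interpolates the differences of nodal
values, and interpolation is stable on the cell. -/
lemma GridState.norm_nodal_sub_le (hGL : IsGaussLobatto p ξ ω) :
    ∃ C, 0 ≤ C ∧ ∀ (B : Set State) (D : ℝ) (M : Mesh L₁ L₂) (c : Coeffs p), 0 ≤ D →
      GridState B D M ξ c → ∀ i < M.N₁, ∀ j < M.N₂, ∀ x ∈ cellSet M.h i j, ∀ a b,
        ‖evalDG M ξ c x - c i j a b‖ ≤ C * (D * M.h) := by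
  obtain ⟨L, hL, hLeb⟩ := exists_lebesgue_bound ξ
  refine ⟨L, by linarith, fun B D M c hD hc i hi j hj x hx a b => ?_⟩
  have hx1 := Ioo_subset_Ico_self hx.1
  have hx2 := Ioo_subset_Ico_self hx.2
  have := hLeb _ (refCoord_mem M.h_pos (Ioo_subset_Icc_self hx.1)) _
    (refCoord_mem M.h_pos (Ioo_subset_Icc_self hx.2)) State (fun a' b' => c i j a' b' - c i j a b)
    (D * M.h) (fun a' b' => hc.osc i hi j hj a b a' b')
  simp only [smul_sub, Finset.sum_sub_distrib, ← Finset.sum_smul] at this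
  rw [sum_lagrange_mul hGL.strictMono, one_smul] at this
  rwa [evalDG_eq_of_mem_Ico M c hx1 hx2]

end Scheme

/-! ### Consistency of the tested scheme with the weak form, cell by cell. -/

section CellConsistency

variable {γ : ℝ} {G : State → ℝ} {g : State → State} {ψ : Fin 2 → State → ℝ}
variable {p k : ℕ} {ξ ω : Fin (p + 1) → ℝ} {T L₁ L₂ : ℝ} {B : Set State} {Cb D Cφ : ℝ}
variable {φ : ℝ → ℝ × ℝ → ℝ}

/-- The nodal values of a test function. -/
def testNodes (φ : ℝ → ℝ × ℝ → ℝ) (t : ℝ) (M : Mesh L₁ L₂) (ξ : Fin (p + 1) → ℝ) (i j : ℕ)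
    (a b : Fin (p + 1)) : ℝ := φ t (nodeCoord M.h ξ i a, nodeCoord M.h ξ j b)

lemma norm_sub_le_of_mem_cell {h : ℝ} {i j : ℕ} {x y : ℝ × ℝ}
    (hx₁ : x.1 ∈ Icc (i * h) ((i + 1) * h)) (hx₂ : x.2 ∈ Icc (j * h) ((j + 1) * h))
    (hy₁ : y.1 ∈ Icc (i * h) ((i + 1) * h)) (hy₂ : y.2 ∈ Icc (j * h) ((j + 1) * h)) :
    ‖x - y‖ ≤ h := by
  rw [Prod.norm_def, Prod.fst_sub, Prod.snd_sub, Real.norm_eq_abs, Real.norm_eq_abs]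
  refine max_le (abs_le.2 ?_) (abs_le.2 ?_)
  · constructor <;> linarith [hx₁.1, hx₁.2, hy₁.1, hy₁.2]
  · constructor <;> linarith [hx₂.1, hx₂.2, hy₂.1, hy₂.2]

lemma node_mem_rect (hGL : IsGaussLobatto p ξ ω) (M : Mesh L₁ L₂) {i j : ℕ} (hi : i < M.N₁)
    (hj : j < M.N₂) (a b : Fin (p + 1)) :
    (nodeCoord M.h ξ i a, nodeCoord M.h ξ j b) ∈ rect L₁ L₂ :=
  ⟨nodeCoord_mem_Icc hGL M.h_pos M.length₁ hi a, nodeCoord_mem_Icc hGL M.h_pos M.length₂ hj b⟩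

lemma Ioo_prod_subset_rect : (Ioo 0 L₁ ×ˢ Ioo 0 L₂ : Set (ℝ × ℝ)) ⊆ rect L₁ L₂ :=
  prod_mono Ioo_subset_Icc_self Ioo_subset_Icc_self

lemma Ioo_prod_subset_Ico : (Ioo 0 L₁ ×ˢ Ioo 0 L₂ : Set (ℝ × ℝ)) ⊆ Ico 0 L₁ ×ˢ Ico 0 L₂ :=
  prod_mono Ioo_subset_Ico_self Ioo_subset_Ico_self

lemma volume_cellSet_lt_top (h : ℝ) (i j : ℕ) : volume (cellSet h i j) < ⊤ := by
  unfold cellSet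
  rw [Measure.volume_eq_prod, Measure.prod_prod, Real.volume_Ioo, Real.volume_Ioo]
  exact ENNReal.mul_lt_top ENNReal.ofReal_lt_top ENNReal.ofReal_lt_top

lemma IsSmoothTest.continuousOn_slice (hφ : IsSmoothTest (k + 1) T L₁ L₂ φ) {t : ℝ}
    (ht : t ∈ Icc 0 T) : ContinuousOn (φ t) (rect L₁ L₂) :=
  hφ.continuousOn.comp (f := fun x : ℝ × ℝ => (t, x)) (by fun_prop) fun _ hx => ⟨ht, hx⟩

lemma IsSmoothTest.continuousOn_dx_slice (hφ : IsSmoothTest (k + 1) T L₁ L₂ φ) (hT : 0 < T)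
    (h₁ : 0 < L₁) (h₂ : 0 < L₂) (d : Fin 2) {t : ℝ} (ht : t ∈ Ioo 0 T) :
    ContinuousOn (dx d φ t) (Ioo 0 L₁ ×ˢ Ioo 0 L₂) :=
  (hφ.continuousOn_dx hT h₁ h₂ d).comp (f := fun x : ℝ × ℝ => (t, x)) (by fun_prop)
    fun _ hx => ⟨ht, hx⟩

lemma IsSmoothTest.continuousOn_dt_slice (hφ : IsSmoothTest (k + 1) T L₁ L₂ φ) (hT : 0 < T)
    (h₁ : 0 < L₁) (h₂ : 0 < L₂) {t : ℝ} (ht : t ∈ Ioo 0 T) :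
    ContinuousOn (dt φ t) (Ioo 0 L₁ ×ˢ Ioo 0 L₂) :=
  (hφ.continuousOn_dt hT h₁ h₂).comp (f := fun x : ℝ × ℝ => (t, x)) (by fun_prop)
    fun _ hx => ⟨ht, hx⟩

/-- At every point of the cell the volume term is `2 h F · ∇φ` up to `O(h²)`: increments of `φ` and
deviations of the flux are each `O(h)`, and the Taylor remainder is `O(h²)`. Division by `2 h` and
integration over the area `h²` give the third power. -/
lemma exists_volume_consistency (hp : 1 ≤ p) (hGL : IsGaussLobatto p ξ ω)
    (hl : IsBalanceLaw γ G g ψ) (hb : BalanceBounds γ G g ψ B Cb) (hD : 0 ≤ D)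
    (hφ : IsSmoothTest (k + 1) T L₁ L₂ φ) (hφb : TestBounds T L₁ L₂ φ Cφ) (hT : 0 < T)
    (h₁ : 0 < L₁) (h₂ : 0 < L₂) :
    ∃ C, 0 ≤ C ∧ ∀ (M : Mesh L₁ L₂) (c : Coeffs p), GridState B D M ξ c → ∀ t ∈ Ioo 0 T,
      ∀ i < M.N₁, ∀ j < M.N₂,
      IntegrableOn (fun x => ∑ d, balanceFlux γ g ψ d (evalDG M ξ c x) * dx d φ t x)
        (cellSet M.h i j) ∧
      |M.h / 2 * cellVolume γ g ψ ξ ω (c i j) (testNodes φ t M ξ i j)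
        - ∫ x in cellSet M.h i j, ∑ d, balanceFlux γ g ψ d (evalDG M ξ c x) * dx d φ t x| ≤
        C * M.h ^ 3 := by
  obtain ⟨C, hC, hvol⟩ := exists_cellVolume_consistency hp hGL
  obtain ⟨L, hL, hLeb⟩ := GridState.norm_nodal_sub_le hGL
  have hb0 := hb.nonneg
  have hφ0 := hφb.nonneg
  refine ⟨2 * (C * (Cφ * (Cb * D + Cb * (L * D))) + Cb * Cφ), by positivity,
    fun M c hc t ht i hi j hj => ?_⟩
  have hh := M.h_pos
  have htc := Ioo_subset_Icc_self ht
  have hsub := cellSet_subset M hi hj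
  have hms := measurableSet_cellSet M.h i j
  have hfin := volume_cellSet_lt_top M.h i j
  have hmem : ∀ x ∈ cellSet M.h i j, evalDG M ξ c x ∈ B := fun x hx =>
    hc.field_mem x (Ioo_prod_subset_Ico (hsub hx))
  set Fd : ℝ × ℝ → ℝ := fun x => ∑ d, balanceFlux γ g ψ d (evalDG M ξ c x) * dx d φ t x with hFd
  have hint : IntegrableOn Fd (cellSet M.h i j) := by
    refine IntegrableOn.of_bound hfin ?_ (∑ _d : Fin 2, Cb * Cφ) ?_
    · refine Finset.aestronglyMeasurable_fun_sum _ fun d _ => ?_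
      refine (((hl.measurable_flux d).comp (measurable_evalDG M c)).aestronglyMeasurable).mul ?_
      exact ((hφ.continuousOn_dx_slice hT h₁ h₂ d ht).mono hsub).aestronglyMeasurable hms
    · refine (ae_restrict_iff' hms).2 (ae_of_all _ fun x hx => ?_)
      rw [Real.norm_eq_abs]
      refine (Finset.abs_sum_le_sum_abs _ _).trans (Finset.sum_le_sum fun d _ => ?_)
      rw [abs_mul]
      exact mul_le_mul (hb.flux_le _ (hmem x hx) d) (hφb.dx_le t ht x (hsub hx) d) (abs_nonneg _) hb0
  refine ⟨hint, ?_⟩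
  have hnode := fun a => nodeCoord_mem hGL hh i a
  have hnode' := fun b => nodeCoord_mem hGL hh j b
  have hnr := fun a b => node_mem_rect hGL M hi hj a b
  have hpt : ∀ z ∈ cellSet M.h i j,
      |cellVolume γ g ψ ξ ω (c i j) (testNodes φ t M ξ i j) / (2 * M.h) - Fd z| ≤
        2 * (C * (Cφ * (Cb * D + Cb * (L * D))) + Cb * Cφ) * M.h := by
    intro z hz
    have hz1 := Ioo_subset_Icc_self hz.1
    have hz2 := Ioo_subset_Icc_self hz.2
    have key := hvol γ g ψ (c i j) (testNodes φ t M ξ i j)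
      (fun d => balanceFlux γ g ψ d (evalDG M ξ c z)) (fun d => M.h * dx d φ t z) Cb
      (Cφ * M.h) ((Cb * D + Cb * (L * D)) * M.h) (Cφ * M.h ^ 2) (by positivity) ?_ ?_ ?_ ?_ ?_
    · have e : cellVolume γ g ψ ξ ω (c i j) (testNodes φ t M ξ i j) / (2 * M.h) - Fd z =
          1 / (2 * M.h) * (cellVolume γ g ψ ξ ω (c i j) (testNodes φ t M ξ i j)
            - 2 * ∑ d, balanceFlux γ g ψ d (evalDG M ξ c z) * (M.h * dx d φ t z)) := by
        have : ∑ d, balanceFlux γ g ψ d (evalDG M ξ c z) * (M.h * dx d φ t z) = M.h * Fd z := by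
          rw [hFd, Finset.mul_sum]
          exact Finset.sum_congr rfl fun d _ => by ring
        rw [this]
        field_simp
      rw [e, abs_mul, abs_of_pos (by positivity : 0 < 1 / (2 * M.h))]
      refine (mul_le_mul_of_nonneg_left key (by positivity)).trans (le_of_eq ?_)
      field_simp
      ring
    · intro a b a' b'
      refine (hφb.lipschitz t htc _ (hnr a b) _ (hnr a' b')).trans ?_
      exact mul_le_mul_of_nonneg_left (norm_sub_le_of_mem_cell (hnode a') (hnode' b') (hnode a)
        (hnode' b)) hφ0
    · intro d a b a' b'
      have t1 := hb.twoPoint _ (hc.nodal_mem i hi j hj a b) _ (hc.nodal_mem i hi j hj a' b') d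
      have t2 := hb.flux_lip _ (hc.nodal_mem i hi j hj a b) _ (hmem z hz) d
      rw [abs_sub_comm] at t2
      have t3 := mul_le_mul_of_nonneg_left (hc.osc i hi j hj a b a' b') hb0
      have t4 := mul_le_mul_of_nonneg_left (hLeb B D M c hD hc i hi j hj z hz a b) hb0
      have := abs_sub_le (twoPointFlux γ g ψ d (c i j a b) (c i j a' b'))
        (balanceFlux γ g ψ d (c i j a b)) (balanceFlux γ g ψ d (evalDG M ξ c z))
      linarith
    · intro b
      have e0 : ((nodeCoord M.h ξ i 0, nodeCoord M.h ξ j b) : ℝ × ℝ) + M.h • unitVec 0 =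
          (nodeCoord M.h ξ i (Fin.last p), nodeCoord M.h ξ j b) := by
        rw [nodeCoord_last hGL, nodeCoord_zero hGL]
        ext <;> simp [unitVec]; ring
      have := hφb.taylor t ht z (hsub hz) 0 M.h hh.le _ (hnr 0 b) (by rw [e0]; exact hnr _ _)
        (norm_sub_le_of_mem_cell (hnode _) (hnode' _) hz1 hz2)
        (by rw [e0]; exact norm_sub_le_of_mem_cell (hnode _) (hnode' _) hz1 hz2)
      rwa [e0] at this
    · intro a
      have e0 : ((nodeCoord M.h ξ i a, nodeCoord M.h ξ j 0) : ℝ × ℝ) + M.h • unitVec 1 =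
          (nodeCoord M.h ξ i a, nodeCoord M.h ξ j (Fin.last p)) := by
        rw [nodeCoord_last hGL, nodeCoord_zero hGL]
        ext <;> simp [unitVec]; ring
      have := hφb.taylor t ht z (hsub hz) 1 M.h hh.le _ (hnr a 0) (by rw [e0]; exact hnr _ _)
        (norm_sub_le_of_mem_cell (hnode _) (hnode' _) hz1 hz2)
        (by rw [e0]; exact norm_sub_le_of_mem_cell (hnode _) (hnode' _) hz1 hz2)
      rwa [e0] at this
    · intro d
      exact hb.flux_le _ (hmem z hz) d
  have hb1 := norm_setIntegral_le_of_norm_le_const (f := fun z =>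
    cellVolume γ g ψ ξ ω (c i j) (testNodes φ t M ξ i j) / (2 * M.h) - Fd z) hfin hpt
  have hconst : IntegrableOn (fun _ : ℝ × ℝ => cellVolume γ g ψ ξ ω (c i j)
      (testNodes φ t M ξ i j) / (2 * M.h)) (cellSet M.h i j) := integrableOn_const hfin.ne
  rw [integral_sub hconst hint, setIntegral_const, volume_cellSet hh,
    Real.norm_eq_abs, smul_eq_mul] at hb1
  have e1 : M.h ^ 2 * (cellVolume γ g ψ ξ ω (c i j) (testNodes φ t M ξ i j) / (2 * M.h)) =
      M.h / 2 * cellVolume γ g ψ ξ ω (c i j) (testNodes φ t M ξ i j) := by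
    field_simp
  rw [e1] at hb1
  refine hb1.trans (le_of_eq (by ring))

lemma abs_mul_sub_mul_le {x x₀ y y₀ e e' m m' : ℝ} (hx : |x - x₀| ≤ e) (hy : |y - y₀| ≤ e')
    (hy' : |y| ≤ m) (hx' : |x₀| ≤ m') : |x * y - x₀ * y₀| ≤ e * m + m' * e' := by
  have : x * y - x₀ * y₀ = (x - x₀) * y + x₀ * (y - y₀) := by ring
  rw [this]
  refine (abs_add_le _ _).trans ?_
  rw [abs_mul, abs_mul]
  exact add_le_add (mul_le_mul hx hy' (abs_nonneg _) ((abs_nonneg _).trans hx))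
    (mul_le_mul hx' hy (abs_nonneg _) ((abs_nonneg _).trans hx'))

/-- The quadrature error is applied to each component, with the slowly varying factor `g(U) φ` and
the polynomial factor `R`. The bound `m` of `R` stays explicit because the time derivative of the
scheme is not bounded uniformly in the mesh. -/
lemma exists_rate_consistency (hp : 1 ≤ p) (hGL : IsGaussLobatto p ξ ω)
    (hl : IsBalanceLaw γ G g ψ) (hb : BalanceBounds γ G g ψ B Cb) (hD : 0 ≤ D)
    (hφ : IsSmoothTest (k + 1) T L₁ L₂ φ) (hφb : TestBounds T L₁ L₂ φ Cφ) :
    ∃ C, 0 ≤ C ∧ ∀ (M : Mesh L₁ L₂) (c : Coeffs p), GridState B D M ξ c → ∀ t ∈ Icc 0 T,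
      ∀ i < M.N₁, ∀ j < M.N₂, ∀ (R : Coeffs p) (m : ℝ), (∀ a b k, |R i j a b k| ≤ m) →
      IntegrableOn (fun x => dotProduct (g (evalDG M ξ c x)) (evalDG M ξ R x) * φ t x)
        (cellSet M.h i j) ∧
      |(∫ x in cellSet M.h i j, dotProduct (g (evalDG M ξ c x)) (evalDG M ξ R x) * φ t x)
        - M.h ^ 2 / 4 * ∑ a, ∑ b, ω a * ω b *
          (testNodes φ t M ξ i j a b * dotProduct (g (c i j a b)) (R i j a b))| ≤
        C * (M.h ^ 3 * m) := by
  obtain ⟨C, hC, hq⟩ := exists_quadrature_error hp hGL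
  obtain ⟨L, hL, hLeb⟩ := GridState.norm_nodal_sub_le hGL
  have hb0 := hb.nonneg
  have hφ0 := hφb.nonneg
  refine ⟨4 * C * (Cb * (L * D + D) * Cφ + Cb * Cφ), by positivity,
    fun M c hc t ht i hi j hj R m hR => ?_⟩
  have hh := M.h_pos
  have hsub := cellSet_subset M hi hj
  have hsubr := hsub.trans Ioo_prod_subset_rect
  have hms := measurableSet_cellSet M.h i j
  have hmem : ∀ x ∈ cellSet M.h i j, evalDG M ξ c x ∈ B := fun x hx =>
    hc.field_mem x (Ioo_prod_subset_Ico (hsub hx))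
  have hn := hc.nodal_mem i hi j hj
  have hnode := fun a => nodeCoord_mem hGL hh i a
  have hnode' := fun b => nodeCoord_mem hGL hh j b
  have hnr := fun a b => node_mem_rect hGL M hi hj a b
  -- One bound for two deviations from the value at the first node: inside the cell (`L * D`) and at
  -- the other nodes (`D`), besides the variation of `φ`.
  set ε := (Cb * (L * D + D) * Cφ + Cb * Cφ) * M.h with hε
  have hk : ∀ k, IntegrableOn (fun x => g (evalDG M ξ c x) k * φ t x *
        cellPoly M.h ξ i j (fun a b => R i j a b k) x) (cellSet M.h i j) ∧
      |(∫ x in cellSet M.h i j, g (evalDG M ξ c x) k * φ t x *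
          cellPoly M.h ξ i j (fun a b => R i j a b k) x) - M.h ^ 2 / 4 * ∑ a, ∑ b, ω a * ω b *
        (g (c i j a b) k * testNodes φ t M ξ i j a b * R i j a b k)| ≤ C * (ε * m * M.h ^ 2) :=
    fun k => hq M.h hh i j (fun x => g (evalDG M ξ c x) k * φ t x)
    (fun a b => g (c i j a b) k * testNodes φ t M ξ i j a b) (fun a b => R i j a b k)
    (g (c i j 0 0) k * testNodes φ t M ξ i j 0 0) ε m
    ((((hl.measurable_multiplier k).comp (measurable_evalDG M c)).aestronglyMeasurable).mul
      (((hφ.continuousOn_slice ht).mono hsubr).aestronglyMeasurable hms))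
    (fun x hx => by
      have := abs_mul_sub_mul_le
        ((hb.multiplier_lip _ (hn 0 0) _ (hmem x hx) k).trans
          (mul_le_mul_of_nonneg_left (hLeb B D M c hD hc i hi j hj x hx 0 0) hb0))
        ((hφb.lipschitz t ht _ (hnr 0 0) _ (hsubr hx)).trans (mul_le_mul_of_nonneg_left
          (norm_sub_le_of_mem_cell (Ioo_subset_Icc_self hx.1) (Ioo_subset_Icc_self hx.2)
            (hnode 0) (hnode' 0)) hφ0))
        (hφb.abs_le t ht _ (hsubr hx)) (hb.multiplier_le _ (hn 0 0) k)
      refine this.trans ?_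
      have h1 : 0 ≤ Cb * D * Cφ * M.h := by positivity
      rw [hε]
      nlinarith)
    (fun a b => by
      have := abs_mul_sub_mul_le
        ((hb.multiplier_lip _ (hn 0 0) _ (hn a b) k).trans
          (mul_le_mul_of_nonneg_left (hc.osc i hi j hj 0 0 a b) hb0))
        ((hφb.lipschitz t ht _ (hnr 0 0) _ (hnr a b)).trans (mul_le_mul_of_nonneg_left
          (norm_sub_le_of_mem_cell (hnode a) (hnode' b) (hnode 0) (hnode' 0)) hφ0))
        (hφb.abs_le t ht _ (hnr a b)) (hb.multiplier_le _ (hn 0 0) k)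
      refine this.trans ?_
      have h1 : 0 ≤ Cb * (L * D) * Cφ * M.h := by positivity
      rw [hε]
      nlinarith)
    (fun a b => hR a b k)
  have heq : EqOn (fun x => dotProduct (g (evalDG M ξ c x)) (evalDG M ξ R x) * φ t x)
      (fun x => ∑ k, g (evalDG M ξ c x) k * φ t x * cellPoly M.h ξ i j (fun a b => R i j a b k) x)
      (cellSet M.h i j) := by
    intro x hx
    simp only [dotProduct, Finset.sum_mul]
    refine Finset.sum_congr rfl fun k _ => ?_
    rw [evalDG_apply M R hx k]
    ring
  have hint : IntegrableOn (fun x => ∑ k, g (evalDG M ξ c x) k * φ t x *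
      cellPoly M.h ξ i j (fun a b => R i j a b k) x) (cellSet M.h i j) :=
    integrable_finsetSum _ fun k _ => (hk k).1
  refine ⟨hint.congr_fun heq.symm hms, ?_⟩
  rw [setIntegral_congr_fun hms heq, integral_finsetSum _ fun k _ => (hk k).1]
  have e : M.h ^ 2 / 4 * ∑ a, ∑ b, ω a * ω b *
      (testNodes φ t M ξ i j a b * dotProduct (g (c i j a b)) (R i j a b)) =
      ∑ k, M.h ^ 2 / 4 * ∑ a, ∑ b, ω a * ω b *
        (g (c i j a b) k * testNodes φ t M ξ i j a b * R i j a b k) := by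
    simp only [dotProduct, Finset.mul_sum]
    symm
    rw [Finset.sum_comm]
    refine Finset.sum_congr rfl fun a _ => ?_
    rw [Finset.sum_comm]
    exact Finset.sum_congr rfl fun b _ => Finset.sum_congr rfl fun k _ => by ring
  rw [e, ← Finset.sum_sub_distrib]
  refine (Finset.abs_sum_le_sum_abs _ _).trans ((Finset.sum_le_sum fun k _ => (hk k).2).trans ?_)
  rw [Finset.sum_const, Finset.card_univ, Fintype.card_fin, hε, nsmul_eq_mul]
  refine le_of_eq ?_
  push_cast
  ring

lemma integrableOn_rect_of_cells (M : Mesh L₁ L₂) {f : ℝ × ℝ → ℝ}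
    (hf : ∀ i < M.N₁, ∀ j < M.N₂, IntegrableOn f (cellSet M.h i j)) :
    IntegrableOn f (rect L₁ L₂) := by
  have hh := M.h_pos
  have h1 : IntegrableOn f (⋃ q ∈ Finset.range M.N₁ ×ˢ Finset.range M.N₂,
      (Ico ((q.1 : ℝ) * M.h) ((q.1 + 1) * M.h) ×ˢ Ico ((q.2 : ℝ) * M.h) ((q.2 + 1) * M.h) :
        Set (ℝ × ℝ))) := by
    rw [integrableOn_finset_iUnion]
    intro q hq
    rw [Finset.mem_product, Finset.mem_range, Finset.mem_range] at hq
    exact (hf _ hq.1 _ hq.2).congr_set_ae (cellSet_ae_eq_Ico M.h q.1 q.2)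
  refine IntegrableOn.congr_set_ae (h1.mono_set fun x hx => ?_) (rect_ae_eq_Ico L₁ L₂)
  obtain ⟨a1, a2⟩ := exists_cell_of_mem hh M.length₁ hx.1
  obtain ⟨a3, a4⟩ := exists_cell_of_mem hh M.length₂ hx.2
  simp only [mem_iUnion, Finset.mem_product, Finset.mem_range, exists_prop, Prod.exists]
  exact ⟨_, _, ⟨a1, a3⟩, a2, a4⟩

end CellConsistency

/-! ### Compatibility of test functions with the boundary conditions. -/

section Boundary

variable {γ : ℝ} {g : State → State} {ψ : Fin 2 → State → ℝ}
variable {p : ℕ} {ξ ω : Fin (p + 1) → ℝ} {T L₁ L₂ : ℝ} {φ : ℝ → ℝ × ℝ → ℝ}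

/-- At a wall with normal in the direction `d` the production on the inner side is half the
production of the face. -/
def WallNeutral (γ : ℝ) (g : State → State) (ψ : Fin 2 → State → ℝ) (d : Fin 2) : Prop :=
  ∀ (lam sgn : ℝ) (U : State), 2 * sidedProduction γ lam g ψ d sgn U (mirror d U)
    - faceProduction γ lam g ψ d sgn U (mirror d U) = 0

/-- The test function matches the boundary conditions of the balance law. -/
def FitsBoundary (bc : BoundaryCondition) (γ : ℝ) (g : State → State) (ψ : Fin 2 → State → ℝ)
    (T L₁ L₂ : ℝ) (φ : ℝ → ℝ × ℝ → ℝ) : Prop :=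
  match bc with
  | .periodic => IsPeriodicTest T L₁ L₂ φ
  | .noFlux =>
    (WallNeutral γ g ψ 0 ∨ ∀ t ∈ Icc 0 T, ∀ y ∈ Icc 0 L₂, φ t (0, y) = 0 ∧ φ t (L₁, y) = 0) ∧
    (WallNeutral γ g ψ 1 ∨ ∀ t ∈ Icc 0 T, ∀ x ∈ Icc 0 L₁, φ t (x, 0) = 0 ∧ φ t (x, L₂) = 0)

lemma faceProduction_coord (lam : ℝ) (k : Fin 4) (d : Fin 2) (sgn : ℝ) (U V : State) :
    faceProduction γ lam (fun _ => Pi.single k 1) (fun _ _ => 0) d sgn U V = 0 := by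
  simp [faceProduction]

/-- The numerical flux towards the mirror state vanishes in every component except the normal
momentum, whose index is `d + 1`. -/
lemma wallNeutral_coord {k : Fin 4} {d : Fin 2} (hk : (k : ℕ) ≠ d + 1) :
    WallNeutral γ (fun _ => Pi.single k 1) (fun _ _ => 0) d := by
  intro lam sgn U
  rw [faceProduction_coord]
  simp [sidedProduction, single_dotProduct, laxFriedrichs_mirror γ lam d sgn U k hk]

lemma wallNeutral_entropy (d : Fin 2) : WallNeutral γ (entropyVars γ) entropyPotential d := by
  intro lam sgn U
  rw [← faceProduction_entropy_mirror]
  simp [sidedProduction]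

/-- Neighbouring cells share the coordinate of their common node, so inner matching is automatic. At
a wall either the balance law is neutral or the test function vanishes. -/
lemma lineCompatible_of_continuous (hGL : IsGaussLobatto p ξ ω) {bc : BoundaryCondition}
    {lam : State → State → ℝ} {d : Fin 2} {N : ℕ} (hN : 0 < N) {h L : ℝ} (hL : N * h = L)
    (f : ℝ → ℝ) (hper : bc = .periodic → f 0 = f L)
    (hwall : bc = .noFlux → WallNeutral γ g ψ d ∨ (f 0 = 0 ∧ f L = 0)) :
    LineCompatible bc γ lam g ψ d N (fun i a => f (nodeCoord h ξ i a)) := by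
  have e0 : nodeCoord h ξ 0 0 = 0 := by rw [nodeCoord_zero hGL]; simp
  have e1 : nodeCoord h ξ (N - 1) (Fin.last p) = L := by
    rw [nodeCoord_last hGL, ← hL]
    congr 1
    rw [Nat.cast_sub hN]
    simp
  refine ⟨fun i hi => ?_, fun hbc => ?_, fun hbc U => ?_, fun hbc U => ?_⟩
  · rw [nodeCoord_last hGL, nodeCoord_zero hGL]
    push_cast
    rfl
  · rw [e0, e1, hper hbc]
  · rw [e1]
    rcases hwall hbc with h | h
    · rw [h, mul_zero]
    · rw [h.2, zero_mul]
  · rw [e0]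
    rcases hwall hbc with h | h
    · rw [h, mul_zero]
    · rw [h.1, zero_mul]

lemma FitsBoundary.lineCompatible₁ (hGL : IsGaussLobatto p ξ ω) {bc : BoundaryCondition}
    (hφ : FitsBoundary bc γ g ψ T L₁ L₂ φ) (lam : State → State → ℝ) (M : Mesh L₁ L₂)
    (h₁ : 0 < L₁) (h₂ : 0 < L₂) {t : ℝ} (ht : t ∈ Icc 0 T) {j : ℕ} (hj : j < M.N₂)
    (b : Fin (p + 1)) :
    LineCompatible bc γ lam g ψ 0 M.N₁ (fun i a => testNodes φ t M ξ i j a b) := by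
  have hy := nodeCoord_mem_Icc hGL M.h_pos M.length₂ hj b
  refine lineCompatible_of_continuous hGL (mesh_N_pos M h₁ h₂).1 M.length₁
    (fun r => φ t (r, nodeCoord M.h ξ j b)) ?_ ?_
  · rintro rfl
    exact (hφ t ht).1 _ hy
  · rintro rfl
    exact hφ.1.imp id fun h => h t ht _ hy

lemma FitsBoundary.lineCompatible₂ (hGL : IsGaussLobatto p ξ ω) {bc : BoundaryCondition}
    (hφ : FitsBoundary bc γ g ψ T L₁ L₂ φ) (lam : State → State → ℝ) (M : Mesh L₁ L₂)
    (h₁ : 0 < L₁) (h₂ : 0 < L₂) {t : ℝ} (ht : t ∈ Icc 0 T) {i : ℕ} (hi : i < M.N₁)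
    (a : Fin (p + 1)) :
    LineCompatible bc γ lam g ψ 1 M.N₂ (fun j b => testNodes φ t M ξ i j a b) := by
  have hy := nodeCoord_mem_Icc hGL M.h_pos M.length₁ hi a
  refine lineCompatible_of_continuous hGL (mesh_N_pos M h₁ h₂).2 M.length₂
    (fun r => φ t (nodeCoord M.h ξ i a, r)) ?_ ?_
  · rintro rfl
    exact (hφ t ht).2 _ hy
  · rintro rfl
    exact hφ.2.imp id fun h => h t ht _ hy

end Boundary

/-! ### The residual of the weak form, summed over the mesh. -/

section Residual

variable {γ : ℝ} {G : State → ℝ} {g : State → State} {ψ : Fin 2 → State → ℝ}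
variable {p k : ℕ} {ξ ω : Fin (p + 1) → ℝ} {T L₁ L₂ : ℝ} {B : Set State} {Cb D Cφ : ℝ}
variable {φ : ℝ → ℝ × ℝ → ℝ}

/-- The sum of the squared jumps over all sides of the mesh. -/
def totalJump (bc : BoundaryCondition) (M : Mesh L₁ L₂) (ω : Fin (p + 1) → ℝ) (c : Coeffs p) : ℝ :=
  ∑ i ∈ Finset.range M.N₁, ∑ j ∈ Finset.range M.N₂, jumpSqSum bc M ω c i j

lemma sum_cells_const (M : Mesh L₁ L₂) (r : ℝ) :
    ∑ _i ∈ Finset.range M.N₁, ∑ _j ∈ Finset.range M.N₂, M.h ^ 2 * r = L₁ * L₂ * r := by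
  simp only [Finset.sum_const, Finset.card_range, nsmul_eq_mul]
  have e : L₁ * L₂ * r = (M.N₁ * M.h) * (M.N₂ * M.h) * r := by rw [M.length₁, M.length₂]
  rw [e]
  ring

lemma totalJump_nonneg (hp : 1 ≤ p) (hGL : IsGaussLobatto p ξ ω) (bc : BoundaryCondition)
    (M : Mesh L₁ L₂) (c : Coeffs p) : 0 ≤ totalJump bc M ω c := by
  refine Finset.sum_nonneg fun i _ => Finset.sum_nonneg fun j _ => ?_
  have hpos := fun a => (hGL.weight_pos hp a).le
  unfold jumpSqSum cellFaces
  exact add_nonneg (Finset.sum_nonneg fun b _ => mul_nonneg (hpos b) (by positivity))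
    (Finset.sum_nonneg fun b _ => mul_nonneg (hpos b) (by positivity))

/-- The weak form of the scheme, up to the entropy production of the faces and an error that is
controlled by the jumps. -/
lemma exists_residual_bound (hγ : 1 < γ) (hp : 1 ≤ p) (hGL : IsGaussLobatto p ξ ω)
    (hl : IsBalanceLaw γ G g ψ) (hb : BalanceBounds γ G g ψ B Cb) (hD : 0 ≤ D)
    (hpos : ∀ U ∈ B, 0 < dens U ∧ 0 < pressure γ U) (hB : ∀ d, ∀ U ∈ B, mirror d U ∈ B)
    (hφ : IsSmoothTest (k + 1) T L₁ L₂ φ) (hφb : TestBounds T L₁ L₂ φ Cφ) (hT : 0 < T)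
    (h₁ : 0 < L₁) (h₂ : 0 < L₂) {bc : BoundaryCondition} (hbc : FitsBoundary bc γ g ψ T L₁ L₂ φ)
    (lamBar : ℝ) :
    ∃ C, 0 ≤ C ∧ ∀ (M : Mesh L₁ L₂) (c : Coeffs p) (lam : State → State → ℝ),
      IsViscosity γ B lamBar lam → GridState B D M ξ c → ∀ t ∈ Ioo 0 T,
      IntegrableOn (fun x => dotProduct (g (evalDG M ξ c x))
        (evalDG M ξ (dgRHS γ bc M ξ ω lam c) x) * φ t x) (rect L₁ L₂) ∧
      IntegrableOn (fun x => ∑ d, balanceFlux γ g ψ d (evalDG M ξ c x) * dx d φ t x)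
        (rect L₁ L₂) ∧
      |(∫ x in rect L₁ L₂, dotProduct (g (evalDG M ξ c x))
          (evalDG M ξ (dgRHS γ bc M ξ ω lam c) x) * φ t x)
        - (∫ x in rect L₁ L₂, ∑ d, balanceFlux γ g ψ d (evalDG M ξ c x) * dx d φ t x)
        + M.h / 4 * ∑ i ∈ Finset.range M.N₁, ∑ j ∈ Finset.range M.N₂,
          cellFaces bc M ω c (viscousProduction γ lam g ψ) (testNodes φ t M ξ i j) i j| ≤
        C * (M.h + √M.h + √M.h * (M.h * totalJump bc M ω c)) := by
  obtain ⟨C1, p1, H1⟩ := exists_rate_consistency hp hGL hl hb hD hφ hφb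
  obtain ⟨C2, p2, H2⟩ := exists_volume_consistency hp hGL hl hb hD hφ hφb hT h₁ h₂
  obtain ⟨C3, p3, H3⟩ := exists_dgRHS_bound (L₁ := L₁) (L₂ := L₂) hp hGL hB hb hD lamBar bc
  refine ⟨(C1 * C3 + C2) * (L₁ * L₂) + 4 * (C1 * C3) * (L₁ * L₂) + C1 * C3, by positivity,
    fun M c lam hlam hc t ht => ?_⟩
  have hh := M.h_pos
  have htc := Ioo_subset_Icc_self ht
  have H3' := H3 M c lam hlam hc
  have K1 := fun i hi j hj => H1 M c hc t htc i hi j hj (dgRHS γ bc M ξ ω lam c) _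
    (H3' i hi j hj)
  have K2 := H2 M c hc t ht
  have i1 := integrableOn_rect_of_cells M fun i hi j hj => (K1 i hi j hj).1
  have i2 := integrableOn_rect_of_cells M fun i hi j hj => (K2 i hi j hj).1
  refine ⟨i1, i2, ?_⟩
  have hgrid := grid_identity hγ hp hGL hl.shuffle (bc := bc) hlam.symm M
    (fun i hi j hj a b => hpos _ (hc.nodal_mem i hi j hj a b))
    (x := fun i j => testNodes φ t M ξ i j)
    (fun j hj b => hbc.lineCompatible₁ hGL lam M h₁ h₂ htc hj b)
    (fun i hi a => hbc.lineCompatible₂ hGL lam M h₁ h₂ htc hi a)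
  rw [integral_rect_eq_sum M i1, integral_rect_eq_sum M i2]
  set I1 : ℕ → ℕ → ℝ := fun i j => ∫ x in cellSet M.h i j, dotProduct (g (evalDG M ξ c x))
          (evalDG M ξ (dgRHS γ bc M ξ ω lam c) x) * φ t x with hI1
  set I2 : ℕ → ℕ → ℝ := fun i j => ∫ x in cellSet M.h i j,
    ∑ d, balanceFlux γ g ψ d (evalDG M ξ c x) * dx d φ t x with hI2
  set Q : ℕ → ℕ → ℝ := fun i j => ∑ a, ∑ b, ω a * ω b * (testNodes φ t M ξ i j a b *
    dotProduct (g (c i j a b)) (dgRHS γ bc M ξ ω lam c i j a b)) with hQ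
  set V : ℕ → ℕ → ℝ := fun i j => cellVolume γ g ψ ξ ω (c i j) (testNodes φ t M ξ i j) with hV
  set F : ℕ → ℕ → ℝ := fun i j =>
    cellFaces bc M ω c (viscousProduction γ lam g ψ) (testNodes φ t M ξ i j) i j with hF
  -- `grid_identity` scaled by the area factor `h ^ 2 / 4` of the quadrature. Subtracting this zero
  -- leaves only the two consistency errors in each cell.
  have hgrid' : ∑ i ∈ Finset.range M.N₁, ∑ j ∈ Finset.range M.N₂, (M.h ^ 2 / 4 * Q i j
      - M.h / 2 * V i j + M.h / 4 * F i j) = 0 := by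
    have lin : ∀ (A A' : ℕ → ℕ → ℝ) (r s : ℝ), ∑ i ∈ Finset.range M.N₁, ∑ j ∈ Finset.range M.N₂,
        (r * A i j - s * A' i j) = r * ∑ i ∈ Finset.range M.N₁, ∑ j ∈ Finset.range M.N₂, A i j
          - s * ∑ i ∈ Finset.range M.N₁, ∑ j ∈ Finset.range M.N₂, A' i j := by
      intro A A' r s
      simp only [Finset.sum_sub_distrib, Finset.mul_sum]
    have := lin Q (fun i j => V i j - F i j / 2) (M.h ^ 2 / 4) (M.h / 2)
    rw [show ∑ i ∈ Finset.range M.N₁, ∑ j ∈ Finset.range M.N₂, Q i j = 2 / M.h *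
      ∑ i ∈ Finset.range M.N₁, ∑ j ∈ Finset.range M.N₂, (V i j - F i j / 2) from hgrid] at this
    refine (Finset.sum_congr rfl fun i _ => Finset.sum_congr rfl fun j _ => ?_).trans
      (this.trans ?_)
    · ring
    · field_simp
      ring
  have esum : ∑ i ∈ Finset.range M.N₁, ∑ j ∈ Finset.range M.N₂, I1 i j
      - ∑ i ∈ Finset.range M.N₁, ∑ j ∈ Finset.range M.N₂, I2 i j
      + M.h / 4 * ∑ i ∈ Finset.range M.N₁, ∑ j ∈ Finset.range M.N₂, F i j =
      ∑ i ∈ Finset.range M.N₁, ∑ j ∈ Finset.range M.N₂,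
        ((I1 i j - M.h ^ 2 / 4 * Q i j) + (M.h / 2 * V i j - I2 i j)) := by
    rw [← sub_eq_zero, ← hgrid']
    simp only [Finset.sum_add_distrib, Finset.sum_sub_distrib, Finset.mul_sum]
    ring
  rw [esum]
  have hcell : ∀ i ∈ Finset.range M.N₁, ∀ j ∈ Finset.range M.N₂,
      |(I1 i j - M.h ^ 2 / 4 * Q i j) + (M.h / 2 * V i j - I2 i j)| ≤
        M.h ^ 2 * ((C1 * C3 + C2) * M.h + 4 * (C1 * C3) * √M.h)
          + C1 * C3 / 2 * (√M.h * (M.h * jumpSqSum bc M ω c i j)) := by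
    intro i hi j hj
    rw [Finset.mem_range] at hi hj
    have b1 := (K1 i hi j hj).2
    have b2 := (K2 i hi j hj).2
    have b3 := jumpSum_le hp hGL bc M c hh hi hj (ω := ω)
    refine (abs_add_le _ _).trans ((add_le_add b1 b2).trans ?_)
    have hs : 0 < √M.h := Real.sqrt_pos.2 hh
    have hsq : √M.h * √M.h = M.h := Real.mul_self_sqrt hh.le
    -- The factor `1 / h` in the bound of the time derivative costs one power of `h`; the area `h ^
    -- 2` times `h` plus the jumps is left.
    have e1 : C1 * (M.h ^ 3 * (C3 / M.h * (M.h + jumpSum bc M ω c i j))) =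
        C1 * C3 * M.h ^ 2 * (M.h + jumpSum bc M ω c i j) := by
      field_simp
    -- This reserves one factor `h` for the squared jumps, the scaling that the entropy balance
    -- controls, and leaves `√h` as the small factor.
    have e2 : M.h ^ 2 * (1 / (2 * √M.h)) = √M.h * M.h / 2 := by
      have : M.h ^ 2 = √M.h * √M.h * M.h := by rw [hsq]; ring
      rw [this]
      field_simp
    have b4 := mul_le_mul_of_nonneg_left b3 (by positivity : 0 ≤ C1 * C3 * M.h ^ 2)
    have e3 : C1 * C3 * M.h ^ 2 * (4 * √M.h + 1 / (2 * √M.h) * jumpSqSum bc M ω c i j) =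
        C1 * C3 * M.h ^ 2 * (4 * √M.h)
          + C1 * C3 * (M.h ^ 2 * (1 / (2 * √M.h))) * jumpSqSum bc M ω c i j := by ring
    rw [e1, mul_add]
    rw [e3, e2] at b4
    linarith
  have hJ0 := totalJump_nonneg hp hGL bc M c (ω := ω)
  have htot : |∑ i ∈ Finset.range M.N₁, ∑ j ∈ Finset.range M.N₂,
        ((I1 i j - M.h ^ 2 / 4 * Q i j) + (M.h / 2 * V i j - I2 i j))| ≤
      L₁ * L₂ * ((C1 * C3 + C2) * M.h + 4 * (C1 * C3) * √M.h)
          + C1 * C3 / 2 * (√M.h * (M.h * totalJump bc M ω c)) := by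
    refine (Finset.abs_sum_le_sum_abs _ _).trans ((Finset.sum_le_sum fun i hi =>
      (Finset.abs_sum_le_sum_abs _ _).trans (Finset.sum_le_sum fun j hj =>
        hcell i hi j hj)).trans (le_of_eq ?_))
    simp only [Finset.sum_add_distrib]
    rw [sum_cells_const]
    simp only [← Finset.mul_sum]
    rfl
  refine htot.trans ?_
  have hs := Real.sqrt_nonneg M.h
  have n1 : 0 ≤ √M.h * (M.h * totalJump bc M ω c) := by positivity
  have n2 : 0 ≤ (C1 * C3 + C2) * (L₁ * L₂) := by positivity
  have n3 : 0 ≤ C1 * C3 * (L₁ * L₂) := by positivity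
  have n4 : 0 ≤ C1 * C3 := by positivity
  set X := √M.h * (M.h * totalJump bc M ω c)
  have m1 : 0 ≤ (C1 * C3 + C2) * (L₁ * L₂) * (√M.h + X) := by positivity
  have m2 : 0 ≤ C1 * C3 * (L₁ * L₂) * (M.h + X) := by positivity
  have m3 : 0 ≤ C1 * C3 * (M.h + √M.h + X / 2) := by positivity
  linarith

end Residual

/-! ### Time evolution of discrete totals, and the weak bound of the jumps. -/

section TimeEvolution

variable {γ : ℝ} {G : State → ℝ} {g : State → State} {ψ : Fin 2 → State → ℝ}
variable {p : ℕ} {ξ ω : Fin (p + 1) → ℝ} {T L₁ L₂ : ℝ} {B : Set State} {D lamBar : ℝ}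
variable {bc : BoundaryCondition} {M : Mesh L₁ L₂} {lam : ℝ → State → State → ℝ}
variable {U : ℝ → Coeffs p}

/-- A solution of the scheme on `[0, T]` which satisfies the uniform bounds. -/
structure BoundedSolution (γ : ℝ) (bc : BoundaryCondition) (M : Mesh L₁ L₂)
    (ξ ω : Fin (p + 1) → ℝ) (B : Set State) (D lamBar T : ℝ) (lam : ℝ → State → State → ℝ)
    (U : ℝ → Coeffs p) : Prop where
  solution : IsDGSolution γ bc M ξ ω lam T U
  viscosity : ∀ t, IsViscosity γ B lamBar (lam t)
  grid : ∀ t ∈ Icc 0 T, GridState B D M ξ (U t)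

lemma continuous_mirror (d : Fin 2) : Continuous (mirror d) := by
  refine continuous_pi fun k => ?_
  unfold mirror
  fin_cases d <;> fin_cases k <;> simp <;> fun_prop

lemma continuousOn_lineExtRight (bc : BoundaryCondition) (d : Fin 2) {N : ℕ} {S : Set ℝ}
    {W : ℝ → ℕ → Fin (p + 1) → State} (hW : ∀ i < N, ∀ a, ContinuousOn (fun t => W t i a) S)
    {i : ℕ} (hi : i < N) : ContinuousOn (fun t => lineExtRight bc d N (W t) i) S := by
  cases bc with
  | periodic => exact hW _ (Nat.mod_lt _ (by omega)) _
  | noFlux =>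
    simp only [lineExtRight]
    split_ifs with h
    · exact hW _ h _
    · exact (continuous_mirror d).comp_continuousOn (hW _ hi _)

lemma continuousOn_lineExtLeft (bc : BoundaryCondition) (d : Fin 2) {N : ℕ} {S : Set ℝ}
    {W : ℝ → ℕ → Fin (p + 1) → State} (hW : ∀ i < N, ∀ a, ContinuousOn (fun t => W t i a) S)
    {i : ℕ} (hi : i < N) : ContinuousOn (fun t => lineExtLeft bc d N (W t) i) S := by
  cases bc with
  | periodic => exact hW _ (Nat.mod_lt _ (by omega)) _
  | noFlux =>
    simp only [lineExtLeft]
    split_ifs with h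
    · exact hW _ (by omega) _
    · exact (continuous_mirror d).comp_continuousOn (hW _ hi _)

lemma continuousOn_totalJump {S : Set ℝ}
    (hU : ∀ i < M.N₁, ∀ j < M.N₂, ∀ a b, ContinuousOn (fun t => U t i j a b) S) :
    ContinuousOn (fun t => totalJump bc M ω (U t)) S := by
  unfold totalJump jumpSqSum cellFaces
  refine continuousOn_finsetSum _ fun i hi => continuousOn_finsetSum _ fun j hj => ?_
  rw [Finset.mem_range] at hi hj
  have h1 : ∀ b, ContinuousOn (fun t => extRight bc M (U t) i j b) S := fun b => by
    simp only [extRight_eq]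
    exact continuousOn_lineExtRight bc 0 (W := fun t i a => U t i j a b)
      (fun i hi a => hU i hi j hj a b) hi
  have h2 : ∀ b, ContinuousOn (fun t => extLeft bc M (U t) i j b) S := fun b => by
    simp only [extLeft_eq]
    exact continuousOn_lineExtLeft bc 0 (W := fun t i a => U t i j a b)
      (fun i hi a => hU i hi j hj a b) hi
  have h3 : ∀ b, ContinuousOn (fun t => extTop bc M (U t) i j b) S := fun b => by
    simp only [extTop_eq]
    exact continuousOn_lineExtRight bc 1 (W := fun t j a => U t i j b a)
      (fun j hj a => hU i hi j hj b a) hj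
  have h4 : ∀ b, ContinuousOn (fun t => extBottom bc M (U t) i j b) S := fun b => by
    simp only [extBottom_eq]
    exact continuousOn_lineExtLeft bc 1 (W := fun t j a => U t i j b a)
      (fun j hj a => hU i hi j hj b a) hj
  have h0 := hU i hi j hj
  refine ContinuousOn.add (continuousOn_finsetSum _ fun b _ => ?_)
    (continuousOn_finsetSum _ fun b _ => ?_)
  · exact continuousOn_const.mul ((continuousOn_const.mul (((h1 b).sub (h0 _ b)).norm.pow 2)).add
      (continuousOn_const.mul (((h2 b).sub (h0 _ b)).norm.pow 2)))
  · exact continuousOn_const.mul ((continuousOn_const.mul (((h3 b).sub (h0 b _)).norm.pow 2)).add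
      (continuousOn_const.mul (((h4 b).sub (h0 b _)).norm.pow 2)))

lemma BoundedSolution.continuousOn (h : BoundedSolution γ bc M ξ ω B D lamBar T lam U) {i j : ℕ}
    (hi : i < M.N₁) (hj : j < M.N₂) (a b : Fin (p + 1)) :
    ContinuousOn (fun t => U t i j a b) (Icc 0 T) := fun t ht =>
  (h.solution t ht i hi j hj a b).continuousWithinAt

/-- The quadrature of the density `G` over the mesh. -/
def discreteIntegral (G : State → ℝ) (M : Mesh L₁ L₂) (ω : Fin (p + 1) → ℝ) (c : Coeffs p) : ℝ :=
  ∑ i ∈ Finset.range M.N₁, ∑ j ∈ Finset.range M.N₂, ∑ a, ∑ b, ω a * ω b * G (c i j a b)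

/-- With the constant test function all increments vanish, so the volume terms disappear and only
the productions of the faces remain. -/
lemma hasDerivWithinAt_discreteIntegral (hγ : 1 < γ) (hp : 1 ≤ p) (hGL : IsGaussLobatto p ξ ω)
    (hl : IsBalanceLaw γ G g ψ) (hw : ∀ d, WallNeutral γ g ψ d)
    (hpos : ∀ U ∈ B, 0 < dens U ∧ 0 < pressure γ U) (h₁ : 0 < L₁) (h₂ : 0 < L₂)
    (h : BoundedSolution γ bc M ξ ω B D lamBar T lam U) {t : ℝ} (ht : t ∈ Icc 0 T) :
    HasDerivWithinAt (fun t => discreteIntegral G M ω (U t))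
      (-(1 / M.h * ∑ i ∈ Finset.range M.N₁, ∑ j ∈ Finset.range M.N₂,
        cellFaces bc M ω (U t) (viscousProduction γ (lam t) g ψ) (fun _ _ => 1) i j)) (Icc 0 T) t := by
  have hh := M.h_pos
  have hn := (h.grid t ht).nodal_mem
  have hgrid := grid_identity hγ hp hGL hl.shuffle (bc := bc) (h.viscosity t).symm M
    (fun i hi j hj a b => hpos _ (hn i hi j hj a b)) (x := fun _ _ _ _ => 1)
    (fun j hj b => lineCompatible_of_continuous hGL (mesh_N_pos M h₁ h₂).1 M.length₁
      (fun _ => 1) (fun _ => rfl) (fun _ => Or.inl (hw 0)))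
    (fun j hj b => lineCompatible_of_continuous hGL (mesh_N_pos M h₁ h₂).2 M.length₂
      (fun _ => 1) (fun _ => rfl) (fun _ => Or.inl (hw 1)))
  have e : -(1 / M.h * ∑ i ∈ Finset.range M.N₁, ∑ j ∈ Finset.range M.N₂,
        cellFaces bc M ω (U t) (viscousProduction γ (lam t) g ψ) (fun _ _ => 1) i j) =
      ∑ i ∈ Finset.range M.N₁, ∑ j ∈ Finset.range M.N₂, ∑ a, ∑ b, ω a * ω b *
        dotProduct (g (U t i j a b)) (dgRHS γ bc M ξ ω (lam t) (U t) i j a b) := by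
    simp only [one_mul] at hgrid
    rw [hgrid]
    simp only [cellVolume, sub_self, zero_mul, mul_zero, Finset.sum_const_zero, add_zero, zero_sub,
      Finset.sum_neg_distrib, Finset.mul_sum, mul_neg]
    congr 1
    refine Finset.sum_congr rfl fun i _ => Finset.sum_congr rfl fun j _ => ?_
    field_simp
  rw [e]
  unfold discreteIntegral
  refine HasDerivWithinAt.fun_sum fun i hi => HasDerivWithinAt.fun_sum fun j hj =>
    HasDerivWithinAt.fun_sum fun a _ => HasDerivWithinAt.fun_sum fun b _ => ?_
  rw [Finset.mem_range] at hi hj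
  obtain ⟨q1, q2⟩ := hpos _ (hn i hi j hj a b)
  exact (hl.hasDeriv _ _ _ t (h.solution t ht i hi j hj a b) q1 q2).const_mul _

/-- The weights of a cell sum to `4`, and the areas `h ^ 2` of the cells to that of the rectangle.
-/
lemma abs_discreteIntegral_le (hp : 1 ≤ p) (hGL : IsGaussLobatto p ξ ω) {K : ℝ}
    (hG : ∀ U ∈ B, |G U| ≤ K) {c : Coeffs p} (hc : GridState B D M ξ c) :
    M.h ^ 2 * |discreteIntegral G M ω c| ≤ L₁ * L₂ * (4 * K) := by
  have hpos := fun a => (hGL.weight_pos hp a).le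
  have hK : ∑ a, ∑ b, ω a * ω b * K = 4 * K := by
    simp only [← Finset.sum_mul, ← Finset.mul_sum, hGL.sum_weights]; norm_num
  rw [← hK, ← sum_cells_const M, discreteIntegral]
  generalize hS : ∑ a, ∑ b, ω a * ω b * K = S
  simp only [← Finset.mul_sum]
  refine mul_le_mul_of_nonneg_left ?_ (sq_nonneg _)
  refine (Finset.abs_sum_le_sum_abs _ _).trans (Finset.sum_le_sum fun i hi =>
    (Finset.abs_sum_le_sum_abs _ _).trans (Finset.sum_le_sum fun j hj => ?_))
  rw [Finset.mem_range] at hi hj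
  rw [← hS]
  refine (Finset.abs_sum_le_sum_abs _ _).trans (Finset.sum_le_sum fun a _ =>
    (Finset.abs_sum_le_sum_abs _ _).trans (Finset.sum_le_sum fun b _ => ?_))
  rw [abs_mul, abs_of_nonneg (mul_nonneg (hpos a) (hpos b))]
  exact mul_le_mul_of_nonneg_left (hG _ (hc.nodal_mem i hi j hj a b))
    (mul_nonneg (hpos a) (hpos b))

/-- The weak bound of the jumps which follows from the entropy balance. -/
lemma integral_totalJump_le (hγ : 1 < γ) (hp : 1 ≤ p) (hGL : IsGaussLobatto p ξ ω)
    (hl : IsBalanceLaw γ G g ψ) (hw : ∀ d, WallNeutral γ g ψ d)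
    (hpos : ∀ U ∈ B, 0 < dens U ∧ 0 < pressure γ U) (hB : ∀ d, ∀ U ∈ B, mirror d U ∈ B)
    {κ K : ℝ} (hκ : 0 < κ)
    (hprod : ∀ U ∈ B, ∀ V ∈ B, ∀ lam, lamMax γ U V ≤ lam → ∀ a sgn, (sgn = 1 ∨ sgn = -1) →
      κ * ‖V - U‖ ^ 2 ≤ faceProduction γ lam g ψ a sgn U V)
    (hG : ∀ U ∈ B, |G U| ≤ K) (hT : 0 < T) (h₁ : 0 < L₁) (h₂ : 0 < L₂)
    (h : BoundedSolution γ bc M ξ ω B D lamBar T lam U) :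
    ∫ t in (0 : ℝ)..T, M.h * totalJump bc M ω (U t) ≤ 8 * (L₁ * L₂ * K) / κ := by
  have hh := M.h_pos
  have hcont := continuousOn_totalJump (bc := bc) (ω := ω) (fun i hi j hj => h.continuousOn hi hj)
  have hd := fun t ht => hasDerivWithinAt_discreteIntegral hγ hp hGL hl hw hpos h₁ h₂ h (t := t) ht
  have hle : ∀ t ∈ Icc 0 T, κ * totalJump bc M ω (U t) ≤
      ∑ i ∈ Finset.range M.N₁, ∑ j ∈ Finset.range M.N₂,
        cellFaces bc M ω (U t) (viscousProduction γ (lam t) g ψ) (fun _ _ => 1) i j := by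
    intro t ht
    rw [totalJump, Finset.mul_sum]
    refine Finset.sum_le_sum fun i hi => ?_
    rw [Finset.mul_sum]
    refine Finset.sum_le_sum fun j hj => ?_
    rw [Finset.mem_range] at hi hj
    have := cellFaces_mono hp hGL hB bc M (h.grid t ht).nodal_mem
      (P := fun _ _ U V => 0 + κ * ‖V - U‖ ^ 2) (Q := viscousProduction γ (lam t) g ψ)
      (fun d sgn hs U hU V hV => by
        rw [zero_add]; exact hprod U hU V hV _ ((h.viscosity t).ge U V) d sgn hs)
      (x := fun _ _ => 1) (fun _ _ => zero_le_one) hi hj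
    rw [cellFaces_affine hGL bc M (U t) (fun _ _ U V => ‖V - U‖ ^ 2)] at this
    unfold jumpSqSum
    linarith
  -- The one-sided form of the fundamental theorem compares the derivative with a continuous
  -- majorant. The production itself, in which the viscosity may depend on time arbitrarily, is
  -- never integrated.
  have key := intervalIntegral.sub_le_integral_of_hasDeriv_right_of_le hT.le
    (g := fun t => discreteIntegral G M ω (U t))
    (g' := fun t => -(1 / M.h * ∑ i ∈ Finset.range M.N₁, ∑ j ∈ Finset.range M.N₂,
        cellFaces bc M ω (U t) (viscousProduction γ (lam t) g ψ) (fun _ _ => 1) i j))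
    (φ := fun t => -(1 / M.h * (κ * totalJump bc M ω (U t))))
    (fun t ht => (hd t ht).continuousWithinAt)
    (fun t ht => ((hd t (Ioo_subset_Icc_self ht)).hasDerivAt
      (Icc_mem_nhds ht.1 ht.2)).hasDerivWithinAt)
    ((continuousOn_const.mul (continuousOn_const.mul hcont)).neg.integrableOn_compact isCompact_Icc)
    (fun t ht => neg_le_neg (mul_le_mul_of_nonneg_left (hle t (Ioo_subset_Icc_self ht))
      (by positivity)))
  simp only [intervalIntegral.integral_neg, intervalIntegral.integral_const_mul] at key ⊢
  have b0 := abs_discreteIntegral_le hp hGL hG (h.grid 0 ⟨le_rfl, hT.le⟩)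
  have b1 := abs_discreteIntegral_le hp hGL hG (h.grid T ⟨hT.le, le_rfl⟩)
  rw [le_div_iff₀ hκ]
  set I := ∫ t in (0 : ℝ)..T, totalJump bc M ω (U t)
  set H0 := discreteIntegral G M ω (U 0)
  set H1 := discreteIntegral G M ω (U T)
  have k2 : 1 / M.h * (κ * I) ≤ |H0| + |H1| := by
    have := le_abs_self H0
    have := neg_abs_le H1
    linarith
  have k3 := mul_le_mul_of_nonneg_left k2 (sq_nonneg M.h)
  have e : M.h ^ 2 * (1 / M.h * (κ * I)) = M.h * I * κ := by field_simp
  rw [e] at k3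
  linarith

/-- The total of a conserved quantity whose flux through the walls vanishes is constant. -/
lemma integral_coord_eq (hγ : 1 < γ) (hp : 1 ≤ p) (hGL : IsGaussLobatto p ξ ω) {k : Fin 4}
    (hk : ∀ d : Fin 2, (k : ℕ) ≠ d + 1) (hpos : ∀ U ∈ B, 0 < dens U ∧ 0 < pressure γ U)
    (h₁ : 0 < L₁) (h₂ : 0 < L₂) (h : BoundedSolution γ bc M ξ ω B D lamBar T lam U) {τ : ℝ}
    (hτ : τ ∈ Icc 0 T) :
    ∫ x in rect L₁ L₂, evalDG M ξ (U τ) x k = ∫ x in rect L₁ L₂, evalDG M ξ (U 0) x k := by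
  -- A conservative variable is polynomial in each cell, so its quadrature is exact; this fails for
  -- the entropy.
  have hint : ∀ c : Coeffs p, ∫ x in rect L₁ L₂, evalDG M ξ c x k =
      M.h ^ 2 / 4 * discreteIntegral (fun U => U k) M ω c := by
    intro c
    have heq : ∀ i j, EqOn (fun x => evalDG M ξ c x k)
        (cellPoly M.h ξ i j (fun a b => c i j a b k)) (cellSet M.h i j) :=
      fun i j x hx => evalDG_apply M c hx k
    have hi : IntegrableOn (fun x => evalDG M ξ c x k) (rect L₁ L₂) :=
      integrableOn_rect_of_cells M fun i _ j _ =>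
        (integrableOn_cellSet_of_continuous (continuous_cellPoly M.h i j _) M.h i j).congr_fun
          (heq i j).symm (measurableSet_cellSet M.h i j)
    rw [integral_rect_eq_sum M hi]
    simp only [discreteIntegral, Finset.mul_sum]
    refine Finset.sum_congr rfl fun i _ => Finset.sum_congr rfl fun j _ => ?_
    rw [setIntegral_congr_fun (measurableSet_cellSet M.h i j) (heq i j),
      integral_cellPoly hp hGL M.h_pos]
    simp only [Finset.mul_sum]
  have hd := fun t ht => hasDerivWithinAt_discreteIntegral hγ hp hGL (isBalanceLaw_coord k)
    (fun d => wallNeutral_coord (hk d)) hpos h₁ h₂ h (t := t) ht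
  have hzero : ∀ t i j, cellFaces bc M ω (U t) (viscousProduction γ (lam t) (fun _ => Pi.single k 1)
      (fun _ _ => 0)) (fun _ _ => 1) i j = 0 := by
    intro t i j
    simp [cellFaces, viscousProduction, faceProduction_coord]
  simp only [hzero, Finset.sum_const_zero, mul_zero, neg_zero] at hd
  rw [hint, hint]
  congr 1
  refine constant_of_has_deriv_right_zero (fun t ht => (hd t ht).continuousWithinAt)
    (fun t ht => ?_) τ hτ
  exact (hd t (Ico_subset_Icc_self ht)).mono_of_mem_nhdsWithin
    (mem_of_superset (Icc_mem_nhdsGE ht.2) (Icc_subset_Icc_left ht.1))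

end TimeEvolution

/-! ### Differentiation of tested densities in time. -/

section WeakForm

variable {γ : ℝ} {G : State → ℝ} {g : State → State} {ψ : Fin 2 → State → ℝ}
variable {p k : ℕ} {ξ ω : Fin (p + 1) → ℝ} {T L₁ L₂ : ℝ} {B : Set State} {Cb D Cφ R lamBar : ℝ}
variable {bc : BoundaryCondition} {M : Mesh L₁ L₂} {lam : ℝ → State → State → ℝ}
variable {U : ℝ → Coeffs p} {φ : ℝ → ℝ × ℝ → ℝ}

/-- The density `G` of the numerical solution, tested with `φ`. -/
def testedDensity (G : State → ℝ) (M : Mesh L₁ L₂) (ξ : Fin (p + 1) → ℝ) (U : ℝ → Coeffs p)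
    (φ : ℝ → ℝ × ℝ → ℝ) (t : ℝ) : ℝ :=
  ∫ x in rect L₁ L₂, G (evalDG M ξ (U t) x) * φ t x

/-- The weak form of the time derivative and the divergence in a balance law. -/
def testedFlux (γ : ℝ) (G : State → ℝ) (g : State → State) (ψ : Fin 2 → State → ℝ)
    (M : Mesh L₁ L₂) (ξ : Fin (p + 1) → ℝ) (U : ℝ → Coeffs p) (φ : ℝ → ℝ × ℝ → ℝ) (t : ℝ) : ℝ :=
  ∫ x in rect L₁ L₂, (G (evalDG M ξ (U t) x) * dt φ t x
    + ∑ d, balanceFlux γ g ψ d (evalDG M ξ (U t) x) * dx d φ t x)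

/-- The defect of the balance law in weak form. -/
def weakDefect (γ : ℝ) (G : State → ℝ) (g : State → State) (ψ : Fin 2 → State → ℝ)
    (M : Mesh L₁ L₂) (ξ : Fin (p + 1) → ℝ) (U : ℝ → Coeffs p) (φ : ℝ → ℝ × ℝ → ℝ) (t : ℝ) : ℝ :=
  deriv (testedDensity G M ξ U φ) t - testedFlux γ G g ψ M ξ U φ t

lemma hasDerivWithinAt_evalDG (h : IsDGSolution γ bc M ξ ω lam T U) {x : ℝ × ℝ}
    (hx : x ∈ Ico 0 L₁ ×ˢ Ico 0 L₂) {t : ℝ} (ht : t ∈ Icc 0 T) :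
    HasDerivWithinAt (fun s => evalDG M ξ (U s) x)
      (evalDG M ξ (dgRHS γ bc M ξ ω (lam t) (U t)) x) (Icc 0 T) t := by
  have hi := (exists_cell_of_mem M.h_pos M.length₁ hx.1).1
  have hj := (exists_cell_of_mem M.h_pos M.length₂ hx.2).1
  unfold evalDG
  exact HasDerivWithinAt.fun_sum fun a _ => HasDerivWithinAt.fun_sum fun b _ =>
    (h t ht _ hi _ hj a b).fun_const_smul _

/-- A crude bound on a fixed mesh, with jumps estimated by `R + R` and a constant that deteriorates
like `1 / h`. It only supplies majorants for differentiation under the integral and integrability in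
time. -/
lemma exists_rate_bound (hp : 1 ≤ p) (hGL : IsGaussLobatto p ξ ω)
    (hb : BalanceBounds γ G g ψ B Cb) (hD : 0 ≤ D) (hB : ∀ d, ∀ U ∈ B, mirror d U ∈ B)
    (hR : ∀ U ∈ B, ‖U‖ ≤ R) (h : BoundedSolution γ bc M ξ ω B D lamBar T lam U) :
    ∃ K, ∀ t ∈ Icc 0 T, ∀ x ∈ Ico 0 L₁ ×ˢ Ico 0 L₂,
      |dotProduct (g (evalDG M ξ (U t) x)) (evalDG M ξ (dgRHS γ bc M ξ ω (lam t) (U t)) x)| ≤ K := by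
  obtain ⟨C, hC, hrhs⟩ := exists_dgRHS_bound (L₁ := L₁) (L₂ := L₂) hp hGL hB hb hD lamBar bc
  obtain ⟨L, hL, hLeb⟩ := exists_lebesgue_bound ξ
  have hh := M.h_pos
  refine ⟨∑ _k : Fin 4, Cb * (L * (C / M.h * (M.h + 8 * (R + R)))), fun t ht x hx => ?_⟩
  have hg := h.grid t ht
  obtain ⟨hi, hx1⟩ := exists_cell_of_mem M.h_pos M.length₁ hx.1
  obtain ⟨hj, hx2⟩ := exists_cell_of_mem M.h_pos M.length₂ hx.2
  set i := ⌊x.1 / M.h⌋₊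
  set j := ⌊x.2 / M.h⌋₊
  have hJ : jumpSum bc M ω (U t) i j ≤ 8 * (R + R) := by
    have := cellFaces_mono hp hGL hB bc M hg.nodal_mem (P := fun _ _ U V => ‖V - U‖)
      (Q := fun _ _ _ _ => (R + R) + 0 * 0) (fun _ _ _ U hU V hV => by
        have := norm_sub_le V U
        have := hR U hU
        have := hR V hV
        linarith) (x := fun _ _ => 1) (fun _ _ => zero_le_one) hi hj
    rw [cellFaces_affine hGL bc M (U t) (fun _ _ _ _ => 0)] at this
    unfold jumpSum
    linarith
  have hrate : ∀ a b k, |dgRHS γ bc M ξ ω (lam t) (U t) i j a b k| ≤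
      C / M.h * (M.h + 8 * (R + R)) := fun a b k =>
    (hrhs M (U t) (lam t) (h.viscosity t) hg i hi j hj a b k).trans
      (mul_le_mul_of_nonneg_left (by linarith) (by positivity))
  have hm0 := (abs_nonneg _).trans (hrate 0 0 0)
  have hev : ‖evalDG M ξ (dgRHS γ bc M ξ ω (lam t) (U t)) x‖ ≤
      L * (C / M.h * (M.h + 8 * (R + R))) := by
    rw [evalDG_eq_of_mem_Ico M _ hx1 hx2]
    exact hLeb _ (refCoord_mem M.h_pos (Ico_subset_Icc_self hx1)) _
      (refCoord_mem M.h_pos (Ico_subset_Icc_self hx2)) State _ _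
      (fun a b => (pi_norm_le_iff_of_nonneg hm0).2 fun k => hrate a b k)
  unfold dotProduct
  refine (Finset.abs_sum_le_sum_abs _ _).trans (Finset.sum_le_sum fun k _ => ?_)
  rw [abs_mul]
  exact mul_le_mul (hb.multiplier_le _ (hg.field_mem x hx) k)
    ((norm_le_pi_norm (evalDG M ξ (dgRHS γ bc M ξ ω (lam t) (U t)) x) k).trans hev)
    (abs_nonneg _) hb.nonneg

lemma restrict_rect (L₁ L₂ : ℝ) : (volume : Measure (ℝ × ℝ)).restrict (rect L₁ L₂) =
    volume.restrict (Ioo 0 L₁ ×ˢ Ioo 0 L₂) := Measure.restrict_congr_set (rect_ae_eq_Ioo L₁ L₂)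

lemma volume_Ioo_prod_lt_top (L₁ L₂ : ℝ) : volume (Ioo 0 L₁ ×ˢ Ioo 0 L₂ : Set (ℝ × ℝ)) < ⊤ := by
  rw [Measure.volume_eq_prod, Measure.prod_prod, Real.volume_Ioo, Real.volume_Ioo]
  exact ENNReal.mul_lt_top ENNReal.ofReal_lt_top ENNReal.ofReal_lt_top

/-- The weak form of the scheme in time. -/
lemma weak_formulation (hp : 1 ≤ p) (hGL : IsGaussLobatto p ξ ω) (hl : IsBalanceLaw γ G g ψ)
    (hb : BalanceBounds γ G g ψ B Cb) (hD : 0 ≤ D)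
    (hpos : ∀ U ∈ B, 0 < dens U ∧ 0 < pressure γ U) (hB : ∀ d, ∀ U ∈ B, mirror d U ∈ B)
    (hR : ∀ U ∈ B, ‖U‖ ≤ R) (hφ : IsSmoothTest (k + 1) T L₁ L₂ φ)
    (hφb : TestBounds T L₁ L₂ φ Cφ) (hT : 0 < T) (h₁ : 0 < L₁) (h₂ : 0 < L₂)
    (h : BoundedSolution γ bc M ξ ω B D lamBar T lam U) :
    (∀ t ∈ Ioo 0 T, weakDefect γ G g ψ M ξ U φ t =
      (∫ x in rect L₁ L₂, dotProduct (g (evalDG M ξ (U t) x))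
          (evalDG M ξ (dgRHS γ bc M ξ ω (lam t) (U t)) x) * φ t x)
        - ∫ x in rect L₁ L₂, ∑ d, balanceFlux γ g ψ d (evalDG M ξ (U t) x) * dx d φ t x) ∧
    IntervalIntegrable (weakDefect γ G g ψ M ξ U φ) volume 0 T ∧
    IntervalIntegrable (testedFlux γ G g ψ M ξ U φ) volume 0 T ∧
    ∀ τ ∈ Ioc 0 T, testedDensity G M ξ U φ τ - testedDensity G M ξ U φ 0 =
      (∫ t in (0 : ℝ)..τ, testedFlux γ G g ψ M ξ U φ t)
        + ∫ t in (0 : ℝ)..τ, weakDefect γ G g ψ M ξ U φ t := by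
  obtain ⟨K, hK⟩ := exists_rate_bound hp hGL hb hD hB hR h
  have hC0 := hb.nonneg
  have hφ0 := hφb.nonneg
  set Ω : Set (ℝ × ℝ) := Ioo 0 L₁ ×ˢ Ioo 0 L₂ with hΩ
  have hms : MeasurableSet Ω := measurableSet_Ioo.prod measurableSet_Ioo
  have hfin : volume Ω < ⊤ := volume_Ioo_prod_lt_top L₁ L₂
  have : IsFiniteMeasure (volume.restrict Ω) := ⟨by rwa [Measure.restrict_apply_univ]⟩
  have hΩI : ∀ x ∈ Ω, x ∈ Ico 0 L₁ ×ˢ Ico 0 L₂ := fun x hx => Ioo_prod_subset_Ico hx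
  have hΩr : ∀ x ∈ Ω, x ∈ rect L₁ L₂ := fun x hx => Ioo_prod_subset_rect hx
  have hΩn : (⟨L₁ / 2, L₂ / 2⟩ : ℝ × ℝ) ∈ Ω := ⟨⟨by positivity, by simp; linarith⟩,
    ⟨by positivity, by simp; linarith⟩⟩
  have hmem : ∀ t ∈ Icc 0 T, ∀ x ∈ Ω, evalDG M ξ (U t) x ∈ B := fun t ht x hx =>
    (h.grid t ht).field_mem x (hΩI x hx)
  have hae : ∀ {P : ℝ × ℝ → Prop}, (∀ x ∈ Ω, P x) → ∀ᵐ x ∂(volume.restrict Ω), P x := fun hP =>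
    (ae_restrict_iff' hms).2 (ae_of_all _ hP)
  set A : ℝ → ℝ × ℝ → ℝ := fun t x => dotProduct (g (evalDG M ξ (U t) x))
    (evalDG M ξ (dgRHS γ bc M ξ ω (lam t) (U t)) x) with hA
  set F : ℝ → ℝ × ℝ → ℝ := fun t x =>
    ∑ d, balanceFlux γ g ψ d (evalDG M ξ (U t) x) * dx d φ t x with hF
  have hcontU : ∀ x ∈ Ω, ContinuousOn (fun t => evalDG M ξ (U t) x) (Icc 0 T) :=
    fun x hx t ht => (hasDerivWithinAt_evalDG h.solution (hΩI x hx) ht).continuousWithinAt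
  have hderG : ∀ x ∈ Ω, ∀ t ∈ Icc 0 T, HasDerivWithinAt (fun s => G (evalDG M ξ (U s) x))
      (A t x) (Icc 0 T) t := fun x hx t ht => by
    obtain ⟨q1, q2⟩ := hpos _ (hmem t ht x hx)
    exact hl.hasDeriv _ _ _ t (hasDerivWithinAt_evalDG h.solution (hΩI x hx) ht) q1 q2
  have mG : ∀ t, AEStronglyMeasurable (fun x => G (evalDG M ξ (U t) x)) (volume.restrict Ω) :=
    fun t => (hl.measurable_density.comp (measurable_evalDG M (U t))).aestronglyMeasurable
  have mA : ∀ t, AEStronglyMeasurable (A t) (volume.restrict Ω) := fun t =>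
    (Finset.measurable_fun_sum _ fun k _ =>
      ((hl.measurable_multiplier k).comp (measurable_evalDG M (U t))).mul
      ((measurable_pi_apply k).comp (measurable_evalDG M _))).aestronglyMeasurable
  have mφ : ∀ t ∈ Icc 0 T, AEStronglyMeasurable (φ t) (volume.restrict Ω) := fun t ht =>
    ((hφ.continuousOn_slice ht).mono hΩr).aestronglyMeasurable hms
  have mdt : ∀ t ∈ Ioo 0 T, AEStronglyMeasurable (dt φ t) (volume.restrict Ω) := fun t ht =>
    (hφ.continuousOn_dt_slice hT h₁ h₂ ht).aestronglyMeasurable hms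
  have mF : ∀ t ∈ Ioo 0 T, AEStronglyMeasurable (F t) (volume.restrict Ω) := fun t ht =>
    Finset.aestronglyMeasurable_fun_sum _ fun d _ =>
      (((hl.measurable_flux d).comp (measurable_evalDG M (U t))).aestronglyMeasurable).mul
      ((hφ.continuousOn_dx_slice hT h₁ h₂ d ht).aestronglyMeasurable hms)
  have bGφ : ∀ t ∈ Icc 0 T, ∀ x ∈ Ω, ‖G (evalDG M ξ (U t) x) * φ t x‖ ≤ Cb * Cφ :=
    fun t ht x hx => by
      rw [norm_mul]
      exact mul_le_mul (hb.density_le _ (hmem t ht x hx)) (hφb.abs_le t ht x (hΩr x hx))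
        (norm_nonneg _) hC0
  have bGdt : ∀ t ∈ Ioo 0 T, ∀ x ∈ Ω, ‖G (evalDG M ξ (U t) x) * dt φ t x‖ ≤ Cb * Cφ :=
    fun t ht x hx => by
      rw [norm_mul]
      exact mul_le_mul (hb.density_le _ (hmem t (Ioo_subset_Icc_self ht) x hx))
        (hφb.dt_le t ht x hx) (norm_nonneg _) hC0
  have bAφ : ∀ t ∈ Icc 0 T, ∀ x ∈ Ω, ‖A t x * φ t x‖ ≤ K * Cφ := fun t ht x hx => by
    have hk := hK t ht x (hΩI x hx)
    rw [norm_mul]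
    exact mul_le_mul hk (hφb.abs_le t ht x (hΩr x hx)) (norm_nonneg _) ((abs_nonneg _).trans hk)
  have bF : ∀ t ∈ Ioo 0 T, ∀ x ∈ Ω, ‖F t x‖ ≤ ∑ _d : Fin 2, Cb * Cφ := fun t ht x hx => by
    refine (norm_sum_le _ _).trans (Finset.sum_le_sum fun d _ => ?_)
    rw [norm_mul]
    exact mul_le_mul (hb.flux_le _ (hmem t (Ioo_subset_Icc_self ht) x hx) d)
      (hφb.dx_le t ht x hx d) (norm_nonneg _) hC0
  have iGdt : ∀ t ∈ Ioo 0 T, IntegrableOn (fun x => G (evalDG M ξ (U t) x) * dt φ t x) Ω :=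
    fun t ht => IntegrableOn.of_bound hfin ((mG t).mul (mdt t ht)) _ (hae (bGdt t ht))
  have iAφ : ∀ t ∈ Icc 0 T, IntegrableOn (fun x => A t x * φ t x) Ω :=
    fun t ht => IntegrableOn.of_bound hfin ((mA t).mul (mφ t ht)) _ (hae (bAφ t ht))
  have iF : ∀ t ∈ Ioo 0 T, IntegrableOn (F t) Ω :=
    fun t ht => IntegrableOn.of_bound hfin (mF t ht) _ (hae (bF t ht))
  -- Continuity includes the end points, while the derivative below exists only inside; together
  -- with integrability of the derivative this suffices for the fundamental theorem.
  have hScont : ContinuousOn (testedDensity G M ξ U φ) (Icc 0 T) := by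
    unfold testedDensity
    rw [restrict_rect]
    refine continuousOn_of_dominated (bound := fun _ => Cb * Cφ)
      (fun t ht => (mG t).mul (mφ t ht)) (fun t ht => hae (bGφ t ht)) (integrable_const _)
      (hae fun x hx => ?_)
    have hc1 : ContinuousOn (fun t => G (evalDG M ξ (U t) x)) (Icc 0 T) :=
      fun t ht => (hderG x hx t ht).continuousWithinAt
    exact hc1.mul (hφ.continuousOn.comp (f := fun t : ℝ => (t, x)) (by fun_prop)
      fun t ht => ⟨ht, hΩr x hx⟩)
  have hSder : ∀ t ∈ Ioo 0 T, HasDerivAt (testedDensity G M ξ U φ)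
      (∫ x in rect L₁ L₂, (A t x * φ t x + G (evalDG M ξ (U t) x) * dt φ t x)) t := by
    intro t ht
    unfold testedDensity
    rw [restrict_rect]
    have htc := Ioo_subset_Icc_self ht
    refine (hasDerivAt_integral_of_dominated_loc_of_deriv_le (μ := volume.restrict Ω)
      (F := fun s x => G (evalDG M ξ (U s) x) * φ s x)
      (F' := fun s x => A s x * φ s x + G (evalDG M ξ (U s) x) * dt φ s x)
      (bound := fun _ => K * Cφ + Cb * Cφ) (s := Ioo 0 T) (Ioo_mem_nhds ht.1 ht.2) ?_ ?_ ?_ ?_ ?_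
      ?_).2
    · filter_upwards [Ioo_mem_nhds ht.1 ht.2] with s hs
      exact (mG s).mul (mφ s (Ioo_subset_Icc_self hs))
    · exact IntegrableOn.of_bound hfin ((mG t).mul (mφ t htc)) _ (hae (bGφ t htc))
    · exact ((mA t).mul (mφ t htc)).add ((mG t).mul (mdt t ht))
    · exact hae fun x hx s hs => (norm_add_le _ _).trans
        (add_le_add (bAφ s (Ioo_subset_Icc_self hs) x hx) (bGdt s hs x hx))
    · exact integrable_const _
    · refine hae fun x hx s hs => ?_
      have d1 := (hderG x hx s (Ioo_subset_Icc_self hs)).hasDerivAt (Icc_mem_nhds hs.1 hs.2)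
      have d2 := hφ.hasDerivAt_time (t := s) (x := x) ⟨hs, hx⟩
      rw [← hφ.dt_eq (t := s) (x := x) ⟨hs, hx⟩] at d2
      exact d1.mul d2
  -- Continuity serves only to make the flux term measurable in time.
  have hRcont : ContinuousOn (testedFlux γ G g ψ M ξ U φ) (Ioo 0 T) := by
    unfold testedFlux
    rw [restrict_rect]
    refine continuousOn_of_dominated (bound := fun _ => Cb * Cφ + ∑ _d : Fin 2, Cb * Cφ)
      (fun t ht => ((mG t).mul (mdt t ht)).add (mF t ht))
      (fun t ht => hae fun x hx => (norm_add_le _ _).trans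
        (add_le_add (bGdt t ht x hx) (bF t ht x hx))) (integrable_const _) (hae fun x hx => ?_)
    have hc1 : ContinuousOn (fun t => G (evalDG M ξ (U t) x)) (Ioo 0 T) :=
      fun t ht => ((hderG x hx t (Ioo_subset_Icc_self ht)).continuousWithinAt).mono
        Ioo_subset_Icc_self
    have hmap : MapsTo (fun t : ℝ => (t, x)) (Ioo 0 T) (openCylinder T L₁ L₂) :=
      fun t ht => ⟨ht, hx⟩
    refine (hc1.mul ((hφ.continuousOn_dt hT h₁ h₂).comp (f := fun t : ℝ => (t, x)) (by fun_prop)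
      hmap)).add (continuousOn_finsetSum _ fun d _ => ContinuousOn.mul ?_
        ((hφ.continuousOn_dx hT h₁ h₂ d).comp (f := fun t : ℝ => (t, x)) (by fun_prop) hmap))
    have hFc : ContinuousOn (balanceFlux γ g ψ d) B := by
      refine (LipschitzOnWith.of_dist_le_mul (K := ⟨Cb, hC0⟩) fun V hV W hW => ?_).continuousOn
      rw [Real.dist_eq, dist_eq_norm]
      exact hb.flux_lip W hW V hV d
    exact hFc.comp ((hcontU x hx).mono Ioo_subset_Icc_self)
      fun t ht => hmem t (Ioo_subset_Icc_self ht) x hx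
  have hvolT : volume (Ioo 0 T) < ⊤ := by rw [Real.volume_Ioo]; exact ENNReal.ofReal_lt_top
  have hRbound : ∀ t ∈ Ioo 0 T, ‖testedFlux γ G g ψ M ξ U φ t‖ ≤
      (Cb * Cφ + ∑ _d : Fin 2, Cb * Cφ) * volume.real Ω := by
    intro t ht
    unfold testedFlux
    rw [restrict_rect]
    exact norm_setIntegral_le_of_norm_le_const hfin fun x hx => (norm_add_le _ _).trans
        (add_le_add (bGdt t ht x hx) (bF t ht x hx))
  have hRint : IntervalIntegrable (testedFlux γ G g ψ M ξ U φ) volume 0 T := by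
    rw [intervalIntegrable_iff_integrableOn_Ioo_of_le hT.le]
    exact IntegrableOn.of_bound hvolT (hRcont.aestronglyMeasurable measurableSet_Ioo) _
      ((ae_restrict_iff' measurableSet_Ioo).2 (ae_of_all _ hRbound))
  have hDbound : ∀ t ∈ Ioo 0 T, ‖deriv (testedDensity G M ξ U φ) t‖ ≤
      (K * Cφ + Cb * Cφ) * volume.real Ω := by
    intro t ht
    rw [(hSder t ht).deriv, restrict_rect]
    exact norm_setIntegral_le_of_norm_le_const hfin fun x hx => (norm_add_le _ _).trans
        (add_le_add (bAφ t (Ioo_subset_Icc_self ht) x hx) (bGdt t ht x hx))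
  -- A derivative is measurable in any case, so no regularity of the viscosity in time is needed;
  -- boundedness gives integrability.
  have hDint : IntervalIntegrable (deriv (testedDensity G M ξ U φ)) volume 0 T := by
    rw [intervalIntegrable_iff_integrableOn_Ioo_of_le hT.le]
    exact IntegrableOn.of_bound hvolT (measurable_deriv _).aestronglyMeasurable _
      ((ae_restrict_iff' measurableSet_Ioo).2 (ae_of_all _ hDbound))
  refine ⟨fun t ht => ?_, hDint.sub hRint, hRint, fun τ hτ => ?_⟩
  · unfold weakDefect testedFlux
    rw [(hSder t ht).deriv, restrict_rect]
    have htc := Ioo_subset_Icc_self ht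
    rw [integral_add (iAφ t htc) (iGdt t ht), integral_add (iGdt t ht) (iF t ht)]
    ring
  · have hsub : uIcc 0 τ ⊆ uIcc 0 T := by
      rw [uIcc_of_le hτ.1.le, uIcc_of_le hT.le]; exact Icc_subset_Icc_right hτ.2
    have d1 := hDint.mono_set hsub
    have d2 := hRint.mono_set hsub
    have ftc := intervalIntegral.integral_eq_sub_of_hasDerivAt_of_le hτ.1.le
      (hScont.mono (Icc_subset_Icc_right hτ.2))
      (fun t ht => (hSder t (Ioo_subset_Ioo_right hτ.2 ht)).differentiableAt.hasDerivAt) d1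
    unfold weakDefect
    rw [intervalIntegral.integral_sub d1 d2, ftc]
    ring

end WeakForm

/-! ### Vanishing of the defects along the sequence of meshes. -/

section Consistency

variable {γ : ℝ} {G : State → ℝ} {g : State → State} {ψ : Fin 2 → State → ℝ}
variable {p k : ℕ} {ξ ω : Fin (p + 1) → ℝ} {T L₁ L₂ : ℝ} {B : Set State} {Cb D Cφ R lamBar : ℝ}
variable {bc : BoundaryCondition} {φ : ℝ → ℝ × ℝ → ℝ}

lemma integrableOn_density {M : Mesh L₁ L₂} (hl : IsBalanceLaw γ G g ψ)
    (hb : BalanceBounds γ G g ψ B Cb) (hφ : IsSmoothTest (k + 1) T L₁ L₂ φ)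
    (hφb : TestBounds T L₁ L₂ φ Cφ) {c : Coeffs p} (hc : GridState B D M ξ c) {t : ℝ}
    (ht : t ∈ Icc 0 T) : IntegrableOn (fun x => G (evalDG M ξ c x) * φ t x) (rect L₁ L₂) := by
  unfold IntegrableOn
  rw [restrict_rect]
  have hms : MeasurableSet (Ioo 0 L₁ ×ˢ Ioo 0 L₂ : Set (ℝ × ℝ)) :=
    measurableSet_Ioo.prod measurableSet_Ioo
  refine IntegrableOn.of_bound (volume_Ioo_prod_lt_top L₁ L₂)
    ((hl.measurable_density.comp (measurable_evalDG M c)).aestronglyMeasurable.mul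
      (((hφ.continuousOn_slice ht).mono Ioo_prod_subset_rect).aestronglyMeasurable hms))
    (Cb * Cφ) ((ae_restrict_iff' hms).2 (ae_of_all _ fun x hx => ?_))
  rw [norm_mul]
  exact mul_le_mul (hb.density_le _ (hc.field_mem x (Ioo_prod_subset_Ico hx)))
    (hφb.abs_le t ht x (Ioo_prod_subset_rect hx)) (norm_nonneg _) hb.nonneg

lemma integrableOn_flux {M : Mesh L₁ L₂} (hl : IsBalanceLaw γ G g ψ)
    (hb : BalanceBounds γ G g ψ B Cb) (hφ : IsSmoothTest (k + 1) T L₁ L₂ φ)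
    (hφb : TestBounds T L₁ L₂ φ Cφ) (hT : 0 < T) (h₁ : 0 < L₁) (h₂ : 0 < L₂) {c : Coeffs p}
    (hc : GridState B D M ξ c) {t : ℝ} (ht : t ∈ Ioo 0 T) :
    IntegrableOn (fun x => G (evalDG M ξ c x) * dt φ t x
      + ∑ d, balanceFlux γ g ψ d (evalDG M ξ c x) * dx d φ t x) (rect L₁ L₂) := by
  unfold IntegrableOn
  rw [restrict_rect]
  have hms : MeasurableSet (Ioo 0 L₁ ×ˢ Ioo 0 L₂ : Set (ℝ × ℝ)) :=
    measurableSet_Ioo.prod measurableSet_Ioo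
  have hmeas := measurable_evalDG (ξ := ξ) M c
  refine IntegrableOn.of_bound (volume_Ioo_prod_lt_top L₁ L₂)
    (((hl.measurable_density.comp hmeas).aestronglyMeasurable.mul
      ((hφ.continuousOn_dt_slice hT h₁ h₂ ht).aestronglyMeasurable hms)).add
      (Finset.aestronglyMeasurable_fun_sum _ fun d _ =>
        ((hl.measurable_flux d).comp hmeas).aestronglyMeasurable.mul
        ((hφ.continuousOn_dx_slice hT h₁ h₂ d ht).aestronglyMeasurable hms)))
    (Cb * Cφ + ∑ _d : Fin 2, Cb * Cφ) ((ae_restrict_iff' hms).2 (ae_of_all _ fun x hx => ?_))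
  have hm := hc.field_mem x (Ioo_prod_subset_Ico hx)
  refine (norm_add_le _ _).trans (add_le_add ?_ ((norm_sum_le _ _).trans
    (Finset.sum_le_sum fun d _ => ?_)))
  · rw [norm_mul]
    exact mul_le_mul (hb.density_le _ hm) (hφb.dt_le t ht x hx) (norm_nonneg _) hb.nonneg
  · rw [norm_mul]
    exact mul_le_mul (hb.flux_le _ hm d) (hφb.dx_le t ht x hx d) (norm_nonneg _) hb.nonneg

lemma intervalIntegral_congr_Ioo {f f' : ℝ → ℝ} {τ : ℝ} (hτ : 0 ≤ τ)
    (h : ∀ t ∈ Ioo 0 τ, f t = f' t) : ∫ t in (0 : ℝ)..τ, f t = ∫ t in (0 : ℝ)..τ, f' t := by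
  rw [intervalIntegral.integral_of_le hτ, intervalIntegral.integral_of_le hτ,
    integral_Ioc_eq_integral_Ioo, integral_Ioc_eq_integral_Ioo]
  exact setIntegral_congr_fun measurableSet_Ioo h

lemma integral_rect_congr {f f' : ℝ × ℝ → ℝ} (h : ∀ x ∈ Ioo 0 L₁ ×ˢ Ioo 0 L₂, f x = f' x) :
    ∫ x in rect L₁ L₂, f x = ∫ x in rect L₁ L₂, f' x := by
  rw [restrict_rect]
  exact setIntegral_congr_fun (measurableSet_Ioo.prod measurableSet_Ioo) h

/-- The defects of a balance law along a sequence of refined meshes, up to the production of the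
faces, are controlled by a sequence of functions that tends to zero in the mean. -/
lemma exists_defect_majorant (hγ : 1 < γ) (hp : 1 ≤ p) (hGL : IsGaussLobatto p ξ ω)
    (hl : IsBalanceLaw γ G g ψ) (hb : BalanceBounds γ G g ψ B Cb) (hD : 0 ≤ D)
    (hpos : ∀ U ∈ B, 0 < dens U ∧ 0 < pressure γ U) (hB : ∀ d, ∀ U ∈ B, mirror d U ∈ B)
    (hR : ∀ U ∈ B, ‖U‖ ≤ R) (hT : 0 < T) (h₁ : 0 < L₁) (h₂ : 0 < L₂)
    {M : ℕ → Mesh L₁ L₂} (hM : Tendsto (fun n => (M n).h) atTop (𝓝 0))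
    {lam : ℕ → ℝ → State → State → ℝ} {U : ℕ → ℝ → Coeffs p}
    (h : ∀ n, BoundedSolution γ bc (M n) ξ ω B D lamBar T (lam n) (U n)) {K : ℝ}
    (hK : ∀ n, ∫ t in (0 : ℝ)..T, (M n).h * totalJump bc (M n) ω (U n t) ≤ K)
    (hφ : IsSmoothTest (k + 1) T L₁ L₂ φ) (hk : 1 ≤ k)
    (hbc : FitsBoundary bc γ g ψ T L₁ L₂ φ) :
    ∃ β : ℕ → ℝ → ℝ, (∀ n, IntervalIntegrable (β n) volume 0 T) ∧
      Tendsto (fun n => ∫ t in (0 : ℝ)..T, β n t) atTop (𝓝 0) ∧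
      ∀ n, ∀ t ∈ Ioo 0 T, |weakDefect γ G g ψ (M n) ξ (U n) φ t + (M n).h / 4 *
        ∑ i ∈ Finset.range (M n).N₁, ∑ j ∈ Finset.range (M n).N₂,
          cellFaces bc (M n) ω (U n t) (viscousProduction γ (lam n t) g ψ) (testNodes φ t (M n) ξ i j) i j|
        ≤ β n t := by
  obtain ⟨Cφ, hφb⟩ := hφ.exists_testBounds hk hT h₁ h₂
  obtain ⟨C, hC, hres⟩ := exists_residual_bound hγ hp hGL hl hb hD hpos hB hφ hφb hT h₁ h₂ hbc
    lamBar
  have hJint : ∀ n, IntervalIntegrable (fun t => (M n).h * totalJump bc (M n) ω (U n t)) volume 0 T :=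
    fun n => (continuousOn_const.mul (continuousOn_totalJump fun i hi j hj =>
      (h n).continuousOn hi hj)).intervalIntegrable_of_Icc hT.le
  have hβint : ∀ n, IntervalIntegrable (fun t => C * ((M n).h + √(M n).h
      + √(M n).h * ((M n).h * totalJump bc (M n) ω (U n t)))) volume 0 T := fun n =>
    (intervalIntegrable_const.add ((hJint n).const_mul _)).const_mul _
  refine ⟨fun n t => C * ((M n).h + √(M n).h + √(M n).h * ((M n).h * totalJump bc (M n) ω (U n t))),
    hβint, ?_, fun n t ht => ?_⟩
  · have hval : ∀ n, ∫ t in (0 : ℝ)..T, C * ((M n).h + √(M n).h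
        + √(M n).h * ((M n).h * totalJump bc (M n) ω (U n t))) =
        C * (T * ((M n).h + √(M n).h) + √(M n).h *
          ∫ t in (0 : ℝ)..T, (M n).h * totalJump bc (M n) ω (U n t)) := by
      intro n
      rw [intervalIntegral.integral_const_mul, intervalIntegral.integral_add
        intervalIntegrable_const ((hJint n).const_mul _), intervalIntegral.integral_const,
        intervalIntegral.integral_const_mul (√(M n).h), smul_eq_mul, sub_zero]
    have hsqrt : Tendsto (fun n => √(M n).h) atTop (𝓝 0) := by
      have := (Real.continuous_sqrt.tendsto 0).comp hM
      rwa [Real.sqrt_zero] at this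
    have hlim : Tendsto (fun n => C * (T * ((M n).h + √(M n).h) + √(M n).h * K)) atTop (𝓝 0) := by
      have := ((((hM.add hsqrt).const_mul T).add (hsqrt.mul_const K)).const_mul C)
      simpa using this
    -- The integral of the majorant is `√h` times the bounded jump integral plus terms of order `h`
    -- and `√h`.
    refine squeeze_zero (fun n => ?_) (fun n => ?_) hlim
    · refine intervalIntegral.integral_nonneg hT.le fun t _ => mul_nonneg hC ?_
      have := (M n).h_pos.le
      have := totalJump_nonneg hp hGL bc (M n) (U n t)
      positivity
    · rw [hval]
      exact mul_le_mul_of_nonneg_left (add_le_add le_rfl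
        (mul_le_mul_of_nonneg_left (hK n) (Real.sqrt_nonneg _))) hC
  · rw [(weak_formulation hp hGL hl hb hD hpos hB hR hφ hφb hT h₁ h₂ (h n)).1 t ht]
    exact (hres (M n) (U n t) (lam n t) ((h n).viscosity t)
      ((h n).grid t (Ioo_subset_Icc_self ht)) t ht).2.2

lemma tendsto_integral_abs_of_le {e β : ℕ → ℝ → ℝ} (hT : 0 < T)
    (he : ∀ n, IntervalIntegrable (e n) volume 0 T)
    (hβ : ∀ n, IntervalIntegrable (β n) volume 0 T)
    (hlim : Tendsto (fun n => ∫ t in (0 : ℝ)..T, β n t) atTop (𝓝 0))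
    (hle : ∀ n, ∀ t ∈ Ioo 0 T, |e n t| ≤ β n t) :
    Tendsto (fun n => ∫ t in (0 : ℝ)..T, |e n t|) atTop (𝓝 0) :=
  squeeze_zero (fun _ => intervalIntegral.integral_nonneg hT.le fun _ _ => abs_nonneg _)
    (fun n => intervalIntegral.integral_mono_on_of_le_Ioo hT.le (he n).abs (hβ n) (hle n)) hlim

/-- The position of the momentum components among the conservative variables. -/
def momIndex (a : Fin 2) : Fin 4 := ![1, 2] a

lemma mom_eq_coord (U : State) (a : Fin 2) : mom U a = U (momIndex a) := by
  fin_cases a <;> rfl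

lemma momIndex_val (a : Fin 2) : (momIndex a : ℕ) = a + 1 := by fin_cases a <;> rfl

lemma eulerFlux_momIndex (γ : ℝ) (d a : Fin 2) (U : State) :
    eulerFlux γ d U (momIndex a) =
      mom U a * mom U d / dens U + if d = a then pressure γ U else 0 := by
  fin_cases d <;> fin_cases a <;> simp [momIndex, eulerFlux, vel] <;> ring

lemma IsScalarTest.fitsBoundary (hφ : IsScalarTest bc k T L₁ L₂ φ)
    (hw : ∀ d, WallNeutral γ g ψ d) : FitsBoundary bc γ g ψ T L₁ L₂ φ := by
  cases bc with
  | periodic => exact hφ.2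
  | noFlux => exact ⟨Or.inl (hw 0), Or.inl (hw 1)⟩

/-- A momentum component has no flux through the walls to which it is tangential; at the walls to
which it is normal the pressure acts, and there its test function vanishes. -/
lemma IsVectorTest.fitsBoundary {φ : Fin 2 → ℝ → ℝ × ℝ → ℝ} (hφ : IsVectorTest bc k T L₁ L₂ φ)
    (a : Fin 2) : FitsBoundary bc γ (fun _ => Pi.single (momIndex a) 1) (fun _ _ => 0) T L₁ L₂
      (φ a) := by
  cases bc with
  | periodic => exact hφ.2 a
  | noFlux =>
    have hw : ∀ d, d ≠ a → WallNeutral γ (fun _ => Pi.single (momIndex a) 1) (fun _ _ => 0) d := by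
      intro d hd
      refine wallNeutral_coord fun h => hd ?_
      rw [momIndex_val] at h
      exact Fin.ext (by omega)
    fin_cases a
    · exact ⟨Or.inr fun t ht y hy => (hφ.2 t ht).1 y hy, Or.inl (hw 1 (by decide))⟩
    · exact ⟨Or.inl (hw 0 (by decide)), Or.inr fun t ht y hy => (hφ.2 t ht).2 y hy⟩

end Consistency

end EulerDG

end

/-! ### Assembly of the theorem. -/

open EulerDG in
theorem theorem3p3
    (γ : ℝ) (hγ : 1 < γ) (T L₁ L₂ : ℝ) (hT : 0 < T) (hL₁ : 0 < L₁) (hL₂ : 0 < L₂)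
    (bc : BoundaryCondition)
    -- polynomial degree, Gauss-Lobatto nodes and weights
    (p : ℕ) (hp : 1 ≤ p) (ξ ω : Fin (p + 1) → ℝ) (hGL : IsGaussLobatto p ξ ω)
    -- a sequence of meshes with mesh size tending to zero
    (M : ℕ → Mesh L₁ L₂) (hM : Tendsto (fun n => (M n).h) atTop (𝓝 0))
    -- the constants of the uniform bounds
    (ρmin Emax smin lamBar c : ℝ) (hρmin : 0 < ρmin)
    -- the viscosity of the Lax-Friedrichs flux: symmetric, at least `lamMax`, uniformly bounded
    (lam : ℕ → ℝ → State → State → ℝ)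
    (hlam_symm : ∀ n t U V, lam n t U V = lam n t V U)
    (hlam_ge : ∀ n t U V, lamMax γ U V ≤ lam n t U V)
    (hlam_le : ∀ n t U V, IsBoundedState γ ρmin Emax smin U →
      IsBoundedState γ ρmin Emax smin V → lam n t U V ≤ lamBar)
    -- solutions of the scheme
    (U : ℕ → ℝ → Coeffs p)
    (hU : ∀ n, IsDGSolution γ bc (M n) ξ ω (lam n) T (U n))
    -- uniform bounds for the numerical solutions
    (hbound : ∀ n, ∀ t ∈ Icc 0 T, ∀ x ∈ Ico 0 L₁ ×ˢ Ico 0 L₂,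
      IsBoundedState γ ρmin Emax smin (evalDG (M n) ξ (U n t) x))
    -- variation of order `h` of the nodal values within a cell
    (hosc : ∀ n, ∀ t ∈ Icc 0 T, ∀ i < (M n).N₁, ∀ j < (M n).N₂, ∀ a b a' b',
      ‖consEntropyVars γ (U n t i j a b) - consEntropyVars γ (U n t i j a' b')‖
        ≤ c * (M n).h) :
    let Uh : ℕ → ℝ → ℝ × ℝ → State := fun n t => evalDG (M n) ξ (U n t)
    -- consistency of the density, momentum and entropy equations
    (∃ eρ : ℕ → (ℝ → ℝ × ℝ → ℝ) → ℝ → ℝ,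
      ∀ φ, IsScalarTest bc (p + 1) T L₁ L₂ φ →
        (∀ n, IntervalIntegrable (eρ n φ) volume 0 T ∧
          ∀ τ ∈ Ioc 0 T,
            (∫ x in rect L₁ L₂, dens (Uh n τ x) * φ τ x)
              - (∫ x in rect L₁ L₂, dens (Uh n 0 x) * φ 0 x)
            = (∫ t in (0 : ℝ)..τ, ∫ x in rect L₁ L₂,
                (dens (Uh n t x) * dt φ t x + ∑ a, mom (Uh n t x) a * dx a φ t x))
              + ∫ t in (0 : ℝ)..τ, eρ n φ t) ∧
        Tendsto (fun n => ∫ t in (0 : ℝ)..T, |eρ n φ t|) atTop (𝓝 0)) ∧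
    (∃ em : ℕ → (Fin 2 → ℝ → ℝ × ℝ → ℝ) → ℝ → ℝ,
      ∀ φ, IsVectorTest bc (p + 1) T L₁ L₂ φ →
        (∀ n, IntervalIntegrable (em n φ) volume 0 T ∧
          ∀ τ ∈ Ioc 0 T,
            (∫ x in rect L₁ L₂, ∑ a, mom (Uh n τ x) a * φ a τ x)
              - (∫ x in rect L₁ L₂, ∑ a, mom (Uh n 0 x) a * φ a 0 x)
            = (∫ t in (0 : ℝ)..τ, ∫ x in rect L₁ L₂,
                ((∑ a, mom (Uh n t x) a * dt (φ a) t x)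
                  + (∑ a, ∑ b, mom (Uh n t x) a * mom (Uh n t x) b / dens (Uh n t x)
                      * dx b (φ a) t x)
                  + pressure γ (Uh n t x) * ∑ a, dx a (φ a) t x))
              + ∫ t in (0 : ℝ)..τ, em n φ t) ∧
        Tendsto (fun n => ∫ t in (0 : ℝ)..T, |em n φ t|) atTop (𝓝 0)) ∧
    (∃ eη : ℕ → (ℝ → ℝ × ℝ → ℝ) → ℝ → ℝ,
      ∀ φ, IsScalarTest bc (p + 1) T L₁ L₂ φ →
        (∀ t ∈ Icc 0 T, ∀ x ∈ rect L₁ L₂, 0 ≤ φ t x) →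
        (∀ n, IntervalIntegrable (eη n φ) volume 0 T ∧
          ∀ τ ∈ Ioc 0 T,
            (∫ x in rect L₁ L₂, mathEntropy γ (Uh n τ x) * φ τ x)
              - (∫ x in rect L₁ L₂, mathEntropy γ (Uh n 0 x) * φ 0 x)
            ≤ (∫ t in (0 : ℝ)..τ, ∫ x in rect L₁ L₂,
                (mathEntropy γ (Uh n t x) * dt φ t x
                  + ∑ a, mathEntropy γ (Uh n t x) * vel (Uh n t x) a * dx a φ t x))
              + ∫ t in (0 : ℝ)..τ, eη n φ t) ∧
        Tendsto (fun n => ∫ t in (0 : ℝ)..T, |eη n φ t|) atTop (𝓝 0)) ∧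
    -- conservation of the total energy
    (∀ n, ∀ τ ∈ Ioc 0 T,
      ∫ x in rect L₁ L₂, energy (Uh n τ x) = ∫ x in rect L₁ L₂, energy (Uh n 0 x)) := by
  intro Uh
  set B := boundedStates γ ρmin Emax smin with hBdef
  obtain ⟨δ, hcalc⟩ := exists_boundedCalculus hγ hρmin Emax smin
  have hpos : ∀ V ∈ B, 0 < dens V ∧ 0 < pressure γ V := fun V hV =>
    ⟨hcalc.pos.trans_le (hcalc.le_dens V hV), hcalc.pos.trans_le (hcalc.le_pressure V hV)⟩
  have hB : ∀ d, ∀ V ∈ B, mirror d V ∈ B := fun d V hV => mirror_mem_boundedStates d hV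
  obtain ⟨R, hR0, hR⟩ : ∃ R, 0 ≤ R ∧ ∀ V ∈ B, ‖V‖ ≤ R := by
    obtain ⟨R, hR0, hR⟩ := exists_common_bound hcalc.d_nonneg hcalc.coord
    exact ⟨R, hR0, fun V hV => (pi_norm_le_iff_of_nonneg hR0).2 fun k => (hR k V hV V hV).1⟩
  obtain ⟨Cv, hCv, hnorm⟩ := exists_norm_sub_le_consEntropyVars hγ hρmin Emax smin
  -- The sign of `c` is not prescribed, hence the absolute value. The factor `Cv` converts the
  -- variation of `(ρ, m, η)` into that of the conservative variables.
  have hD : 0 ≤ Cv * |c| := mul_nonneg hCv (abs_nonneg c)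
  have hsol : ∀ n, BoundedSolution γ bc (M n) ξ ω B (Cv * |c|) lamBar T (lam n) (U n) := fun n =>
    { solution := hU n
      viscosity := fun t => ⟨hlam_symm n t, hlam_ge n t, fun V hV W hW => hlam_le n t V W hV hW⟩
      grid := fun t ht => by
        have hnode : ∀ i < (M n).N₁, ∀ j < (M n).N₂, ∀ a b, U n t i j a b ∈ B :=
          fun i hi j hj a b => nodal_mem_boundedStates hρmin hGL (M n) (hbound n t ht) hi hj a b
        refine ⟨hbound n t ht, hnode, fun i hi j hj a b a' b' => ?_⟩
        refine (hnorm _ (hnode i hi j hj a b) _ (hnode i hi j hj a' b')).trans ?_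
        rw [mul_assoc]
        refine mul_le_mul_of_nonneg_left ((hosc n t ht i hi j hj a' b' a b).trans ?_) hCv
        exact mul_le_mul_of_nonneg_right (le_abs_self c) (M n).h_pos.le }
  have hη := isBalanceLaw_entropy hγ
  obtain ⟨Cη, hbη⟩ := hη.exists_bounds hγ hcalc
  obtain ⟨κ, hκ, hprod⟩ := exists_le_faceProduction_entropy hγ hρmin Emax smin
  -- The entropy balance provides the control of the jumps for all equations, those of mass and
  -- momentum included.
  have hK : ∀ n, ∫ t in (0 : ℝ)..T, (M n).h * totalJump bc (M n) ω (U n t) ≤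
      8 * (L₁ * L₂ * Cη) / κ := fun n =>
    integral_totalJump_le hγ hp hGL hη wallNeutral_entropy hpos hB hκ hprod hbη.density_le hT hL₁
      hL₂ (hsol n)
  have hcoord := fun k : Fin 4 => isBalanceLaw_coord (γ := γ) k
  choose Ck hbk using fun k : Fin 4 => (hcoord k).exists_bounds hγ hcalc
  have hflat : ∀ n t i j k φ, cellFaces bc (M n) ω (U n t) (viscousProduction γ (lam n t)
      (fun _ => Pi.single k 1) (fun _ _ => 0)) (testNodes φ t (M n) ξ i j) i j = 0 := by
    intro n t i j k φ
    simp [cellFaces, viscousProduction, faceProduction_coord]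
  have hmemU : ∀ n, ∀ t ∈ Icc 0 T, ∀ x ∈ Ioo 0 L₁ ×ˢ Ioo 0 L₂, Uh n t x ∈ B :=
    fun n t ht x hx => ((hsol n).grid t ht).field_mem x (Ioo_prod_subset_Ico hx)
  have hIoo : ∀ {τ t : ℝ}, τ ∈ Ioc 0 T → t ∈ Ioo 0 τ → t ∈ Ioo 0 T :=
    fun hτ ht => Ioo_subset_Ioo_right hτ.2 ht
  -- For mass and momentum the errors are the defects. For the entropy the positive part is taken:
  -- the defect contains minus the face production, which need not tend to zero and has the right
  -- sign for the inequality.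
  refine ⟨⟨fun n φ => weakDefect γ (fun V => V 0) (fun _ => Pi.single 0 1) (fun _ _ => 0) (M n) ξ
    (U n) φ, fun φ hφ => ?_⟩, ⟨fun n φ t => ∑ a, weakDefect γ (fun V => V (momIndex a))
    (fun _ => Pi.single (momIndex a) 1) (fun _ _ => 0) (M n) ξ (U n) (φ a) t, fun φ hφ => ?_⟩,
    ⟨fun n φ t => max (weakDefect γ (mathEntropy γ) (entropyVars γ) entropyPotential (M n) ξ (U n)
      φ t) 0, fun φ hφ hφ0 => ?_⟩, fun n τ hτ => ?_⟩
  · obtain ⟨Cφ, hφb⟩ := hφ.1.exists_testBounds hp hT hL₁ hL₂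
    obtain ⟨β, hβ, hlim, hle⟩ := exists_defect_majorant hγ hp hGL (hcoord 0) (hbk 0) hD hpos hB hR
      hT hL₁ hL₂ hM hsol hK hφ.1 hp
      (hφ.fitsBoundary fun d => wallNeutral_coord (by simp))
    have hweak := fun n => weak_formulation hp hGL (hcoord 0) (hbk 0) hD hpos hB hR hφ.1 hφb hT
      hL₁ hL₂ (hsol n)
    refine ⟨fun n => ⟨(hweak n).2.1, fun τ hτ => ((hweak n).2.2.2 τ hτ).trans ?_⟩,
      tendsto_integral_abs_of_le hT (fun n => (hweak n).2.1) hβ hlim fun n t ht => ?_⟩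
    · congr 1
      refine intervalIntegral_congr_Ioo hτ.1.le fun t ht => integral_rect_congr fun x hx => ?_
      have hd := (hpos _ (hmemU n t (Ioo_subset_Icc_self (hIoo hτ ht)) x hx)).1.ne'
      simp only [balanceFlux_coord]
      congr 1
      refine Finset.sum_congr rfl fun a _ => ?_
      rw [mom_eq hd]
      rfl
    · simpa only [hflat, Finset.sum_const_zero, mul_zero, add_zero] using hle n t ht
  · choose Cφ hφb using fun a => (hφ.1 a).exists_testBounds hp hT hL₁ hL₂
    choose β hβ hlim hle using fun a => exists_defect_majorant hγ hp hGL (hcoord (momIndex a))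
      (hbk (momIndex a)) hD hpos hB hR hT hL₁ hL₂ hM hsol hK (hφ.1 a) hp (hφ.fitsBoundary a)
    have hweak := fun n a => weak_formulation hp hGL (hcoord (momIndex a)) (hbk (momIndex a)) hD
      hpos hB hR (hφ.1 a) (hφb a) hT hL₁ hL₂ (hsol n)
    have hint : ∀ n, IntervalIntegrable (fun t => ∑ a, weakDefect γ (fun V => V (momIndex a))
        (fun _ => Pi.single (momIndex a) 1) (fun _ _ => 0) (M n) ξ (U n) (φ a) t) volume 0 T :=
      fun n => by
        simpa only [Fin.sum_univ_two] using (hweak n 0).2.1.add (hweak n 1).2.1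
    refine ⟨fun n => ⟨hint n, fun τ hτ => ?_⟩, ?_⟩
    · have hτc : τ ∈ Icc 0 T := Ioc_subset_Icc_self hτ
      have hsub : uIcc 0 τ ⊆ uIcc 0 T := by
        rw [uIcc_of_le hτ.1.le, uIcc_of_le hT.le]; exact Icc_subset_Icc_right hτ.2
      have hden : ∀ t ∈ Icc 0 T, ∫ x in rect L₁ L₂, ∑ a, mom (Uh n t x) a * φ a t x =
          ∑ a, testedDensity (fun V => V (momIndex a)) (M n) ξ (U n) (φ a) t := by
        intro t ht
        simp only [mom_eq_coord]
        exact integral_finsetSum _ fun a _ => integrableOn_density (hcoord (momIndex a))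
          (hbk (momIndex a)) (hφ.1 a) (hφb a) ((hsol n).grid t ht) ht
      rw [hden τ hτc, hden 0 ⟨le_rfl, hT.le⟩, ← Finset.sum_sub_distrib,
        Finset.sum_congr rfl fun a _ => (hweak n a).2.2.2 τ hτ, Finset.sum_add_distrib,
        intervalIntegral.integral_finsetSum fun a _ => (hweak n a).2.1.mono_set hsub]
      congr 1
      rw [← intervalIntegral.integral_finsetSum fun a _ => (hweak n a).2.2.1.mono_set hsub]
      refine intervalIntegral_congr_Ioo hτ.1.le fun t ht => ?_
      have htT := hIoo hτ ht
      unfold testedFlux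
      rw [← integral_finsetSum _ fun a _ => integrableOn_flux (hcoord (momIndex a))
          (hbk (momIndex a)) (hφ.1 a) (hφb a) hT hL₁ hL₂
          ((hsol n).grid t (Ioo_subset_Icc_self htT)) htT]
      refine integral_rect_congr fun x _ => ?_
      simp only [balanceFlux_coord, eulerFlux_momIndex, Uh]
      simp only [← mom_eq_coord, Fin.sum_univ_two, Fin.isValue, if_true, zero_ne_one, one_ne_zero,
        if_false]
      ring
    · refine tendsto_integral_abs_of_le hT hint (β := fun n t => ∑ a, β a n t) (fun n => ?_) ?_
        fun n t ht => ?_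
      · simpa only [Fin.sum_univ_two] using (hβ 0 n).add (hβ 1 n)
      · have := (hlim 0).add (hlim 1)
        rw [add_zero] at this
        refine this.congr fun n => ?_
        simp only [Fin.sum_univ_two]
        rw [intervalIntegral.integral_add (hβ 0 n) (hβ 1 n)]
      · refine (Finset.abs_sum_le_sum_abs _ _).trans (Finset.sum_le_sum fun a _ => ?_)
        simpa only [hflat, Finset.sum_const_zero, mul_zero, add_zero] using hle a n t ht
  · obtain ⟨Cφ, hφb⟩ := hφ.1.exists_testBounds hp hT hL₁ hL₂
    obtain ⟨β, hβ, hlim, hle⟩ := exists_defect_majorant hγ hp hGL hη hbη hD hpos hB hR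
      hT hL₁ hL₂ hM hsol hK hφ.1 hp (hφ.fitsBoundary wallNeutral_entropy)
    have hweak := fun n => weak_formulation hp hGL hη hbη hD hpos hB hR hφ.1 hφb hT
      hL₁ hL₂ (hsol n)
    have hint : ∀ n, IntervalIntegrable (fun t => max (weakDefect γ (mathEntropy γ) (entropyVars γ)
        entropyPotential (M n) ξ (U n) φ t) 0) volume 0 T := fun n =>
      ⟨(hweak n).2.1.1.sup integrableOn_zero, (hweak n).2.1.2.sup integrableOn_zero⟩
    refine ⟨fun n => ⟨hint n, fun τ hτ => ?_⟩,
      tendsto_integral_abs_of_le hT hint hβ hlim fun n t ht => ?_⟩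
    · have hsub : uIcc 0 τ ⊆ uIcc 0 T := by
        rw [uIcc_of_le hτ.1.le, uIcc_of_le hT.le]; exact Icc_subset_Icc_right hτ.2
      refine ((hweak n).2.2.2 τ hτ).le.trans (add_le_add (le_of_eq ?_) ?_)
      · refine intervalIntegral_congr_Ioo hτ.1.le fun t ht => integral_rect_congr fun x hx => ?_
        obtain ⟨q1, q2⟩ := hpos _ (hmemU n t (Ioo_subset_Icc_self (hIoo hτ ht)) x hx)
        congr 1
        refine Finset.sum_congr rfl fun a _ => ?_
        rw [balanceFlux, entropyVars_dot_eulerFlux hγ a q1 q2]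
      · exact intervalIntegral.integral_mono_on hτ.1.le ((hweak n).2.1.mono_set hsub)
          ((hint n).mono_set hsub) fun t _ => le_max_left _ _
    · have htc := Ioo_subset_Icc_self ht
      -- The only place where the sign of the test function enters.
      have hprod0 : 0 ≤ (M n).h / 4 * ∑ i ∈ Finset.range (M n).N₁, ∑ j ∈ Finset.range (M n).N₂,
          cellFaces bc (M n) ω (U n t) (viscousProduction γ (lam n t) (entropyVars γ) entropyPotential)
            (testNodes φ t (M n) ξ i j) i j := by
        refine mul_nonneg (by have := (M n).h_pos; positivity) (Finset.sum_nonneg fun i hi =>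
          Finset.sum_nonneg fun j hj => ?_)
        rw [Finset.mem_range] at hi hj
        have := cellFaces_mono hp hGL hB bc (M n) ((hsol n).grid t htc).nodal_mem
          (P := fun _ _ _ _ => 0) (Q := viscousProduction γ (lam n t) (entropyVars γ) entropyPotential)
          (fun d sgn hs V hV W hW => (mul_nonneg hκ.le (sq_nonneg _)).trans
            (hprod V hV W hW _ (hlam_ge n t V W) d sgn hs))
          (x := testNodes φ t (M n) ξ i j)
          (fun a b => hφ0 t htc _ (node_mem_rect hGL (M n) hi hj a b)) hi hj
        refine le_trans (le_of_eq ?_) this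
        simp [cellFaces]
      have hb := hle n t ht
      have hβ0 := (abs_nonneg _).trans hb
      rw [abs_of_nonneg (le_max_right _ _)]
      -- The residual is the defect plus a nonnegative production and is at most `β`, so the same
      -- majorant bounds the defect from above.
      exact max_le (by linarith [(abs_le.1 hb).2]) hβ0
  · exact integral_coord_eq hγ hp hGL (k := 3) (by decide) hpos hL₁ hL₂ (hsol n)
      (Ioc_subset_Icc_self hτ)
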